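/- Let $U\subset\mathbb C^m$ be open (the image of a holomorphic coordinate chart of a Kähler manifold, with coordinates $z^1,\dots,z^m$), and let $\Phi=\frac1h\Phi_{-1}+\Phi_0+\Phi_1h+\Phi_2h^2+\cdots$, with $\Phi_k\in C^\infty(U)$ (smooth, complex valued) for $k\ge -1$, be a formal potential of a formal deformation $\omega=i\partial\bar\partial\Phi$ of the Kähler form; that is, the matrix $g_{p\bar q}=\partial^2\Phi_{-1}/\partial z^p\partial\bar z^q$ is Hermitian positive definite at every point of $U$. Write $g^{\bar q p}$ for the entries of the inverse matrix. For $n\ge 0$ let $\mathcal A_n$ be the set of isomorphism classes of finite directed graphs $G$ (parallel edges allowed) without directed cycles, with $n$ numbered external vertices and a set $\mathrm{Int}(G)$ of internal vertices, each internal vertex $v$ carrying a weight $w(v)\in\{-1,0,1,2,\dots\}$, such that every internal vertex has at least one incoming and at least one outgoing edge, every internal vertex of weight $-1$ has degree at least $3$, the first external vertex has no incoming edge and the last external vertex has no outgoing edge. Isomorphisms are pairs of bijections of the vertices and of the edges that preserve heads, tails, weights, and each external vertex with its number; $\mathrm{Aut}(G)$ is the group of automorphisms. The total weight is $W(G)=|E_G|+\sum_{v\in\mathrm{Int}(G)}w(v)$;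 it is nonnegative, and there are finitely many classes of each total weight. For $G\in\mathcal A_n$ and $f_1,\dots,f_n\in C^\infty(U)$ define the partition function $\Gamma_G(f_1,\dots,f_n)\in C^\infty(U)$ as follows: a vertex with $p$ incoming and $q$ outgoing edges is assigned the tensor of partial derivatives $\partial^{p+q}F/\partial z^{i_1}\cdots\partial z^{i_p}\partial\bar z^{j_1}\cdots\partial\bar z^{j_q}$, one holomorphic index for each incoming and one anti-holomorphic index for each outgoing edge, where $F=f_k$ for the $k$-th external vertex and $F=-\Phi_w$ for an internal vertex of weight $w$; these tensors are multiplied and contracted along the edges, an edge with index $s$ at its tail and index $r$ at its head contributing the factor $g^{\bar s r}$, and all indices are summed over $\{1,\dots,m\}$. Set $$D_k(f_1,\dots,f_n)=\sum_{G\in\mathcal A_n,\;W(G)=k}\frac{1}{|\mathrm{Aut}(G)|}\,\Gamma_G(f_1,\dots,f_n),\qquad D=\sum_{k\ge 0}D_k\,h^k ,$$ and extend $D$ to formal functions, i.e. elements of $C^\infty(U)[[h]]$, multilinearly over $\mathbb C[[h]]$: the coefficient of $h^N$ in $D(F_1,\dots,F_n)$, where $F_i=\sum_j F_{i,j}h^j$,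 is $\sum_{k+j_1+\cdots+j_n=N}D_k(F_{1,j_1},\dots,F_{n,j_n})$. **Theorem.** For all $f_1,f_2,f_3\in C^\infty(U)[[h]]$, in particular for all $f_1,f_2,f_3\in C^\infty(U)$, $$D(f_1,D(f_2,f_3))=D(f_1,f_2,f_3)=D(D(f_1,f_2),f_3)\quad\text{on }U.$$ -/

import Mathlib

open scoped ContDiff ComplexOrder

namespace KahlerStar

/-! ## Weighted acyclic graphs -/

/-- A weighted acyclic directed graph (parallel edges allowed) with `n` numbered external vertices,
with `I` as its set of internal vertices and `E` as its set of edges.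
The vertex set is `Fin n ⊕ I`; the edge `e` runs from `tail e` to `head e`. -/
structure Graph (n : ℕ) (I E : Type) where
  tail : E → Fin n ⊕ I
  head : E → Fin n ⊕ I
  /-- the weights of the internal vertices -/
  weight : I → ℤ
  neg_one_le_weight : ∀ i, -1 ≤ weight i
  /-- there are no directed cycles, in particular no loops -/
  acyclic : ∀ v, ¬ Relation.TransGen (fun u w => ∃ e, tail e = u ∧ head e = w) v v
  /-- an internal vertex is not a source -/
  exists_incoming : ∀ i : I, ∃ e, head e = Sum.inr i
  /-- an internal vertex is not a sink -/
  exists_outgoing : ∀ i : I, ∃ e, tail e = Sum.inr i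
  /-- the first external vertex is a source -/
  first_source : ∀ k : Fin n, (k : ℕ) = 0 → ∀ e, head e ≠ Sum.inl k
  /-- the last external vertex is a sink -/
  last_sink : ∀ k : Fin n, (k : ℕ) + 1 = n → ∀ e, tail e ≠ Sum.inl k
  /-- an internal vertex of weight `-1` has degree at least three -/
  three_le_degree : ∀ i : I, weight i = -1 →
    3 ≤ Nat.card {e // head e = Sum.inr i} + Nat.card {e // tail e = Sum.inr i}

/-- An isomorphism of graphs: a bijection on internal vertices and a bijection on edges, compatible
with heads, tails and weights; each external vertex is sent to the external vertex with the same
number. -/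
@[ext]
structure Iso {n : ℕ} {I E I' E' : Type} (G : Graph n I E) (G' : Graph n I' E') where
  vert : I ≃ I'
  edge : E ≃ E'
  map_tail : ∀ e, G'.tail (edge e) = Sum.map id vert (G.tail e)
  map_head : ∀ e, G'.head (edge e) = Sum.map id vert (G.head e)
  map_weight : ∀ i, G'.weight (vert i) = G.weight i

/-- The total weight: the number of edges plus the sum of the weights of the internal vertices. -/
def Graph.totalWeight {n : ℕ} {I E : Type} [Fintype I] [Fintype E] (G : Graph n I E) : ℤ :=
  (Fintype.card E : ℤ) + ∑ i, G.weight i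

/-- Finite graphs with `n` external vertices. Up to isomorphism, the internal vertices are numbered
by `Fin a` and the edges by `Fin b`. -/
def FinGraph (n : ℕ) : Type := Σ a : ℕ, Σ b : ℕ, Graph n (Fin a) (Fin b)

/-- The graph underlying an element of `FinGraph n`. -/
def FinGraph.graph {n : ℕ} (G : FinGraph n) : Graph n (Fin G.1) (Fin G.2.1) := G.2.2

/-- Two finite graphs are equivalent when they are isomorphic. -/
instance isoSetoid (n : ℕ) : Setoid (FinGraph n) where
  r G G' := Nonempty (Iso G.graph G'.graph)
  iseqv :=
    { refl := fun _ => ⟨⟨Equiv.refl _, Equiv.refl _, by simp, by simp, by simp⟩⟩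
      symm := by
        rintro G G' ⟨φ⟩
        refine ⟨⟨φ.vert.symm, φ.edge.symm, fun e => ?_, fun e => ?_, fun i => ?_⟩⟩
        · have h := φ.map_tail (φ.edge.symm e)
          rw [Equiv.apply_symm_apply] at h
          rw [h, Sum.map_map]
          simp
        · have h := φ.map_head (φ.edge.symm e)
          rw [Equiv.apply_symm_apply] at h
          rw [h, Sum.map_map]
          simp
        · have h := φ.map_weight (φ.vert.symm i)
          rw [Equiv.apply_symm_apply] at h
          exact h.symm
      trans := by
        rintro G G' G'' ⟨φ⟩ ⟨ψ⟩
        refine ⟨⟨φ.vert.trans ψ.vert, φ.edge.trans ψ.edge, fun e => ?_, fun e => ?_, fun i => ?_⟩⟩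
        · simp [ψ.map_tail, φ.map_tail, Sum.map_map]
        · simp [ψ.map_head, φ.map_head, Sum.map_map]
        · simp [ψ.map_weight, φ.map_weight] }

/-- The set of isomorphism classes of finite acyclic weighted graphs with `n` external vertices. -/
def IsoClass (n : ℕ) : Type := Quotient (isoSetoid n)

/-- A representative of an isomorphism class. -/
noncomputable def IsoClass.rep {n : ℕ} (c : IsoClass n) : FinGraph n := Quotient.out c

/-- The set of isomorphism classes of graphs of total weight `k`. -/
def IsoClassOfWeight (n k : ℕ) : Type :=
  {c : IsoClass n // c.rep.graph.totalWeight = (k : ℤ)}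

/-! ### There are finitely many graphs of a given total weight -/

namespace Graph

variable {n : ℕ} {I E : Type} [Fintype I] [Fintype E]

theorem sum_fiber_le (f : E → Fin n ⊕ I) :
    ∑ i, Nat.card {e // f e = Sum.inr i} ≤ Fintype.card E := by
  classical
  rw [← Nat.card_eq_fintype_card, ← Nat.card_sigma]
  refine Nat.card_le_card_of_injective (fun p : Σ i, {e // f e = Sum.inr i} => p.2.1) ?_
  rintro ⟨i, e, he⟩ ⟨j, e', he'⟩ h
  obtain rfl : e = e' := h
  obtain rfl : i = j := Sum.inr_injective (he.symm.trans he')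
  rfl

/-- The total weight of a graph is at least a third of its number of edges; in particular it is
nonnegative. -/
theorem card_edge_le (G : Graph n I E) : (Fintype.card E : ℤ) ≤ 3 * G.totalWeight := by
  have h1 := sum_fiber_le G.head
  have h2 := sum_fiber_le G.tail
  have h3 : ∀ i ∈ (Finset.univ : Finset I), (0 : ℤ) ≤ 3 * G.weight i +
      ((Nat.card {e // G.head e = Sum.inr i} : ℤ) +
        (Nat.card {e // G.tail e = Sum.inr i} : ℤ)) := by
    intro i _
    have := G.neg_one_le_weight i
    have := G.three_le_degree i
    omega
  have h4 := Finset.sum_nonneg h3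
  rw [Finset.sum_add_distrib, Finset.sum_add_distrib, ← Finset.mul_sum] at h4
  unfold totalWeight
  zify at h1 h2
  linarith

theorem card_vert_le (G : Graph n I E) : Fintype.card I ≤ Fintype.card E := by
  choose e he using G.exists_incoming
  refine Fintype.card_le_of_injective e fun i j h => ?_
  have := he j
  rw [← h, he i] at this
  exact Sum.inr_injective this

theorem weight_lt (G : Graph n I E) (i : I) : G.weight i < G.totalWeight := by
  have h1 := Finset.single_le_sum (s := Finset.univ) (f := fun j => G.weight j + 1)
    (fun j _ => by have := G.neg_one_le_weight j; linarith) (Finset.mem_univ i)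
  rw [Finset.sum_add_distrib] at h1
  have h2 := G.card_vert_le
  unfold totalWeight
  zify at h2
  simp at h1
  linarith

end Graph

instance finite_finGraph (n k : ℕ) :
    Finite {G : FinGraph n // G.graph.totalWeight = (k : ℤ)} := by
  have hfin : Finite (Σ a : Fin (3 * k + 1), Σ b : Fin (3 * k + 1),
      (Fin b → Fin n ⊕ Fin a) × (Fin b → Fin n ⊕ Fin a) ×
        (Fin a → Finset.Icc (-1 : ℤ) k)) := inferInstance
  have hb : ∀ G : {G : FinGraph n // G.graph.totalWeight = (k : ℤ)}, G.1.2.1 < 3 * k + 1 := by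
    rintro ⟨G, hG⟩
    have h := G.graph.card_edge_le
    rw [hG, Fintype.card_fin] at h
    show G.2.1 < _
    omega
  have ha : ∀ G : {G : FinGraph n // G.graph.totalWeight = (k : ℤ)}, G.1.1 < 3 * k + 1 := by
    rintro ⟨G, hG⟩
    have h := G.graph.card_vert_le
    have h' := hb ⟨G, hG⟩
    rw [Fintype.card_fin, Fintype.card_fin] at h
    exact lt_of_le_of_lt h h'
  refine Finite.of_injective (β := Σ a : Fin (3 * k + 1), Σ b : Fin (3 * k + 1),
      (Fin b → Fin n ⊕ Fin a) × (Fin b → Fin n ⊕ Fin a) ×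
        (Fin a → Finset.Icc (-1 : ℤ) k))
    (fun G => ⟨⟨G.1.1, ha G⟩, ⟨G.1.2.1, hb G⟩, G.1.graph.tail, G.1.graph.head,
      fun i => ⟨G.1.graph.weight i, Finset.mem_Icc.2 ⟨G.1.graph.neg_one_le_weight i,
        by have := G.1.graph.weight_lt i; rw [G.2] at this; exact this.le⟩⟩⟩) ?_
  rintro ⟨⟨a, b, G⟩, hG⟩ ⟨⟨a', b', G'⟩, hG'⟩ h
  rw [Sigma.mk.injEq] at h
  obtain ⟨h1, h2⟩ := h
  obtain rfl : a = a' := congrArg Fin.val h1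
  rw [heq_eq_eq, Sigma.mk.injEq] at h2
  obtain ⟨h3, h4⟩ := h2
  obtain rfl : b = b' := congrArg Fin.val h3
  rw [heq_eq_eq, Prod.mk.injEq, Prod.mk.injEq] at h4
  obtain ⟨h5, h6, h7⟩ := h4
  have h8 : G.weight = G'.weight := by
    funext i
    exact congrArg Subtype.val (congrFun h7 i)
  have h9 : G = G' := by
    cases G
    cases G'
    simp only [FinGraph.graph] at h5 h6 h8
    subst h5 h6 h8
    rfl
  subst h9
  rfl

instance finite_isoClassOfWeight (n k : ℕ) : Finite (IsoClassOfWeight n k) :=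
  Finite.of_injective
    (fun c : IsoClassOfWeight n k =>
      (⟨c.1.rep, c.2⟩ : {G : FinGraph n // G.graph.totalWeight = (k : ℤ)}))
    (by
      intro c c' h
      have h' : c.1.rep = c'.1.rep := congrArg Subtype.val h
      apply Subtype.ext
      have := congrArg (Quotient.mk (isoSetoid n)) h'
      exact (Quotient.out_eq c.1).symm.trans (this.trans (Quotient.out_eq c'.1)))

noncomputable instance fintype_isoClassOfWeight (n k : ℕ) : Fintype (IsoClassOfWeight n k) :=
  Fintype.ofFinite _

/-! ## Wirtinger derivatives and the metric -/

variable {m : ℕ}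

/-- The Wirtinger derivative `∂f/∂zⁱ = (∂f/∂xⁱ - √-1 ∂f/∂yⁱ) / 2` on `ℂᵐ`. -/
noncomputable def dz (i : Fin m) (f : (Fin m → ℂ) → ℂ) : (Fin m → ℂ) → ℂ := fun x =>
  (fderiv ℝ f x (Pi.single i 1) - Complex.I * fderiv ℝ f x (Pi.single i Complex.I)) / 2

/-- The Wirtinger derivative `∂f/∂z̄ⁱ = (∂f/∂xⁱ + √-1 ∂f/∂yⁱ) / 2` on `ℂᵐ`. -/
noncomputable def dzbar (i : Fin m) (f : (Fin m → ℂ) → ℂ) : (Fin m → ℂ) → ℂ := fun x =>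
  (fderiv ℝ f x (Pi.single i 1) + Complex.I * fderiv ℝ f x (Pi.single i Complex.I)) / 2

/-- The mixed partial derivative `∂_z^α ∂_z̄^β f` for multi-indices `α` and `β` (on smooth functions
the order of the differentiations does not matter). -/
noncomputable def mixedDeriv (α β : Fin m → ℕ) (f : (Fin m → ℂ) → ℂ) : (Fin m → ℂ) → ℂ :=
  (List.finRange m).foldr (fun i u => (dz i)^[α i] u)
    ((List.finRange m).foldr (fun i u => (dzbar i)^[β i] u) f)

theorem mixedDeriv_zero (α β : Fin m → ℕ) : mixedDeriv α β (0 : (Fin m → ℂ) → ℂ) = 0 := by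
  have h1 : ∀ i : Fin m, dz i (0 : (Fin m → ℂ) → ℂ) = 0 := fun i => by
    funext x
    simp [dz]
  have h2 : ∀ i : Fin m, dzbar i (0 : (Fin m → ℂ) → ℂ) = 0 := fun i => by
    funext x
    simp [dzbar]
  have h3 : ∀ L : List (Fin m), L.foldr (fun i u => (dzbar i)^[β i] u)
      (0 : (Fin m → ℂ) → ℂ) = 0 := fun L => by
    induction L with
    | nil => rfl
    | cons i L ih => rw [List.foldr_cons, ih, Function.iterate_fixed (h2 i)]
  have h4 : ∀ L : List (Fin m), L.foldr (fun i u => (dz i)^[α i] u)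
      (0 : (Fin m → ℂ) → ℂ) = 0 := fun L => by
    induction L with
    | nil => rfl
    | cons i L ih => rw [List.foldr_cons, ih, Function.iterate_fixed (h1 i)]
  rw [mixedDeriv, h3, h4]

/-- The matrix `g_{p q̄} = ∂²Φ₋₁ / ∂z^p ∂z̄^q` at the point `x`. -/
noncomputable def metric (Φ : ℤ → (Fin m → ℂ) → ℂ) (x : Fin m → ℂ) : Matrix (Fin m) (Fin m) ℂ :=
  Matrix.of fun p q => dz p (dzbar q (Φ (-1))) x

/-! ## Partition functions -/

section Partition

variable {n : ℕ} {I E : Type}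

/-- A labelling assigns to each edge `e` an index `(l e).1` at its tail and an index `(l e).2` at
its head. This is the multi-index counting the labels among the incoming edges of the vertex `v`. -/
noncomputable def Graph.inIndex (G : Graph n I E) (l : E → Fin m × Fin m) (v : Fin n ⊕ I) :
    Fin m → ℕ :=
  fun i => Nat.card {e // G.head e = v ∧ (l e).2 = i}

/-- The multi-index counting the labels among the outgoing edges of the vertex `v`. -/
noncomputable def Graph.outIndex (G : Graph n I E) (l : E → Fin m × Fin m) (v : Fin n ⊕ I) :
    Fin m → ℕ :=
  fun i => Nat.card {e // G.tail e = v ∧ (l e).1 = i}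

/-- The function differentiated at a vertex: `f_k` at the `k`-th external vertex, and `-Φ_w` at an
internal vertex of weight `w`. -/
def Graph.vertexFun (G : Graph n I E) (Φ : ℤ → (Fin m → ℂ) → ℂ) (f : Fin n → (Fin m → ℂ) → ℂ) :
    Fin n ⊕ I → (Fin m → ℂ) → ℂ :=
  Sum.elim f (fun i => -Φ (G.weight i))

open Classical in
/-- The partition function of a graph with values in functions: incoming edges of a vertex
differentiate in the holomorphic directions, outgoing edges in the anti-holomorphic ones, and the
resulting tensors are contracted along the edges with the inverse metric. The contraction is
written as the sum over all labellings `l`; an edge contributes the entry `g^{s̄ r}` of the inverse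
of the matrix `g_{p q̄}`, where `s` is the label at its tail and `r` the label at its head. -/
noncomputable def Graph.partitionFun [Fintype I] [Fintype E] (G : Graph n I E)
    (Φ : ℤ → (Fin m → ℂ) → ℂ) (f : Fin n → (Fin m → ℂ) → ℂ) : (Fin m → ℂ) → ℂ := fun x =>
    ∑ l : E → Fin m × Fin m,
      (∏ v, mixedDeriv (G.inIndex l v) (G.outIndex l v) (G.vertexFun Φ f v) x) *
        ∏ e, (metric Φ x)⁻¹ (l e).1 (l e).2

end Partition

/-! ## The multi-differential operator `D` -/

/-- `D_k(f₁, …, fₙ)`: the sum of `Γ_G(f₁, …, fₙ) / |Aut G|` over all isomorphism classes of graphs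
with `n` external vertices and total weight `k`. -/
noncomputable def Dk (Φ : ℤ → (Fin m → ℂ) → ℂ) {n : ℕ} (k : ℕ) (f : Fin n → (Fin m → ℂ) → ℂ) :
    (Fin m → ℂ) → ℂ := fun x =>
  ∑ c : IsoClassOfWeight n k,
    (1 / (Nat.card (Iso c.1.rep.graph c.1.rep.graph) : ℂ)) * c.1.rep.graph.partitionFun Φ f x

/-- Formal power series in `h` whose coefficients are complex functions on `ℂᵐ`. -/
abbrev FormalFun (m : ℕ) : Type := PowerSeries ((Fin m → ℂ) → ℂ)

/-- A formal function is smooth on `U` if all its coefficients are. -/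
def FormalFun.SmoothOn (F : FormalFun m) (U : Set (Fin m → ℂ)) : Prop :=
  ∀ k, ContDiffOn ℝ ∞ (PowerSeries.coeff k F) U

/-- Equality of formal functions on `U`. -/
def FormalFun.EqOn (F F' : FormalFun m) (U : Set (Fin m → ℂ)) : Prop :=
  ∀ k, Set.EqOn (PowerSeries.coeff k F) (PowerSeries.coeff k F') U

/-- The operator `D = ∑ D_k h^k`, extended `h`-multilinearly to formal functions: the coefficient of
`h^N` in `D(F₁, …, Fₙ)` is the sum of `D_k(F_{1,j₁}, …, F_{n,jₙ})` over all `k, j₁, …, jₙ` with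
`k + j₁ + ⋯ + jₙ = N`, where `F_{i,j}` is the coefficient of `h^j` in `F_i`. -/
noncomputable def D (Φ : ℤ → (Fin m → ℂ) → ℂ) {n : ℕ} (F : Fin n → FormalFun m) : FormalFun m :=
  PowerSeries.mk fun N =>
    ∑ p ∈ Finset.Nat.antidiagonalTuple (n + 1) N,
      Dk Φ (p 0) (fun i => PowerSeries.coeff (p i.succ) (F i))

/-- On functions without `h`, the coefficient of `h^k` in `D(f₁, …, fₙ)` is `D_k(f₁, …, fₙ)`. -/
theorem coeff_D_C (Φ : ℤ → (Fin m → ℂ) → ℂ) {n : ℕ} (f : Fin n → (Fin m → ℂ) → ℂ) (k : ℕ) :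
    PowerSeries.coeff k (D Φ fun i => PowerSeries.C (f i)) = Dk Φ k f := by
  rw [D, PowerSeries.coeff_mk, Finset.sum_eq_single (Fin.cons k fun _ => 0)]
  · simp
  · intro p hp hne
    have hsum := Finset.Nat.mem_antidiagonalTuple.1 hp
    have hex : ∃ i : Fin n, p i.succ ≠ 0 := by
      by_contra hcon
      push Not at hcon
      apply hne
      rw [Fin.sum_univ_succ] at hsum
      simp only [hcon, Finset.sum_const_zero, add_zero] at hsum
      funext i
      refine Fin.cases ?_ (fun j => ?_) i
      · simpa using hsum
      · simpa using hcon j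
    obtain ⟨i, hi⟩ := hex
    funext x
    refine Finset.sum_eq_zero fun c _ => ?_
    refine mul_eq_zero_of_right _ (Finset.sum_eq_zero fun l _ => mul_eq_zero_of_left ?_ _)
    refine Finset.prod_eq_zero (Finset.mem_univ (Sum.inl i)) ?_
    simp only [Graph.vertexFun, Sum.elim_inl]
    rw [PowerSeries.coeff_C, if_neg hi, mixedDeriv_zero]
    rfl
  · intro h
    exact absurd (Finset.Nat.mem_antidiagonalTuple.2 (by simp [Fin.sum_univ_succ])) h

end KahlerStar

namespace KahlerStar

/-! ## Sums over labelled graphs with values in a commutative ring -/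

/-! The heart of the matter is that a derivative of the sum over graphs is again a sum over graphs,
with one more incoming leg. Apply `∂/∂zⁱ` to the sum for `(f₂, f₃)`. Where the derivative hits a
vertex, it attaches a leg to that vertex. Where it hits a propagator, `∂g⁻¹ = -g⁻¹ (∂g) g⁻¹`, and
`-∂g` is a third derivative of `-Φ₋₁`: the edge is subdivided by a vertex of weight `-1` that
carries the leg. Such vertices with one incoming edge, one outgoing edge and one leg are precisely
those that cannot arise from the attachment of a leg, since bivalent vertices of weight `-1` are
forbidden. So nothing is missing and nothing is counted twice (`graphSum_subdivide`,
`derivation_partitionSum`). By iteration, the sum with legs `i₁, …, iᵣ` is `∂_{i₁} ⋯ ∂_{iᵣ} D(f₂,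
f₃)` (`IsPropagator.partitionSum_eq`).

Now take a graph with three external vertices. Its lower part consists of the last two external
vertices and of the internal vertices reachable from the second one. Contracting the lower part
gives a graph with two external vertices, and the edges that enter the lower part become legs,
distributed over its vertices in an arbitrary way. Conversely, every gluing of this kind is
admissible and the cut is unique (`Config.Valid.existsUnique_isSplit`, `glue_valid_iff`). The
contracted vertex has no outgoing edge, so it is differentiated holomorphically only, and the sum
over the lower parts and the distributions of legs is the corresponding derivative of `D(f₂, f₃)`.
This gives the first equality (`IsPropagator.partitionSum_three`). Reversing all edges and the order
of the external vertices exchanges `z` and `z̄` and gives the second one.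

Two devices make this finite algebra. Automorphism factors are replaced by `1 / (a! b!)` for graphs
with numbered internal vertices and edges (`sum_isoClass`); binomial coefficients distribute these
factors over the two parts of a cut. The total weight is recorded by a variable `X` with `X³` in the
role of `h`: an edge contributes `X`, and an internal vertex of weight `w` and degree `d`
contributes `X^(3w + d)`. This exponent is nonnegative because of the degree condition, and the
degrees add up to `2|E|`. The derivation `X · ∂` is compatible with these degrees. Modulo `X^N` only
graphs with fewer than `N` edges survive, and a graph has at most as many internal vertices as
edges. -/

/-- A family of elements of `L` indexed by a holomorphic and an anti-holomorphic multi-index. -/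
abbrev Tensor (M L : Type*) := (M → ℕ) → (M → ℕ) → L

/-- The constraints imposed on a vertex: internal vertices have incoming and outgoing edges, sources
have no incoming edges and sinks have no outgoing edges. -/
structure VertexKind where
  internal : Prop
  source : Prop
  sink : Prop

/-- A directed graph on the vertices `V` with edges `E`, together with a labelling of its half-edges
by `M`: the first component of `x e` is the tail of `e` with its label, the second one is the head
of `e` with its label. -/
abbrev Config (E V M : Type*) := E → (V × M) × (V × M)

section Config

variable {E E' V V' P P' M L : Type*}

/-- The graph underlying a configuration is acyclic and satisfies the constraints `κ`. Acyclicity is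
expressed by a height function that increases along the edges. -/
structure Config.Valid (κ : V → VertexKind) (x : Config E V M) : Prop where
  acyclic : ∃ r : V → ℕ, ∀ e, r (x e).1.1 < r (x e).2.1
  exists_in : ∀ v, (κ v).internal → ∃ e, (x e).2.1 = v
  exists_out : ∀ v, (κ v).internal → ∃ e, (x e).1.1 = v
  source : ∀ v, (κ v).source → ∀ e, (x e).2.1 ≠ v
  sink : ∀ v, (κ v).sink → ∀ e, (x e).1.1 ≠ v

/-- Relabelling of the vertices and of the edges of a configuration. -/
def Config.relabel (σ : V ≃ V') (ε : E ≃ E') : Config E V M ≃ Config E' V' M :=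
  Equiv.arrowCongr ε ((σ.prodCongr (Equiv.refl M)).prodCongr (σ.prodCongr (Equiv.refl M)))

theorem Config.relabel_apply (σ : V ≃ V') (ε : E ≃ E') (x : Config E V M) (e : E) :
    Config.relabel σ ε x (ε e) =
      ((σ (x e).1.1, (x e).1.2), (σ (x e).2.1, (x e).2.2)) := by
  simp [Config.relabel, Equiv.arrowCongr, Prod.map]

theorem Config.Valid.relabel_of {κ : V → VertexKind} {κ' : V' → VertexKind} (σ : V ≃ V')
    (ε : E ≃ E') (hκ : ∀ v, κ' (σ v) = κ v) {x : Config E V M} {x' : Config E' V' M}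
    (hx : ∀ e, x' (ε e) = ((σ (x e).1.1, (x e).1.2), (σ (x e).2.1, (x e).2.2)))
    (h : x.Valid κ) : x'.Valid κ' where
  acyclic := by
    obtain ⟨r, hr⟩ := h.acyclic
    refine ⟨r ∘ σ.symm, fun e' => ?_⟩
    obtain ⟨e, rfl⟩ := ε.surjective e'
    simpa [hx] using hr e
  exists_in v' hv := by
    obtain ⟨v, rfl⟩ := σ.surjective v'
    obtain ⟨e, he⟩ := h.exists_in v (by rwa [hκ] at hv)
    exact ⟨ε e, by simp [hx, he]⟩
  exists_out v' hv := by
    obtain ⟨v, rfl⟩ := σ.surjective v'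
    obtain ⟨e, he⟩ := h.exists_out v (by rwa [hκ] at hv)
    exact ⟨ε e, by simp [hx, he]⟩
  source v' hv e' := by
    obtain ⟨v, rfl⟩ := σ.surjective v'
    obtain ⟨e, rfl⟩ := ε.surjective e'
    simpa [hx] using h.source v (by rwa [hκ] at hv) e
  sink v' hv e' := by
    obtain ⟨v, rfl⟩ := σ.surjective v'
    obtain ⟨e, rfl⟩ := ε.surjective e'
    simpa [hx] using h.sink v (by rwa [hκ] at hv) e

theorem Config.valid_relabel {κ : V → VertexKind} {κ' : V' → VertexKind} (σ : V ≃ V')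
    (ε : E ≃ E') (hκ : ∀ v, κ' (σ v) = κ v) (x : Config E V M) :
    (Config.relabel σ ε x).Valid κ' ↔ x.Valid κ := by
  refine ⟨fun h => ?_, fun h => h.relabel_of σ ε hκ (Config.relabel_apply σ ε x)⟩
  refine h.relabel_of σ.symm ε.symm (fun v => ?_) fun e' => ?_
  · rw [← hκ, Equiv.apply_symm_apply]
  · obtain ⟨e, rfl⟩ := ε.surjective e'
    simp [Config.relabel_apply]

/-- Reversal of all edges. -/
def Config.reverse : Config E V M ≃ Config E V M :=
  Equiv.arrowCongr (Equiv.refl E) (Equiv.prodComm _ _)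

theorem Config.reverse_apply (x : Config E V M) (e : E) :
    Config.reverse x e = ((x e).2, (x e).1) := rfl

/-- Exchange of sources and sinks. -/
def VertexKind.reverse (k : VertexKind) : VertexKind := ⟨k.internal, k.sink, k.source⟩

theorem Config.Valid.reverse [Fintype V] {κ : V → VertexKind} {x : Config E V M} (h : x.Valid κ) :
    (Config.reverse x).Valid fun v => (κ v).reverse where
  acyclic := by
    obtain ⟨r, hr⟩ := h.acyclic
    -- No height exceeds the sum of all heights, so the truncated subtraction reverses the order
    -- strictly.
    refine ⟨fun v => (∑ u, r u) - r v, fun e => ?_⟩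
    have h1 := hr e
    have h2 := Finset.single_le_sum (f := r) (fun _ _ => Nat.zero_le _)
      (Finset.mem_univ (x e).2.1)
    simp only [Config.reverse_apply]
    omega
  exists_in := h.exists_out
  exists_out := h.exists_in
  source := h.sink
  sink := h.source

theorem Config.valid_reverse [Fintype V] {κ : V → VertexKind} {x : Config E V M} :
    ((Config.reverse x).Valid fun v => (κ v).reverse) ↔ x.Valid κ :=
  ⟨fun h => h.reverse, fun h => h.reverse⟩

variable [DecidableEq M]

open Classical in
/-- The multi-index of the labels among the elements of `H` that are attached to the vertex `v`. -/
noncomputable def multiIndex {H : Type*} [Fintype H] (y : H → V × M) (v : V) : M → ℕ :=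
  ∑ a, if (y a).1 = v then Pi.single (y a).2 1 else 0

theorem multiIndex_relabel {H H' : Type*} [Fintype H] [Fintype H'] (σ : V → V')
    (hσ : Function.Injective σ) (ε : H ≃ H') {y : H → V × M} {y' : H' → V' × M}
    (h : ∀ a, y' (ε a) = (σ (y a).1, (y a).2)) (v : V) :
    multiIndex y' (σ v) = multiIndex y v := by
  classical
  rw [multiIndex, multiIndex, ← Equiv.sum_comp ε]
  simp [h, hσ.eq_iff]

variable [Fintype E] [Fintype E'] [Fintype V] [Fintype V'] [Fintype P] [Fintype P'] [CommRing L]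

/-- The contribution of a configuration `x` with additional incoming legs `y`: the product of the
tensors at the vertices and of the propagators of the edges. -/
noncomputable def graphWeight (T : V → Tensor M L) (γ : M → M → L) (x : Config E V M)
    (y : P → V × M) : L :=
  (∏ v, T v (multiIndex (fun e => (x e).2) v + multiIndex y v) (multiIndex (fun e => (x e).1) v)) *
    ∏ e, γ (x e).1.2 (x e).2.2

theorem graphWeight_relabel (σ : V ≃ V') (ε : E ≃ E') (ρ : P ≃ P') {T : V → Tensor M L}
    {T' : V' → Tensor M L} (hT : ∀ v, T' (σ v) = T v) (γ : M → M → L)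
    {x : Config E V M} {x' : Config E' V' M}
    (hx : ∀ e, x' (ε e) = ((σ (x e).1.1, (x e).1.2), (σ (x e).2.1, (x e).2.2)))
    {y : P → V × M} {y' : P' → V' × M} (hy : ∀ a, y' (ρ a) = (σ (y a).1, (y a).2)) :
    graphWeight T' γ x' y' = graphWeight T γ x y := by
  rw [graphWeight, graphWeight, ← Equiv.prod_comp σ, ← Equiv.prod_comp ε]
  congr 1
  · refine Finset.prod_congr rfl fun v _ => ?_
    rw [hT, multiIndex_relabel σ σ.injective ρ hy,
      multiIndex_relabel σ σ.injective ε (y := fun e => (x e).2) (by simp [hx]),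
      multiIndex_relabel σ σ.injective ε (y := fun e => (x e).1) (by simp [hx])]
  · simp [hx]

variable [Fintype M]

open Classical in
/-- The sum over all configurations with the property `Q` and over all ways to attach legs with
labels `l` to the vertices. -/
noncomputable def graphSum [DecidableEq E] [DecidableEq P] (κ : V → VertexKind)
    (T : V → Tensor M L) (γ : M → M → L)
    (Q : Config E V M → Prop) (l : P → M) : L :=
  ∑ x : Config E V M, ∑ s : P → V,
    if x.Valid κ ∧ Q x then graphWeight T γ x (fun p => (s p, l p)) else 0

/-- This invariance serves for every change of numbering: to move a distinguished vertex, to bring a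
cut into standard position, and to rename the legs. -/
theorem graphSum_relabel [DecidableEq E] [DecidableEq E'] [DecidableEq P] [DecidableEq P'] (σ : V ≃ V') (ε : E ≃ E') (ρ : P ≃ P') {κ : V → VertexKind}
    {κ' : V' → VertexKind} (hκ : ∀ v, κ' (σ v) = κ v) {T : V → Tensor M L}
    {T' : V' → Tensor M L} (hT : ∀ v, T' (σ v) = T v) (γ : M → M → L)
    {Q : Config E V M → Prop} {Q' : Config E' V' M → Prop}
    (hQ : ∀ x, Q' (Config.relabel σ ε x) ↔ Q x) {l : P → M} {l' : P' → M}
    (hl : ∀ p, l' (ρ p) = l p) :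
    graphSum κ' T' γ Q' l' = graphSum κ T γ Q l := by
  classical
  unfold graphSum
  refine (Fintype.sum_equiv (Config.relabel σ ε) _ _ fun x => ?_).symm
  refine Fintype.sum_equiv (Equiv.arrowCongr ρ σ) _ _ fun s => ?_
  rw [Config.valid_relabel σ ε hκ, hQ]
  refine if_congr Iff.rfl (graphWeight_relabel σ ε ρ hT γ (Config.relabel_apply σ ε x) ?_).symm rfl
  intro p
  simp [hl]

/-- Reversing all edges exchanges the holomorphic and the anti-holomorphic indices. -/
theorem graphSum_reverse [DecidableEq E] [DecidableEq P] (κ : V → VertexKind) (T : V → Tensor M L) (γ : M → M → L) [IsEmpty P]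
    (l : P → M) :
    graphSum (E := E) (fun v => (κ v).reverse) (fun v α β => T v β α) (fun s r => γ r s)
      (fun _ => True) l = graphSum (E := E) κ T γ (fun _ => True) l := by
  classical
  unfold graphSum
  refine (Fintype.sum_equiv Config.reverse _ _ fun x => ?_).symm
  refine Finset.sum_congr rfl fun s _ => ?_
  by_cases h : x.Valid κ
  -- Legs are always incoming; the symmetry holds only because there are none.
  · simp only [Config.valid_reverse, h, graphWeight, Config.reverse_apply, multiIndex,
      Finset.univ_eq_empty, Finset.sum_empty, add_zero, and_self, if_true]
    rfl
  · simp [Config.valid_reverse, h]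

end Config

/-! ### Graphs with numbered external vertices -/

/-- The constraints at the external vertices `Fin n` and the internal vertices `I`. -/
def graphKind (n : ℕ) (I : Type*) : Fin n ⊕ I → VertexKind :=
  Sum.elim (fun k => ⟨False, (k : ℕ) = 0, (k : ℕ) + 1 = n⟩) fun _ => ⟨True, False, False⟩

/-- The tensors `X k` at the external vertices and `V` at the internal vertices. -/
def graphTensor {n : ℕ} {M L : Type*} (I : Type*) (X : Fin n → Tensor M L) (V : Tensor M L) :
    Fin n ⊕ I → Tensor M L :=
  Sum.elim X fun _ => V

section PartitionSum

variable {n : ℕ} {M L P P' : Type*} [Fintype M] [DecidableEq M] [CommRing L] [Algebra ℂ L]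
  [Fintype P] [Fintype P'] [DecidableEq P] [DecidableEq P']

/-- The sum over all graphs with `n` external vertices, with less than `N` internal vertices and less
than `N` edges, divided by the number of numberings of the internal vertices and of the edges. -/
noncomputable def partitionSum (N : ℕ) (X : Fin n → Tensor M L) (V : Tensor M L) (γ : M → M → L)
    (l : P → M) : L :=
  ∑ a ∈ Finset.range N, ∑ b ∈ Finset.range N, ((a.factorial * b.factorial : ℂ)⁻¹) •
    graphSum (E := Fin b) (graphKind n (Fin a)) (graphTensor (Fin a) X V) γ (fun _ => True) l

theorem partitionSum_equiv (ρ : P ≃ P') (N : ℕ) (X : Fin n → Tensor M L) (V : Tensor M L)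
    (γ : M → M → L) (l : P' → M) :
    partitionSum N X V γ l = partitionSum N X V γ (l ∘ ρ) := by
  unfold partitionSum
  refine Finset.sum_congr rfl fun a _ => Finset.sum_congr rfl fun b _ => ?_
  congr 1
  exact graphSum_relabel (κ := graphKind n (Fin a)) (T := graphTensor (Fin a) X V)
    (Q := fun _ => True) (l := l ∘ ρ) (Equiv.refl _) (Equiv.refl (Fin b)) ρ (fun _ => rfl)
    (fun _ => rfl) γ (fun _ => Iff.rfl) (fun _ => rfl)

/-- Reversing all edges and the order of the external vertices. -/
theorem partitionSum_reverse (N : ℕ) (X : Fin n → Tensor M L) (V : Tensor M L) (γ : M → M → L)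
    [IsEmpty P] (l : P → M) :
    partitionSum N (fun k α β => X k.rev β α) (fun α β => V β α) (fun s r => γ r s) l =
      partitionSum N X V γ l := by
  unfold partitionSum
  refine Finset.sum_congr rfl fun a _ => Finset.sum_congr rfl fun b _ => ?_
  congr 1
  rw [← graphSum_reverse (graphKind n (Fin a)) (graphTensor (Fin a) X V) γ l]
  refine (graphSum_relabel (Q := fun _ => True) (l := l)
    (Equiv.sumCongr Fin.revPerm (Equiv.refl (Fin a))) (Equiv.refl (Fin b)) (Equiv.refl P) ?_ ?_ _
    (fun _ => Iff.rfl) (fun _ => rfl)).symm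
  · rintro (k | i)
    · simp only [graphKind, VertexKind.reverse, Equiv.sumCongr_apply, Sum.map_inl, Sum.elim_inl,
        Fin.revPerm_apply, Fin.val_rev, VertexKind.mk.injEq, true_and, eq_iff_iff]
      have := k.2
      omega
    · rfl
  · rintro (k | i)
    · simp [graphTensor]
    · rfl

end PartitionSum

/-! ## Derivatives of sums over graphs -/

theorem derivation_prod {R L ι : Type*} [CommRing R] [CommRing L] [Algebra R L] [DecidableEq ι]
    (δ : Derivation R L L) (s : Finset ι) (f : ι → L) :
    δ (∏ a ∈ s, f a) = ∑ a ∈ s, (∏ b ∈ s.erase a, f b) * δ (f a) := by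
  induction s using Finset.induction_on with
  | empty => simp
  | insert a s ha ih =>
    rw [Finset.prod_insert ha, Derivation.leibniz, ih, Finset.sum_insert ha,
      Finset.erase_insert ha, smul_eq_mul, smul_eq_mul, add_comm, Finset.mul_sum]
    congr 1
    refine Finset.sum_congr rfl fun b hb => ?_
    rw [Finset.erase_insert_of_ne (by rintro rfl; exact ha hb),
      Finset.prod_insert (fun h => ha (Finset.mem_of_mem_erase h)), mul_assoc]

section

variable {E V P M L : Type*} [DecidableEq M] [Fintype E] [Fintype P]

theorem multiIndex_eq [DecidableEq V] {H : Type*} [Fintype H] (y : H → V × M) (v : V) :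
    multiIndex y v = ∑ a, if (y a).1 = v then Pi.single (y a).2 1 else 0 := by
  rw [multiIndex]
  congr!

theorem multiIndex_option {H : Type*} [Fintype H] (y : Option H → V × M) (v : V)
    [Decidable ((y none).1 = v)] :
    multiIndex y v = (if (y none).1 = v then Pi.single (y none).2 1 else 0) +
      multiIndex (fun a => y (some a)) v := by
  rw [multiIndex, Fintype.sum_option, multiIndex]
  congr

theorem sum_multiIndex [Fintype M] [DecidableEq V] {H : Type*} [Fintype H] (y : H → V × M) (v : V) :
    ∑ i, multiIndex y v i = (Finset.univ.filter fun a => (y a).1 = v).card := by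
  classical
  rw [Finset.card_filter]
  simp only [multiIndex, Finset.sum_apply]
  rw [Finset.sum_comm]
  refine Finset.sum_congr rfl fun a _ => ?_
  split_ifs <;> simp_all

/-- This keeps the differentiation rule at internal vertices away from the bidegrees `(2, 0)` and
`(0, 2)`, where a correction outside bidegree `(1, 1)` would be needed. -/
theorem Config.Valid.multiIndex_ne_zero [Fintype M] {κ : V → VertexKind} {x : Config E V M}
    (h : x.Valid κ) {v : V} (hv : (κ v).internal) :
    multiIndex (fun e => (x e).2) v ≠ 0 ∧ multiIndex (fun e => (x e).1) v ≠ 0 := by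
  classical
  obtain ⟨e, he⟩ := h.exists_in v hv
  obtain ⟨e', he'⟩ := h.exists_out v hv
  constructor
  · intro h0
    have := sum_multiIndex (fun e => (x e).2) v
    rw [h0] at this
    simp only [Pi.zero_apply, Finset.sum_const_zero] at this
    exact (Finset.card_pos.2 ⟨e, by simpa using he⟩).ne this
  · intro h0
    have := sum_multiIndex (fun e => (x e).1) v
    rw [h0] at this
    simp only [Pi.zero_apply, Finset.sum_const_zero] at this
    exact (Finset.card_pos.2 ⟨e', by simpa using he'⟩).ne this

variable [Fintype V] [CommRing L]

omit [DecidableEq M] in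
theorem prod_update_tensor [DecidableEq V] (T : V → Tensor M L) (v : V) (A : Tensor M L)
    (α β : V → M → ℕ) :
    ∏ u, Function.update T v A u (α u) (β u) =
      (∏ u ∈ Finset.univ.erase v, T u (α u) (β u)) * A (α v) (β v) := by
  rw [← Finset.prod_erase_mul _ _ (Finset.mem_univ v), Function.update_self]
  congr 1
  exact Finset.prod_congr rfl fun u hu => by
    rw [Function.update_of_ne (Finset.ne_of_mem_erase hu)]

variable [Fintype M] [DecidableEq E] [DecidableEq P]

open Classical in
/-- The sum over all configurations in which the propagator of one edge is replaced by `γ'`. -/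
noncomputable def edgeSum (κ : V → VertexKind) (T : V → Tensor M L) (γ γ' : M → M → L)
    (l : P → M) : L :=
  ∑ x : Config E V M, ∑ s : P → V, ∑ e, if x.Valid κ then
    (∏ v, T v (multiIndex (fun e => (x e).2) v + multiIndex (fun p => (s p, l p)) v)
      (multiIndex (fun e => (x e).1) v)) *
      ((∏ e' ∈ Finset.univ.erase e, γ (x e').1.2 (x e').2.2) * γ' (x e).1.2 (x e).2.2) else 0

/-- The derivative of a sum over graphs: a new leg is attached to some vertex, with a correction `C v`
at each vertex `v`, or the propagator of some edge is differentiated. -/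
theorem derivation_graphSum [Algebra ℂ L] [DecidableEq V] (δ : Derivation ℂ L L) (i : M) {κ : V → VertexKind}
    {T : V → Tensor M L} {γ : M → M → L} (C : V → Tensor M L)
    (hT : ∀ v α β, ((κ v).internal → α ≠ 0 ∧ β ≠ 0) →
      δ (T v α β) = T v (α + Pi.single i 1) β - C v α β) (l : P → M) :
    δ (graphSum (E := E) κ T γ (fun _ => True) l) =
      graphSum (E := E) κ T γ (fun _ => True) (fun o : Option P => o.elim i l) -
        ∑ v, graphSum (E := E) κ (Function.update T v (C v)) γ (fun _ => True) l +
        edgeSum (E := E) κ T γ (fun s r => δ (γ s r)) l := by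
  classical
  unfold graphSum edgeSum
  rw [map_sum, Finset.sum_comm (s := (Finset.univ : Finset V)), ← Finset.sum_sub_distrib,
    ← Finset.sum_add_distrib]
  refine Finset.sum_congr rfl fun x _ => ?_
  -- Attaching the legs `Option P` means choosing a vertex for the new leg and attaching the old
  -- ones; the new vertex then matches the factor hit by the Leibniz rule.
  rw [map_sum, Finset.sum_comm (s := (Finset.univ : Finset V)),
    Fintype.sum_equiv Equiv.piOptionEquivProd _
      (fun q : V × (P → V) => if x.Valid κ ∧ True then graphWeight T γ x
        (fun o : Option P => (o.elim q.1 q.2, o.elim i l)) else 0) (by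
        intro s
        congr
        funext o
        cases o <;> rfl),
    Fintype.sum_prod_type, Finset.sum_comm (s := (Finset.univ : Finset V)),
    ← Finset.sum_sub_distrib, ← Finset.sum_add_distrib]
  refine Finset.sum_congr rfl fun s _ => ?_
  by_cases hx : x.Valid κ
  swap
  · simp [hx]
  simp only [hx, true_and, if_true, graphWeight, Derivation.leibniz, smul_eq_mul]
  rw [derivation_prod, derivation_prod, ← Finset.mul_sum, add_comm, ← Finset.sum_sub_distrib]
  congr 1
  rw [Finset.mul_sum]
  refine Finset.sum_congr rfl fun v _ => ?_
  rw [prod_update_tensor, hT]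
  · have h1 : ∏ u, T u (multiIndex (fun e => (x e).2) u +
        multiIndex (fun o : Option P => (o.elim v s, o.elim i l)) u)
        (multiIndex (fun e => (x e).1) u) =
        (∏ u ∈ Finset.univ.erase v, T u (multiIndex (fun e => (x e).2) u +
          multiIndex (fun p => (s p, l p)) u) (multiIndex (fun e => (x e).1) u)) *
        T v (multiIndex (fun e => (x e).2) v + multiIndex (fun p => (s p, l p)) v +
          Pi.single i 1) (multiIndex (fun e => (x e).1) v) := by
      rw [← Finset.prod_erase_mul _ _ (Finset.mem_univ v)]
      congr 1
      · refine Finset.prod_congr rfl fun u hu => ?_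
        rw [multiIndex_option (fun o : Option P => (o.elim v s, o.elim i l)),
          if_neg (by simpa using (Finset.ne_of_mem_erase hu).symm), zero_add]
        rfl
      · rw [multiIndex_option (fun o : Option P => (o.elim v s, o.elim i l)),
          if_pos (by rfl), add_comm _ (multiIndex _ v), ← add_assoc]
        rfl
    rw [h1]
    ring
  · intro hv
    have := hx.multiIndex_ne_zero hv
    refine ⟨fun h => this.1 ?_, this.2⟩
    funext j
    have := congrFun h j
    simp only [Pi.add_apply, Pi.zero_apply] at this ⊢
    omega

/-- If the tensor `K` at an internal vertex `v` is supported in bidegree `(1, 1)`, then exactly one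
edge ends at `v`. -/
theorem graphSum_eq_sum_incoming [DecidableEq V] {κ : V → VertexKind} (T : V → Tensor M L)
    (γ : M → M → L) {K : Tensor M L} (hK : ∀ α β, K α β ≠ 0 → ∑ j, α j = 1 ∧ ∑ j, β j = 1)
    {v : V} (hv : (κ v).internal) (l : P → M) :
    graphSum (E := E) κ (Function.update T v K) γ (fun _ => True) l =
      ∑ e, graphSum (E := E) κ (Function.update T v K) γ (fun x => (x e).2.1 = v) l := by
  classical
  unfold graphSum
  rw [Finset.sum_comm (s := (Finset.univ : Finset E))]
  refine Finset.sum_congr rfl fun x _ => ?_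
  rw [Finset.sum_comm (s := (Finset.univ : Finset E))]
  refine Finset.sum_congr rfl fun s _ => ?_
  by_cases hx : x.Valid κ
  swap
  · simp [hx]
  simp only [hx, true_and, if_true]
  rw [← Finset.sum_filter, Finset.sum_const]
  by_cases h0 : graphWeight (Function.update T v K) γ x (fun p => (s p, l p)) = 0
  · simp [h0]
  have h1 : K (multiIndex (fun e => (x e).2) v + multiIndex (fun p => (s p, l p)) v)
      (multiIndex (fun e => (x e).1) v) ≠ 0 := by
    intro h
    apply h0
    rw [graphWeight, prod_update_tensor, h, mul_zero, zero_mul]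
  have h2 := (hK _ _ h1).1
  simp only [Pi.add_apply, Finset.sum_add_distrib] at h2
  rw [sum_multiIndex] at h2
  -- Edges and legs entering `v` number one in total, and validity provides an edge: so there is
  -- exactly one edge and no leg.
  obtain ⟨e, he⟩ := hx.exists_in v hv
  have h3 : 0 < (Finset.univ.filter fun e => (x e).2.1 = v).card :=
    Finset.card_pos.2 ⟨e, by simpa using he⟩
  have h4 : (Finset.univ.filter fun e => (x e).2.1 = v).card = 1 := by omega
  rw [h4, one_smul]

end

/-! ### Subdivision of an edge -/

section Subdivide

variable {E V P M L : Type*} [DecidableEq E]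

/-- Subdivision of the edge `e` by a new vertex `none`. The new edge `none` runs from the tail of `e`
to the new vertex, the edge `some e` from the new vertex to the head of `e`. -/
def Config.subdivide (x : Config E V M) (e : E) (p q : M) : Config (Option E) (Option V) M
  | none => ((some (x e).1.1, (x e).1.2), (none, p))
  | some e' => if e' = e then ((none, q), (some (x e).2.1, (x e).2.2)) else
      ((some (x e').1.1, (x e').1.2), (some (x e').2.1, (x e').2.2))

theorem Config.subdivide_none (x : Config E V M) (e : E) (p q : M) :
    x.subdivide e p q none = ((some (x e).1.1, (x e).1.2), (none, p)) := rfl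

theorem Config.subdivide_self (x : Config E V M) (e : E) (p q : M) :
    x.subdivide e p q (some e) = ((none, q), (some (x e).2.1, (x e).2.2)) := if_pos rfl

theorem Config.subdivide_of_ne (x : Config E V M) {e e' : E} (h : e' ≠ e) (p q : M) :
    x.subdivide e p q (some e') =
      ((some (x e').1.1, (x e').1.2), (some (x e').2.1, (x e').2.2)) := if_neg h

theorem Config.subdivide_head (x : Config E V M) (e e' : E) (p q : M) :
    (x.subdivide e p q (some e')).2 = (some (x e').2.1, (x e').2.2) := by
  by_cases h : e' = e
  · rw [h, subdivide_self]
  · rw [subdivide_of_ne x h]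

/-- The constraints after the introduction of a new internal vertex. -/
def optionKind (κ : V → VertexKind) (o : Option V) : VertexKind :=
  o.elim ⟨True, False, False⟩ κ

theorem Config.valid_subdivide {κ : V → VertexKind} (x : Config E V M) (e : E) (p q : M) :
    (x.subdivide e p q).Valid (optionKind κ) ↔ x.Valid κ := by
  constructor
  · intro h
    refine ⟨?_, fun v hv => ?_, fun v hv => ?_, fun v hv e' he' => ?_, fun v hv e' he' => ?_⟩
    · obtain ⟨r, hr⟩ := h.acyclic
      refine ⟨fun v => r (some v), fun e' => ?_⟩
      by_cases h' : e' = e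
      · subst h'
        have h1 := hr none
        have h2 := hr (some e')
        rw [subdivide_none] at h1
        rw [subdivide_self] at h2
        exact h1.trans h2
      · have h1 := hr (some e')
        rwa [subdivide_of_ne x h'] at h1
    · obtain ⟨o, ho⟩ := h.exists_in (some v) hv
      cases o with
      | none => simp [subdivide_none] at ho
      | some e' => exact ⟨e', by simpa [subdivide_head] using ho⟩
    · obtain ⟨o, ho⟩ := h.exists_out (some v) hv
      cases o with
      | none => exact ⟨e, by simpa [subdivide_none] using ho⟩
      | some e' =>
        by_cases h' : e' = e
        · rw [h', subdivide_self] at ho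
          simp at ho
        · exact ⟨e', by simpa [subdivide_of_ne x h'] using ho⟩
    · exact h.source (some v) hv (some e') (by simp [subdivide_head, he'])
    · by_cases h' : e' = e
      · exact h.sink (some v) hv none (by simp [subdivide_none, ← h', he'])
      · exact h.sink (some v) hv (some e') (by simp [subdivide_of_ne x h', he'])
  · intro h
    refine ⟨?_, fun v hv => ?_, fun v hv => ?_, fun v hv e' he' => ?_, fun v hv e' he' => ?_⟩
    · obtain ⟨r, hr⟩ := h.acyclic
      -- Doubling the heights frees the odd value just above the tail of `e` for the new vertex.
      refine ⟨fun o => o.elim (2 * r (x e).1.1 + 1) fun v => 2 * r v, fun o => ?_⟩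
      cases o with
      | none => simp [subdivide_none]
      | some e' =>
        have h1 := hr e'
        by_cases h' : e' = e
        · subst h'
          simp only [subdivide_self, Option.elim_none, Option.elim_some]
          omega
        · simp only [subdivide_of_ne x h', Option.elim_some]
          omega
    · cases v with
      | none => exact ⟨none, rfl⟩
      | some v =>
        obtain ⟨e', he'⟩ := h.exists_in v hv
        exact ⟨some e', by simp [subdivide_head, he']⟩
    · cases v with
      | none => exact ⟨some e, by simp [subdivide_self]⟩
      | some v =>
        obtain ⟨e', he'⟩ := h.exists_out v hv
        by_cases h' : e' = e
        · exact ⟨none, by simp [subdivide_none, ← h', he']⟩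
        · exact ⟨some e', by simp [subdivide_of_ne x h', he']⟩
    · cases v with
      | none => exact hv
      | some v =>
        cases e' with
        | none => simp [subdivide_none] at he'
        | some e' => exact h.source v hv e' (by simpa [subdivide_head] using he')
    · cases v with
      | none => exact hv
      | some v =>
        cases e' with
        | none => exact h.sink v hv e (by simpa [subdivide_none] using he')
        | some e' =>
          by_cases h' : e' = e
          · rw [h', subdivide_self] at he'
            simp at he'
          · exact h.sink v hv e' (by simpa [subdivide_of_ne x h'] using he')

/-- The subdivided edge is recovered as the only edge that leaves the new vertex; all other data can
then be read off. -/
theorem Config.subdivide_injective :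
    Function.Injective fun z : Config E V M × E × M × M =>
      z.1.subdivide z.2.1 z.2.2.1 z.2.2.2 := by
  rintro ⟨x, e, p, q⟩ ⟨x', e', p', q'⟩ h
  have h0 := congrFun h none
  have h1 := fun a => congrFun h (some a)
  simp only [subdivide_none, Prod.mk.injEq, Option.some.injEq, true_and] at h0 h1
  have he : e = e' := by
    by_contra hne
    have := h1 e
    rw [subdivide_self, subdivide_of_ne x' hne] at this
    simp at this
  subst he
  have h2 := h1 e
  simp only [subdivide_self, Prod.mk.injEq, Option.some.injEq, true_and] at h2
  refine Prod.ext (funext fun a => ?_) (by simp [h0, h2])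
  by_cases ha : a = e
  · subst ha
    exact Prod.ext (Prod.ext h0.1.1 h0.1.2) (Prod.ext h2.2.1 h2.2.2)
  · have h3 := h1 a
    simp only [subdivide_of_ne x ha, subdivide_of_ne x' ha, Prod.mk.injEq, Option.some.injEq] at h3
    exact Prod.ext (Prod.ext h3.1.1 h3.1.2) (Prod.ext h3.2.1 h3.2.2)

/-- A configuration in which the vertex `none` has the edge `none` as its only incoming edge and has
exactly one outgoing edge arises by subdivision. -/
theorem Config.exists_subdivide (x' : Config (Option E) (Option V) M)
    (h1 : ∀ a, (x' a).2.1 = none ↔ a = none) {e : E} (h2 : ∀ a, (x' a).1.1 = none ↔ a = some e) :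
    ∃ x : Config E V M, x.subdivide e (x' none).2.2 (x' (some e)).1.2 = x' := by
  have hh : ∀ a : E, ∃ v, (x' (some a)).2.1 = some v := fun a =>
    Option.ne_none_iff_exists'.1 fun h => by simpa using (h1 _).1 h
  have ht : ∀ a : E, a ≠ e → ∃ v, (x' (some a)).1.1 = some v := fun a ha =>
    Option.ne_none_iff_exists'.1 fun h => ha (by simpa using (h2 _).1 h)
  obtain ⟨u, hu⟩ : ∃ v, (x' none).1.1 = some v :=
    Option.ne_none_iff_exists'.1 fun h => by simpa using (h2 _).1 h
  choose v hv using hh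
  choose w hw using ht
  refine ⟨fun a => if h : a = e then ((u, (x' none).1.2), (v a, (x' (some a)).2.2)) else
    ((w a h, (x' (some a)).1.2), (v a, (x' (some a)).2.2)), ?_⟩
  funext o
  cases o with
  | none =>
    rw [subdivide_none]
    simp [← hu, ← (h1 none).2 rfl]
  | some a =>
    by_cases ha : a = e
    · subst ha
      rw [subdivide_self]
      simp [← hv, ← (h2 _).2 rfl]
    · rw [subdivide_of_ne _ ha]
      simp [ha, ← hv, ← hw]

variable [DecidableEq M] [Fintype E]

theorem Config.multiIndex_subdivide_head (x : Config E V M) (e : E) (p q : M) (v : V) :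
    multiIndex (fun a => (x.subdivide e p q a).2) (some v) = multiIndex (fun a => (x a).2) v := by
  classical
  rw [multiIndex_option, if_neg (by simp [subdivide_none]), zero_add]
  simp [multiIndex, subdivide_head]

theorem Config.multiIndex_subdivide_head_none (x : Config E V M) (e : E) (p q : M) :
    multiIndex (fun a => (x.subdivide e p q a).2) none = Pi.single p 1 := by
  classical
  rw [multiIndex_option, if_pos (by simp [subdivide_none])]
  simp [multiIndex, subdivide_head, subdivide_none]

theorem Config.multiIndex_subdivide_tail (x : Config E V M) (e : E) (p q : M) (v : V) :
    multiIndex (fun a => (x.subdivide e p q a).1) (some v) = multiIndex (fun a => (x a).1) v := by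
  classical
  rw [multiIndex_option, multiIndex_eq, multiIndex_eq,
    ← Finset.add_sum_erase _ (fun a => if (x a).1.1 = v then Pi.single (x a).1.2 1 else 0)
      (Finset.mem_univ e),
    ← Finset.add_sum_erase _ (fun a => if (x.subdivide e p q (some a)).1.1 = some v then
      Pi.single (x.subdivide e p q (some a)).1.2 1 else 0) (Finset.mem_univ e)]
  simp only [subdivide_self, subdivide_none, Option.some.injEq, reduceCtorEq, if_false, zero_add]
  congr 1
  refine Finset.sum_congr rfl fun a ha => ?_
  rw [subdivide_of_ne x (Finset.ne_of_mem_erase ha)]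
  simp

theorem Config.multiIndex_subdivide_tail_none (x : Config E V M) (e : E) (p q : M) :
    multiIndex (fun a => (x.subdivide e p q a).1) none = Pi.single q 1 := by
  classical
  rw [multiIndex_option, if_neg (by simp [subdivide_none]), zero_add, multiIndex,
    ← Finset.add_sum_erase _ _ (Finset.mem_univ e), subdivide_self, if_pos rfl,
    Finset.sum_eq_zero, add_zero]
  intro a ha
  rw [subdivide_of_ne x (Finset.ne_of_mem_erase ha)]
  simp

theorem multiIndex_some {H : Type*} [Fintype H] (y : H → V × M) (v : V) :
    multiIndex (fun a => (some (y a).1, (y a).2)) (some v) = multiIndex y v := by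
  classical
  simp [multiIndex]

theorem multiIndex_some_none {H : Type*} [Fintype H] (y : H → V × M) :
    multiIndex (fun a => (some (y a).1, (y a).2)) none = 0 := by
  classical
  simp [multiIndex]

variable [Fintype V] [Fintype P] [DecidableEq P] [Fintype M] [CommRing L]

/-- Graphs with a distinguished bivalent vertex are obtained by the subdivision of an edge. -/
theorem graphSum_subdivide {κ : V → VertexKind} (T : V → Tensor M L) (γ : M → M → L)
    {K : Tensor M L} (hK : ∀ α β, K α β ≠ 0 → ∑ j, α j = 1 ∧ ∑ j, β j = 1) (l : P → M) :
    graphSum (E := Option E) (optionKind κ) (fun o => o.elim K T) γ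
      (fun x => (x none).2.1 = none) l =
    edgeSum (E := E) κ T γ
      (fun s r => ∑ p, ∑ q, γ s p * K (Pi.single p 1) (Pi.single q 1) * γ q r) l := by
  classical
  have hR : edgeSum (E := E) κ T γ
      (fun s r => ∑ p, ∑ q, γ s p * K (Pi.single p 1) (Pi.single q 1) * γ q r) l =
      ∑ z : (Config E V M × E × M × M) × (P → V), if z.1.1.Valid κ then
        (∏ v, T v (multiIndex (fun e => (z.1.1 e).2) v + multiIndex (fun p => (z.2 p, l p)) v)
          (multiIndex (fun e => (z.1.1 e).1) v)) *
        ((∏ e' ∈ Finset.univ.erase z.1.2.1, γ (z.1.1 e').1.2 (z.1.1 e').2.2) *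
          (γ (z.1.1 z.1.2.1).1.2 z.1.2.2.1 *
            K (Pi.single z.1.2.2.1 1) (Pi.single z.1.2.2.2 1) *
            γ z.1.2.2.2 (z.1.1 z.1.2.1).2.2)) else 0 := by
    rw [Fintype.sum_prod_type_right]
    simp only [Fintype.sum_prod_type]
    unfold edgeSum
    rw [Finset.sum_comm]
    refine Finset.sum_congr rfl fun s _ => Finset.sum_congr rfl fun x _ =>
      Finset.sum_congr rfl fun e _ => ?_
    split_ifs
    · simp only [Finset.mul_sum]
    · simp
  rw [hR, graphSum, ← Fintype.sum_prod_type']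
  refine (Fintype.sum_of_injective
    (fun z : (Config E V M × E × M × M) × (P → V) =>
      ((z.1.1.subdivide z.1.2.1 z.1.2.2.1 z.1.2.2.2, fun p => some (z.2 p)) :
        Config (Option E) (Option V) M × (P → Option V))) ?_ _ _ ?_ ?_).symm
  · rintro ⟨z, s⟩ ⟨z', s'⟩ h
    rw [Prod.mk.injEq] at h
    refine Prod.ext (Config.subdivide_injective h.1) (funext fun p => ?_)
    simpa using congrFun h.2 p
  -- A nonzero term comes from a subdivision: the bidegree of `K` forces one incoming edge, one
  -- outgoing edge and no leg at the new vertex, and by acyclicity the two edges are distinct.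
  · rintro ⟨x', s'⟩ hz
    by_contra h0
    apply hz
    simp only [ite_eq_right_iff, Classical.not_imp] at h0
    obtain ⟨⟨hx, hn⟩, h0⟩ := h0
    have hK0 : K (multiIndex (fun e => (x' e).2) none + multiIndex (fun p => (s' p, l p)) none)
        (multiIndex (fun e => (x' e).1) none) ≠ 0 := by
      intro h
      apply h0
      rw [graphWeight, Fintype.prod_option]
      simp only [Option.elim_none, h, zero_mul]
    obtain ⟨hin, hout⟩ := hK _ _ hK0
    simp only [Pi.add_apply, Finset.sum_add_distrib] at hin
    rw [sum_multiIndex, sum_multiIndex] at hin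
    rw [sum_multiIndex] at hout
    have hpos : 0 < (Finset.univ.filter fun e => (x' e).2.1 = none).card :=
      Finset.card_pos.2 ⟨none, by simpa using hn⟩
    have hin1 : (Finset.univ.filter fun e => (x' e).2.1 = none).card = 1 := by omega
    have hleg : (Finset.univ.filter fun p => s' p = none).card = 0 := by
      simp only at hin hin1
      omega
    obtain ⟨a, ha⟩ := Finset.card_eq_one.1 hin1
    have ha' : ∀ b, (x' b).2.1 = none ↔ b = a := fun b => by
      simpa using Finset.ext_iff.1 ha b
    obtain rfl : none = a := (ha' none).1 hn
    obtain ⟨o, ho⟩ := Finset.card_eq_one.1 hout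
    have ho' : ∀ b, (x' b).1.1 = none ↔ b = o := fun b => by
      simpa using Finset.ext_iff.1 ho b
    cases o with
    | none =>
      obtain ⟨r, hr⟩ := hx.acyclic
      have := hr none
      rw [hn, (ho' none).2 rfl] at this
      exact absurd this (lt_irrefl _)
    | some e =>
      obtain ⟨x, hx⟩ := Config.exists_subdivide x' ha' ho'
      have hs : ∀ p, ∃ v, s' p = some v := fun p => Option.ne_none_iff_exists'.1 fun h => by
        have h1 := Finset.card_eq_zero.1 hleg
        have h2 : p ∈ Finset.univ.filter fun p => s' p = none := by simpa using h
        rw [h1] at h2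
        simp at h2
      choose s hs using hs
      exact ⟨⟨⟨x, e, _, _⟩, s⟩, Prod.ext hx (funext fun p => (hs p).symm)⟩
  · rintro ⟨⟨x, e, p, q⟩, s⟩
    by_cases hx : x.Valid κ
    swap
    · simp [Config.valid_subdivide, hx]
    simp only [Config.valid_subdivide, hx, Config.subdivide_none, and_self, if_true]
    rw [graphWeight, Fintype.prod_option, Fintype.prod_option]
    simp only [Option.elim_none, Option.elim_some]
    rw [Config.multiIndex_subdivide_head_none, Config.multiIndex_subdivide_tail_none,
      multiIndex_some_none (fun p => (s p, l p)), add_zero, Config.subdivide_none,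
      ← Finset.mul_prod_erase _ (fun a => γ (x.subdivide e p q (some a)).1.2
        (x.subdivide e p q (some a)).2.2) (Finset.mem_univ e), Config.subdivide_self]
    have h1 : ∏ a ∈ Finset.univ.erase e, γ (x.subdivide e p q (some a)).1.2
        (x.subdivide e p q (some a)).2.2 =
        ∏ a ∈ Finset.univ.erase e, γ (x a).1.2 (x a).2.2 := by
      refine Finset.prod_congr rfl fun a ha => ?_
      rw [Config.subdivide_of_ne x (Finset.ne_of_mem_erase ha)]
    have h2 : ∏ v, T v (multiIndex (fun a => (x.subdivide e p q a).2) (some v) +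
          multiIndex (fun p => (some (s p), l p)) (some v))
          (multiIndex (fun a => (x.subdivide e p q a).1) (some v)) =
        ∏ v, T v (multiIndex (fun e => (x e).2) v + multiIndex (fun p => (s p, l p)) v)
          (multiIndex (fun e => (x e).1) v) := by
      refine Finset.prod_congr rfl fun v _ => ?_
      rw [Config.multiIndex_subdivide_head, Config.multiIndex_subdivide_tail,
        multiIndex_some (fun p => (s p, l p))]
    rw [h1, h2]
    ring

end Subdivide

/-! ### Vanishing of large graphs, and the derivative of the partition sum. -/

theorem Config.Valid.card_le {n : ℕ} {E I M : Type*} [Fintype E] [Fintype I]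
    {x : Config E (Fin n ⊕ I) M} (h : x.Valid (graphKind n I)) :
    Fintype.card I ≤ Fintype.card E := by
  choose e he using fun i : I => h.exists_in (Sum.inr i) trivial
  refine Fintype.card_le_of_injective e fun i j hij => ?_
  have := he j
  rw [← hij, he i] at this
  exact Sum.inr_injective this

theorem prod_eq_zero_of_dvd {L ι : Type*} [CommRing L] {τ : L} {N : ℕ} (hτ : τ ^ N = 0)
    (s : Finset ι) (hs : N ≤ s.card) (f : ι → L) (hf : ∀ a ∈ s, τ ∣ f a) : ∏ a ∈ s, f a = 0 := by
  have h1 : τ ^ s.card ∣ ∏ a ∈ s, f a := by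
    rw [← Finset.prod_const]
    exact Finset.prod_dvd_prod_of_dvd _ _ hf
  have h2 : τ ^ s.card = 0 := by
    obtain ⟨d, hd⟩ := Nat.exists_eq_add_of_le hs
    rw [hd, pow_add, hτ, zero_mul]
  rw [h2] at h1
  exact zero_dvd_iff.1 h1

/-- Numbering of `a + 1` internal vertices such that the vertex `none` gets the number `i`. -/
def optionVertexEquiv (n : ℕ) {a : ℕ} (i : Fin (a + 1)) :
    Option (Fin n ⊕ Fin a) ≃ Fin n ⊕ Fin (a + 1) where
  toFun o := o.elim (Sum.inr i) (Sum.map id i.succAbove)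
  invFun := Sum.elim (fun k => some (Sum.inl k)) fun j => (finSuccEquiv' i j).map Sum.inr
  left_inv := by
    rintro (_ | k | j) <;> simp
  right_inv := by
    rintro (k | j)
    · rfl
    · rcases i.eq_self_or_eq_succAbove j with rfl | ⟨j, rfl⟩ <;> simp

section

variable {n : ℕ} {M L P : Type*} [Fintype M] [DecidableEq M] [CommRing L]
  [Fintype P] [DecidableEq P]

theorem graphSum_eq_zero_of_card {E V : Type*} [Fintype E] [DecidableEq E] [Fintype V] {τ : L}
    {N : ℕ} (hτ : τ ^ N = 0) (hN : N ≤ Fintype.card E) (κ : V → VertexKind)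
    (T : V → Tensor M L) {γ : M → M → L} (hγ : ∀ s r, τ ∣ γ s r) (Q : Config E V M → Prop)
    (l : P → M) : graphSum κ T γ Q l = 0 := by
  refine Finset.sum_eq_zero fun x _ => Finset.sum_eq_zero fun s _ => ?_
  rw [graphWeight, prod_eq_zero_of_dvd hτ _ hN _ fun _ _ => hγ _ _, mul_zero, ite_self]

/-- There is no valid configuration at all: distinct internal vertices have distinct incoming edges.
-/
theorem graphSum_eq_zero_of_lt {E I : Type*} [Fintype E] [DecidableEq E] [Fintype I]
    (h : Fintype.card E < Fintype.card I) (T : Fin n ⊕ I → Tensor M L)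
    (γ : M → M → L) (Q : Config E (Fin n ⊕ I) M → Prop) (l : P → M) :
    graphSum (graphKind n I) T γ Q l = 0 :=
  Finset.sum_eq_zero fun _ _ => Finset.sum_eq_zero fun _ _ =>
    if_neg fun hx => (hx.1.card_le.trans_lt h).false

theorem edgeSum_eq_zero_of_lt {E I : Type*} [Fintype E] [DecidableEq E] [Fintype I]
    (h : Fintype.card E < Fintype.card I) (T : Fin n ⊕ I → Tensor M L)
    (γ γ' : M → M → L) (l : P → M) : edgeSum (E := E) (graphKind n I) T γ γ' l = 0 :=
  Finset.sum_eq_zero fun _ _ => Finset.sum_eq_zero fun _ _ => Finset.sum_eq_zero fun _ _ =>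
    if_neg fun hx => (hx.card_le.trans_lt h).false

/-- The distinguished edge supplies two factors `τ` and every other edge one, so the vanishing
starts one edge earlier than for `graphSum`. -/
theorem edgeSum_eq_zero_of_card {E V : Type*} [Fintype E] [DecidableEq E] [Fintype V] {τ : L}
    {N : ℕ} (hτ : τ ^ N = 0) (hN : N ≤ Fintype.card E + 1) (κ : V → VertexKind)
    (T : V → Tensor M L) {γ γ' : M → M → L} (hγ : ∀ s r, τ ∣ γ s r)
    (hγ' : ∀ s r, τ ^ 2 ∣ γ' s r) (l : P → M) : edgeSum (E := E) κ T γ γ' l = 0 := by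
  refine Finset.sum_eq_zero fun x _ => Finset.sum_eq_zero fun s _ =>
    Finset.sum_eq_zero fun e _ => ?_
  have h1 : τ ^ (Finset.univ.erase e).card ∣
      ∏ e' ∈ Finset.univ.erase e, γ (x e').1.2 (x e').2.2 := by
    rw [← Finset.prod_const]
    exact Finset.prod_dvd_prod_of_dvd _ _ fun _ _ => hγ _ _
  have h2 : τ ^ ((Finset.univ.erase e).card + 2) = 0 := by
    rw [Finset.card_erase_of_mem (Finset.mem_univ e), Finset.card_univ]
    have : 0 < Fintype.card E := Fintype.card_pos_iff.2 ⟨e⟩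
    obtain ⟨d, hd⟩ := Nat.exists_eq_add_of_le (show N ≤ Fintype.card E - 1 + 2 by omega)
    rw [hd, pow_add, hτ, zero_mul]
  have h3 := mul_dvd_mul h1 (hγ' (x e).1.2 (x e).2.2)
  rw [← pow_add, h2] at h3
  rw [zero_dvd_iff.1 h3, mul_zero, ite_self]

/-- Graphs with a distinguished bivalent vertex and graphs with a distinguished edge. -/
theorem sum_graphSum_update (X : Fin n → Tensor M L) (V : Tensor M L) (γ : M → M → L)
    {K : Tensor M L} (hK : ∀ α β, K α β ≠ 0 → ∑ j, α j = 1 ∧ ∑ j, β j = 1) (l : P → M)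
    (a b : ℕ) :
    ∑ i : Fin (a + 1), graphSum (E := Fin (b + 1)) (graphKind n (Fin (a + 1)))
      (Function.update (graphTensor (Fin (a + 1)) X V) (Sum.inr i) K) γ (fun _ => True) l =
    ((a + 1) * (b + 1)) • edgeSum (E := Fin b) (graphKind n (Fin a)) (graphTensor (Fin a) X V) γ
      (fun s r => ∑ p, ∑ q, γ s p * K (Pi.single p 1) (Pi.single q 1) * γ q r) l := by
  have h : ∀ (i : Fin (a + 1)) (e : Fin (b + 1)),
      graphSum (E := Fin (b + 1)) (graphKind n (Fin (a + 1)))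
        (Function.update (graphTensor (Fin (a + 1)) X V) (Sum.inr i) K) γ
        (fun x => (x e).2.1 = Sum.inr i) l =
      edgeSum (E := Fin b) (graphKind n (Fin a)) (graphTensor (Fin a) X V) γ
        (fun s r => ∑ p, ∑ q, γ s p * K (Pi.single p 1) (Pi.single q 1) * γ q r) l := by
    intro i e
    rw [← graphSum_subdivide _ _ hK]
    refine graphSum_relabel (optionVertexEquiv n i) (finSuccEquiv' e).symm (Equiv.refl P)
      ?_ ?_ γ ?_ (fun _ => rfl)
    · rintro (_ | k | j) <;> rfl
    · rintro (_ | k | j)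
      · exact Function.update_self _ _ _
      · exact Function.update_of_ne (by simp [optionVertexEquiv]) _ _
      · exact Function.update_of_ne (by simp [optionVertexEquiv]) _ _
    · intro x
      have h1 := Config.relabel_apply (optionVertexEquiv n i) (finSuccEquiv' e).symm x none
      rw [finSuccEquiv'_symm_none] at h1
      rw [h1]
      exact (optionVertexEquiv n i).apply_eq_iff_eq (y := none)
  have h' : ∀ i : Fin (a + 1), graphSum (E := Fin (b + 1)) (graphKind n (Fin (a + 1)))
      (Function.update (graphTensor (Fin (a + 1)) X V) (Sum.inr i) K) γ (fun _ => True) l =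
      (b + 1) • edgeSum (E := Fin b) (graphKind n (Fin a)) (graphTensor (Fin a) X V) γ
        (fun s r => ∑ p, ∑ q, γ s p * K (Pi.single p 1) (Pi.single q 1) * γ q r) l := fun i => by
    rw [graphSum_eq_sum_incoming _ _ hK (by exact trivial), Finset.sum_congr rfl fun e _ => h i e]
    simp
  rw [Finset.sum_congr rfl fun i _ => h' i, Finset.sum_const, Finset.card_univ, Fintype.card_fin,
    smul_smul]

variable [Algebra ℂ L]

/-- The derivative of the partition sum is given by the attachment of one more leg. -/
theorem derivation_partitionSum (δ : Derivation ℂ L L) (i : M) {τ : L} {N : ℕ} (hτ : τ ^ N = 0)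
    {X : Fin n → Tensor M L} {V K : Tensor M L} {γ : M → M → L}
    (hK : ∀ α β, K α β ≠ 0 → ∑ j, α j = 1 ∧ ∑ j, β j = 1)
    (hγ : ∀ s r, τ ∣ γ s r)
    (hδγ : ∀ s r, δ (γ s r) = ∑ p, ∑ q, γ s p * K (Pi.single p 1) (Pi.single q 1) * γ q r)
    (hV : ∀ α β, α ≠ 0 → β ≠ 0 → δ (V α β) = V (α + Pi.single i 1) β - K α β)
    (hX : ∀ k α β, δ (X k α β) = X k (α + Pi.single i 1) β) (l : P → M) :
    δ (partitionSum N X V γ l) =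
      partitionSum N X V γ fun o : Option P => o.elim i l := by
  have hstep : ∀ a b : ℕ,
      δ (graphSum (E := Fin b) (graphKind n (Fin a)) (graphTensor (Fin a) X V) γ
        (fun _ => True) l) =
      graphSum (E := Fin b) (graphKind n (Fin a)) (graphTensor (Fin a) X V) γ
        (fun _ => True) (fun o : Option P => o.elim i l) -
      ∑ j : Fin a, graphSum (E := Fin b) (graphKind n (Fin a))
        (Function.update (graphTensor (Fin a) X V) (Sum.inr j) K) γ (fun _ => True) l +
      edgeSum (E := Fin b) (graphKind n (Fin a)) (graphTensor (Fin a) X V) γ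
        (fun s r => ∑ p, ∑ q, γ s p * K (Pi.single p 1) (Pi.single q 1) * γ q r) l := by
    intro a b
    rw [derivation_graphSum δ i (Sum.elim (fun _ => 0) fun _ => K), Fintype.sum_sum_type]
    · simp only [hδγ, Sum.elim_inl, Sum.elim_inr]
      congr 2
      rw [add_eq_right]
      refine Finset.sum_eq_zero fun k _ => Finset.sum_eq_zero fun x _ =>
        Finset.sum_eq_zero fun s _ => ?_
      rw [graphWeight, prod_update_tensor]
      simp
    · rintro (k | j) α β h
      · simpa [graphTensor] using hX k α β
      · exact hV α β (h trivial).1 (h trivial).2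
  -- `A` collects the corrections with a distinguished bivalent vertex, `B` the terms with a
  -- differentiated edge. Their weighted sums have to cancel.
  set c : ℕ → ℕ → ℂ := fun a b => (a.factorial * b.factorial : ℂ)⁻¹ with hc
  set A : ℕ → ℕ → L := fun a b => ∑ j : Fin a, graphSum (E := Fin b) (graphKind n (Fin a))
    (Function.update (graphTensor (Fin a) X V) (Sum.inr j) K) γ (fun _ => True) l with hA
  set B : ℕ → ℕ → L := fun a b => edgeSum (E := Fin b) (graphKind n (Fin a))
    (graphTensor (Fin a) X V) γ
    (fun s r => ∑ p, ∑ q, γ s p * K (Pi.single p 1) (Pi.single q 1) * γ q r) l with hB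
  have hγ' : ∀ s r, τ ^ 2 ∣ ∑ p, ∑ q, γ s p * K (Pi.single p 1) (Pi.single q 1) * γ q r :=
    fun s r => Finset.dvd_sum fun p _ => Finset.dvd_sum fun q _ => by
      rw [mul_right_comm, pow_two]
      exact (mul_dvd_mul (hγ _ _) (hγ _ _)).mul_right _
  -- The bivalent vertex and its incoming edge can be numbered in `(a + 1)(b + 1)` ways, which is
  -- the ratio of the factorials.
  have hcA : ∀ a b, c (a + 1) (b + 1) • A (a + 1) (b + 1) = c a b • B a b := by
    intro a b
    simp only [hA, hB]
    rw [sum_graphSum_update X V γ hK l a b, ← Nat.cast_smul_eq_nsmul ℂ, smul_smul]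
    congr 1
    have h1 : ((a.factorial : ℂ)) ≠ 0 := Nat.cast_ne_zero.2 (Nat.factorial_ne_zero a)
    have h2 : ((b.factorial : ℂ)) ≠ 0 := Nat.cast_ne_zero.2 (Nat.factorial_ne_zero b)
    have h3 : (a + 1 : ℂ) ≠ 0 := Nat.cast_add_one_ne_zero a
    have h4 : (b + 1 : ℂ) ≠ 0 := Nat.cast_add_one_ne_zero b
    simp only [hc, Nat.factorial_succ]
    push_cast
    field_simp
  have hA0 : ∀ b, A 0 b = 0 := fun b => by simp [hA]
  have hA0' : ∀ a, A a 0 = 0 := fun a => by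
    simp only [hA]
    refine Finset.sum_eq_zero fun j _ => ?_
    rw [graphSum_eq_sum_incoming _ _ hK (by exact trivial)]
    simp
  -- After the shift of both indices only boundary terms remain. `A` vanishes without internal
  -- vertices or without edges. At the upper end `B` vanishes by nilpotency if the number of edges
  -- is maximal, and for lack of edges if only the number of internal vertices is.
  have hsum : ∑ a ∈ Finset.range N, ∑ b ∈ Finset.range N, c a b • A a b =
      ∑ a ∈ Finset.range N, ∑ b ∈ Finset.range N, c a b • B a b := by
    cases N with
    | zero => simp
    | succ N =>
      have hB1 : ∀ a, B a N = 0 := fun a =>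
        edgeSum_eq_zero_of_card hτ (by simp) _ _ hγ hγ' l
      have hB2 : ∀ b ∈ Finset.range N, B N b = 0 := fun b hb =>
        edgeSum_eq_zero_of_lt (by simpa using hb) _ _ _ l
      rw [Finset.sum_range_succ',
        Finset.sum_range_succ fun a => ∑ b ∈ Finset.range (N + 1), c a b • B a b]
      simp only [hA0, smul_zero, Finset.sum_const_zero, add_zero]
      have h1 : ∑ b ∈ Finset.range (N + 1), c N b • B N b = 0 := by
        rw [Finset.sum_range_succ, hB1, smul_zero, add_zero]
        exact Finset.sum_eq_zero fun b hb => by rw [hB2 b hb, smul_zero]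
      rw [h1, add_zero]
      refine Finset.sum_congr rfl fun a _ => ?_
      rw [Finset.sum_range_succ', Finset.sum_range_succ fun b => c a b • B a b, hA0', hB1]
      simp only [smul_zero, add_zero, hcA]
  unfold partitionSum
  simp only [map_sum, Derivation.map_smul, hstep, smul_add, smul_sub, Finset.sum_add_distrib,
    Finset.sum_sub_distrib]
  rw [sub_add, sub_eq_self, sub_eq_zero]
  exact hsum

end

/-! ## Cutting a graph with three external vertices -/

section Split

variable {E I M : Type*}

/-- The internal vertices `S` and the edges `T` are those below the second external vertex of a
graph with three external vertices. -/
structure Config.IsSplit (x : Config E (Fin 3 ⊕ I) M) (S : I → Prop) (T : E → Prop) : Prop where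
  tail_mem : ∀ e, T e → (x e).1.1 = Sum.inl 1 ∨ ∃ i, S i ∧ (x e).1.1 = Sum.inr i
  head_mem : ∀ e, T e → (x e).2.1 = Sum.inl 2 ∨ ∃ i, S i ∧ (x e).2.1 = Sum.inr i
  tail_of_not_mem : ∀ e, ¬ T e → (x e).1.1 = Sum.inl 0 ∨ ∃ i, ¬ S i ∧ (x e).1.1 = Sum.inr i
  exists_in : ∀ i, S i → ∃ e, T e ∧ (x e).2.1 = Sum.inr i

theorem Config.IsSplit.relabel_of {E' I' : Type*} {x : Config E (Fin 3 ⊕ I) M} {S : I → Prop}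
    {T : E → Prop} (h : x.IsSplit S T) (σ : I ≃ I') (ε : E ≃ E') {S' : I' → Prop} {T' : E' → Prop}
    (hS : ∀ i, S' (σ i) ↔ S i) (hT : ∀ e, T' (ε e) ↔ T e) {x' : Config E' (Fin 3 ⊕ I') M}
    (hx : ∀ e, x' (ε e) = ((Sum.map id σ (x e).1.1, (x e).1.2),
      (Sum.map id σ (x e).2.1, (x e).2.2))) : x'.IsSplit S' T' where
  tail_mem e' he := by
    obtain ⟨e, rfl⟩ := ε.surjective e'
    rw [hx]
    rcases h.tail_mem e ((hT e).1 he) with h1 | ⟨i, hi, h1⟩ <;> rw [h1]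
    · exact Or.inl rfl
    · exact Or.inr ⟨σ i, (hS i).2 hi, rfl⟩
  head_mem e' he := by
    obtain ⟨e, rfl⟩ := ε.surjective e'
    rw [hx]
    rcases h.head_mem e ((hT e).1 he) with h1 | ⟨i, hi, h1⟩ <;> rw [h1]
    · exact Or.inl rfl
    · exact Or.inr ⟨σ i, (hS i).2 hi, rfl⟩
  tail_of_not_mem e' he := by
    obtain ⟨e, rfl⟩ := ε.surjective e'
    rw [hx]
    rcases h.tail_of_not_mem e (fun h' => he ((hT e).2 h')) with h1 | ⟨i, hi, h1⟩ <;> rw [h1]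
    · exact Or.inl rfl
    · exact Or.inr ⟨σ i, fun h' => hi ((hS i).1 h'), rfl⟩
  exists_in i' hi := by
    obtain ⟨i, rfl⟩ := σ.surjective i'
    obtain ⟨e, he, h1⟩ := h.exists_in i ((hS i).1 hi)
    exact ⟨ε e, (hT e).2 he, by rw [hx, h1]; rfl⟩

/-- The relation between the tails and the heads of the edges. -/
def Config.Step {V : Type*} (x : Config E V M) (u w : V) : Prop :=
  ∃ e, (x e).1.1 = u ∧ (x e).2.1 = w

variable {x : Config E (Fin 3 ⊕ I) M} {S : I → Prop} {T : E → Prop}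

/-- Climbing back along lower edges decreases the height and can only end at the second external
vertex. Conversely, an edge that starts at this vertex or in `S` is a lower edge, so no path leaves
the lower part. -/
theorem Config.IsSplit.iff_reachable (h : x.IsSplit S T) (hx : x.Valid (graphKind 3 I)) (i : I) :
    S i ↔ Relation.TransGen x.Step (Sum.inl 1) (Sum.inr i) := by
  constructor
  · obtain ⟨r, hr⟩ := hx.acyclic
    suffices ∀ k i, r (Sum.inr i) ≤ k → S i → Relation.TransGen x.Step (Sum.inl 1) (Sum.inr i) from
      this _ i le_rfl
    intro k
    induction k with
    | zero =>
      intro i hi hS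
      obtain ⟨e, -, he⟩ := h.exists_in i hS
      have := hr e
      rw [he] at this
      omega
    | succ k ih =>
      intro i hi hS
      obtain ⟨e, hT, he⟩ := h.exists_in i hS
      have h1 := hr e
      rw [he] at h1
      rcases h.tail_mem e hT with ht | ⟨j, hj, ht⟩
      · exact .single ⟨e, ht, he⟩
      · rw [ht] at h1
        exact (ih j (by omega) hj).tail ⟨e, ht, he⟩
  · intro hi
    suffices ∀ v, Relation.TransGen x.Step (Sum.inl 1) v →
        v = Sum.inl 2 ∨ ∃ i, S i ∧ v = Sum.inr i by
      rcases this _ hi with h' | ⟨j, hj, h'⟩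
      · simp at h'
      · rwa [Sum.inr_injective h']
    have key : ∀ e, ((x e).1.1 = Sum.inl 1 ∨ ∃ i, S i ∧ (x e).1.1 = Sum.inr i) →
        (x e).2.1 = Sum.inl 2 ∨ ∃ i, S i ∧ (x e).2.1 = Sum.inr i := by
      intro e he
      refine h.head_mem e (by_contra fun hT => ?_)
      rcases h.tail_of_not_mem e hT with h1 | ⟨j, hj, h1⟩ <;> rw [h1] at he
      · simp at he
      · rcases he with he | ⟨i, hi, he⟩
        · simp at he
        · exact hj (by rwa [Sum.inr_injective he])
    intro v hv
    induction hv with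
    | single h1 =>
      obtain ⟨e, ht, rfl⟩ := h1
      exact key e (Or.inl ht)
    | tail _ h1 ih =>
      obtain ⟨e, rfl, rfl⟩ := h1
      rcases ih with ih | ih
      · exact absurd ih (hx.sink (Sum.inl 2) rfl e)
      · exact key e (Or.inr ih)

theorem Config.IsSplit.iff_tail (h : x.IsSplit S T) (e : E) :
    T e ↔ (x e).1.1 = Sum.inl 1 ∨ ∃ i, S i ∧ (x e).1.1 = Sum.inr i := by
  refine ⟨h.tail_mem e, fun he => by_contra fun hT => ?_⟩
  rcases h.tail_of_not_mem e hT with h1 | ⟨j, hj, h1⟩ <;> rw [h1] at he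
  · simp at he
  · rcases he with he | ⟨i, hi, he⟩
    · simp at he
    · exact hj (by rwa [Sum.inr_injective he])

theorem Config.Valid.lt_of_transGen {V : Type*} {x : Config E V M} {r : V → ℕ}
    (hr : ∀ e, r (x e).1.1 < r (x e).2.1) {u v : V} (h : Relation.TransGen x.Step u v) :
    r u < r v := by
  induction h with
  | single h1 =>
    obtain ⟨e, rfl, rfl⟩ := h1
    exact hr e
  | tail _ h1 ih =>
    obtain ⟨e, rfl, rfl⟩ := h1
    exact ih.trans (hr e)

theorem Config.Valid.exists_isSplit (hx : x.Valid (graphKind 3 I)) :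
    ∃ (S : I → Prop) (T : E → Prop), x.IsSplit S T := by
  obtain ⟨r, hr⟩ := hx.acyclic
  refine ⟨fun i => Relation.TransGen x.Step (Sum.inl 1) (Sum.inr i),
    fun e => (x e).1.1 = Sum.inl 1 ∨
      ∃ i, Relation.TransGen x.Step (Sum.inl 1) (Sum.inr i) ∧ (x e).1.1 = Sum.inr i,
    fun e he => he, fun e he => ?_, fun e he => ?_, fun i hi => ?_⟩
  · have h1 : Relation.TransGen x.Step (Sum.inl 1) (x e).2.1 := by
      rcases he with he | ⟨i, hi, he⟩
      · exact .single ⟨e, he, rfl⟩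
      · exact hi.tail ⟨e, he, rfl⟩
    match h2 : (x e).2.1 with
    | Sum.inl 0 => exact absurd h2 (hx.source (Sum.inl 0) rfl e)
    | Sum.inl 1 => exact absurd (Config.Valid.lt_of_transGen hr h1) (by rw [h2]; exact lt_irrefl _)
    | Sum.inl 2 => exact Or.inl rfl
    | Sum.inr i => exact Or.inr ⟨i, h2 ▸ h1, rfl⟩
  · match h2 : (x e).1.1 with
    | Sum.inl 0 => exact Or.inl rfl
    | Sum.inl 1 => exact absurd (Or.inl h2) he
    | Sum.inl 2 => exact absurd h2 (hx.sink (Sum.inl 2) rfl e)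
    | Sum.inr i => exact Or.inr ⟨i, fun hi => he (Or.inr ⟨i, hi, h2⟩), rfl⟩
  -- The last step of the path starts at the second external vertex or at a reachable internal
  -- vertex: the first external vertex cannot be reached and the last one cannot be left.
  · cases hi with
    | single h1 =>
      obtain ⟨e, ht, hh⟩ := h1
      exact ⟨e, Or.inl ht, hh⟩
    | tail h0 h1 =>
      obtain ⟨e, rfl, hh⟩ := h1
      refine ⟨e, ?_, hh⟩
      match h2 : (x e).1.1 with
      | Sum.inl 0 =>
        rw [h2] at h0
        cases h0 with
        | single h1 =>
          obtain ⟨e', -, h'⟩ := h1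
          exact absurd h' (hx.source (Sum.inl 0) rfl e')
        | tail _ h1 =>
          obtain ⟨e', -, h'⟩ := h1
          exact absurd h' (hx.source (Sum.inl 0) rfl e')
      | Sum.inl 1 => exact Or.inl rfl
      | Sum.inl 2 => exact absurd h2 (hx.sink (Sum.inl 2) rfl e)
      | Sum.inr i => exact Or.inr ⟨i, h2 ▸ h0, rfl⟩

theorem Config.Valid.existsUnique_isSplit [Fintype I] [Fintype E] (hx : x.Valid (graphKind 3 I)) :
    ∃! st : Finset I × Finset E, x.IsSplit (· ∈ st.1) (· ∈ st.2) := by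
  classical
  obtain ⟨S, T, h⟩ := hx.exists_isSplit
  refine ⟨(Finset.univ.filter S, Finset.univ.filter T), by simpa using h, ?_⟩
  rintro ⟨S', T'⟩ h'
  have hS : ∀ i, i ∈ S' ↔ S i := fun i => by
    rw [h.iff_reachable hx, ← h'.iff_reachable hx]
  refine Prod.ext (Finset.ext fun i => by simpa using hS i) (Finset.ext fun e => ?_)
  have h1 := h'.iff_tail e
  simp only [hS] at h1
  rw [h1, ← h.iff_tail]
  simp

variable {P L : Type*} [Fintype E] [Fintype I] [DecidableEq E] [Fintype M] [DecidableEq M]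
  [CommRing L] [Fintype P] [DecidableEq P]

/-- Each valid configuration has exactly one cut, so it is counted once on the right. -/
theorem graphSum_eq_sum_isSplit (t : Fin 3 ⊕ I → Tensor M L) (γ : M → M → L) (l : P → M) :
    graphSum (E := E) (graphKind 3 I) t γ (fun _ => True) l =
      ∑ S : Finset I, ∑ T : Finset E,
        graphSum (E := E) (graphKind 3 I) t γ (fun x => x.IsSplit (· ∈ S) (· ∈ T)) l := by
  classical
  refine Eq.trans ?_ (Fintype.sum_prod_type' fun (S : Finset I) (T : Finset E) =>
    graphSum (E := E) (graphKind 3 I) t γ (fun x => x.IsSplit (· ∈ S) (· ∈ T)) l)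
  unfold graphSum
  rw [Finset.sum_comm (s := (Finset.univ : Finset (Finset I × Finset E)))]
  refine Finset.sum_congr rfl fun x _ => ?_
  rw [Finset.sum_comm (s := (Finset.univ : Finset (Finset I × Finset E)))]
  refine Finset.sum_congr rfl fun s _ => ?_
  by_cases hx : x.Valid (graphKind 3 I)
  · obtain ⟨st, h1, h2⟩ := hx.existsUnique_isSplit
    rw [Finset.sum_eq_single st]
    · simp [hx, h1]
    · intro st' _ hne
      rw [if_neg fun h => hne (h2 st' h.2)]
    · simp
  · simp [hx]

theorem exists_equiv_sum {H : Type*} [Fintype H] (S : Finset H) {a b : ℕ} (hb : S.card = b)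
    (ha : Fintype.card H = a + b) : ∃ σ : H ≃ Fin a ⊕ Fin b, ∀ i, (σ i).isRight ↔ i ∈ S := by
  classical
  have h1 : Fintype.card {i // i ∈ S} = b := by simpa using hb
  have h2 : Fintype.card {i // ¬ i ∈ S} = a := by
    rw [Fintype.card_subtype_compl, h1, ha, Nat.add_sub_cancel]
  refine ⟨(Equiv.sumCompl (· ∈ S)).symm.trans (((Fintype.equivFinOfCardEq h1).sumCongr
    (Fintype.equivFinOfCardEq h2)).trans (Equiv.sumComm _ _)), fun i => ?_⟩
  by_cases hi : i ∈ S
  · simp [hi]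
  · simp [hi]

/-- Only the cardinalities of `S` and `T` matter: after a renumbering the lower vertices and the
lower edges are the right summands. -/
theorem graphSum_isSplit_eq (X : Fin 3 → Tensor M L) (V : Tensor M L) (γ : M → M → L) (l : P → M)
    (S : Finset I) (T : Finset E) {a b c d : ℕ} (hS : S.card = b) (hI : Fintype.card I = a + b)
    (hT : T.card = d) (hE : Fintype.card E = c + d) :
    graphSum (E := E) (graphKind 3 I) (graphTensor I X V) γ
        (fun x => x.IsSplit (· ∈ S) (· ∈ T)) l =
      graphSum (E := Fin c ⊕ Fin d) (graphKind 3 (Fin a ⊕ Fin b))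
        (graphTensor (Fin a ⊕ Fin b) X V) γ
        (fun x => x.IsSplit (fun i => i.isRight) (fun e => e.isRight)) l := by
  obtain ⟨σ, hσ⟩ := exists_equiv_sum S hS hI
  obtain ⟨ε, hε⟩ := exists_equiv_sum T hT hE
  refine (graphSum_relabel ((Equiv.refl (Fin 3)).sumCongr σ) ε (Equiv.refl P) ?_ ?_ γ ?_
    fun _ => rfl).symm
  · rintro (k | i) <;> rfl
  · rintro (k | i) <;> rfl
  · intro x
    constructor
    · intro h
      refine h.relabel_of σ.symm ε.symm (fun i => ?_) (fun e => ?_) fun e' => ?_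
      · rw [← hσ, Equiv.apply_symm_apply]
      · rw [← hε, Equiv.apply_symm_apply]
      · obtain ⟨e, rfl⟩ := ε.surjective e'
        simp [Config.relabel_apply, Sum.map_map]
    · exact fun h => h.relabel_of σ ε hσ hε (Config.relabel_apply _ _ _)

end Split

/-! ## Gluing two graphs -/

section Glue

variable {E E₁ E₂ I₁ I₂ M L : Type*}

/-- The upper vertices of a glued graph. -/
def upper (I₁ I₂ : Type*) : Fin 2 ⊕ I₁ → Fin 3 ⊕ (I₁ ⊕ I₂) := Sum.map ![0, 2] Sum.inl

/-- The lower vertices of a glued graph. -/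
def lower (I₁ I₂ : Type*) : Fin 2 ⊕ I₂ → Fin 3 ⊕ (I₁ ⊕ I₂) := Sum.map ![1, 2] Sum.inr

/-- The collapse of all lower vertices to the last external vertex. -/
def toUpper : Fin 3 ⊕ (I₁ ⊕ I₂) → Fin 2 ⊕ I₁ :=
  Sum.elim ![Sum.inl 0, Sum.inl 1, Sum.inl 1] (Sum.elim Sum.inr fun _ => Sum.inl 1)

/-- A left inverse of `lower`. -/
def toLower : Fin 3 ⊕ (I₁ ⊕ I₂) → Fin 2 ⊕ I₂ :=
  Sum.elim ![Sum.inl 0, Sum.inl 0, Sum.inl 1] (Sum.elim (fun _ => Sum.inl 0) Sum.inr)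

theorem toUpper_upper (v : Fin 2 ⊕ I₁) : toUpper (upper I₁ I₂ v) = v := by
  rcases v with k | i
  · fin_cases k <;> rfl
  · rfl

theorem toUpper_lower (v : Fin 2 ⊕ I₂) : toUpper (lower I₁ I₂ v) = Sum.inl 1 := by
  rcases v with k | i
  · fin_cases k <;> rfl
  · rfl

theorem toLower_lower (v : Fin 2 ⊕ I₂) : toLower (lower I₁ I₂ v) = v := by
  rcases v with k | i
  · fin_cases k <;> rfl
  · rfl

theorem lower_toLower {v : Fin 3 ⊕ (I₁ ⊕ I₂)} (h : toUpper v = Sum.inl 1) :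
    lower I₁ I₂ (toLower v) = v := by
  rcases v with k | i | j
  · fin_cases k
    · simp [toUpper] at h
    · rfl
    · rfl
  · simp [toUpper] at h
  · rfl

theorem upper_toUpper {v : Fin 3 ⊕ (I₁ ⊕ I₂)} (h : toUpper v ≠ Sum.inl 1) :
    upper I₁ I₂ (toUpper v) = v := by
  rcases v with k | i | j
  · fin_cases k
    · rfl
    · simp [toUpper] at h
    · simp [toUpper] at h
  · rfl
  · simp [toUpper] at h

theorem upper_injective : Function.Injective (upper I₁ I₂) :=
  Function.LeftInverse.injective toUpper_upper

theorem lower_injective : Function.Injective (lower I₁ I₂) :=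
  Function.LeftInverse.injective toLower_lower

theorem upper_ne_lower {v : Fin 2 ⊕ I₁} (hv : v ≠ Sum.inl 1) (w : Fin 2 ⊕ I₂) :
    upper I₁ I₂ v ≠ lower I₁ I₂ w := fun h => hv <| by
  rw [← toUpper_upper (I₂ := I₂) v, h, toUpper_lower]

open Classical in
/-- The head of an edge of the upper graph: the heads at the last external vertex are distributed over
the lower vertices by `s`. -/
noncomputable def glueHead (x₁ : Config E₁ (Fin 2 ⊕ I₁) M)
    (s : {e // (x₁ e).2.1 = Sum.inl 1} → Fin 2 ⊕ I₂) (e : E₁) : Fin 3 ⊕ (I₁ ⊕ I₂) :=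
  if h : (x₁ e).2.1 = Sum.inl 1 then lower I₁ I₂ (s ⟨e, h⟩) else upper I₁ I₂ (x₁ e).2.1

theorem glueHead_of_eq {x₁ : Config E₁ (Fin 2 ⊕ I₁) M}
    (s : {e // (x₁ e).2.1 = Sum.inl 1} → Fin 2 ⊕ I₂) (p : {e // (x₁ e).2.1 = Sum.inl 1}) :
    glueHead x₁ s p = lower I₁ I₂ (s p) := dif_pos p.2

theorem glueHead_of_ne {x₁ : Config E₁ (Fin 2 ⊕ I₁) M}
    (s : {e // (x₁ e).2.1 = Sum.inl 1} → Fin 2 ⊕ I₂) {e : E₁} (h : (x₁ e).2.1 ≠ Sum.inl 1) :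
    glueHead x₁ s e = upper I₁ I₂ (x₁ e).2.1 := dif_neg h

theorem toUpper_glueHead (x₁ : Config E₁ (Fin 2 ⊕ I₁) M)
    (s : {e // (x₁ e).2.1 = Sum.inl 1} → Fin 2 ⊕ I₂) (e : E₁) :
    toUpper (glueHead x₁ s e) = (x₁ e).2.1 := by
  by_cases h : (x₁ e).2.1 = Sum.inl 1
  · rw [glueHead_of_eq s ⟨e, h⟩, toUpper_lower, h]
  · rw [glueHead_of_ne s h, toUpper_upper]

/-- The upper vertices other than the last external one. -/
theorem glueHead_eq_upper_iff (x₁ : Config E₁ (Fin 2 ⊕ I₁) M)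
    (s : {e // (x₁ e).2.1 = Sum.inl 1} → Fin 2 ⊕ I₂) (e : E₁) {v : Fin 2 ⊕ I₁}
    (hv : v ≠ Sum.inl 1) : glueHead x₁ s e = upper I₁ I₂ v ↔ (x₁ e).2.1 = v := by
  constructor
  · intro h
    rw [← toUpper_glueHead x₁ s e, h, toUpper_upper]
  · rintro rfl
    exact glueHead_of_ne s hv

/-- The graph obtained by gluing `x₂` into the last external vertex of `x₁`. -/
noncomputable def glue (x₁ : Config E₁ (Fin 2 ⊕ I₁) M)
    (s : {e // (x₁ e).2.1 = Sum.inl 1} → Fin 2 ⊕ I₂) (x₂ : Config E₂ (Fin 2 ⊕ I₂) M) :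
    Config (E₁ ⊕ E₂) (Fin 3 ⊕ (I₁ ⊕ I₂)) M :=
  Sum.elim
    (fun e => ((upper I₁ I₂ (x₁ e).1.1, (x₁ e).1.2), (glueHead x₁ s e, (x₁ e).2.2)))
    (fun e => ((lower I₁ I₂ (x₂ e).1.1, (x₂ e).1.2), (lower I₁ I₂ (x₂ e).2.1, (x₂ e).2.2)))

/-- The collapse `toUpper` recovers the heads in the upper graph, and the injectivity of `lower`
recovers the attachments `s`. -/
theorem glue_injective : Function.Injective
    fun z : (Σ x₁ : Config E₁ (Fin 2 ⊕ I₁) M, ({e // (x₁ e).2.1 = Sum.inl 1} → Fin 2 ⊕ I₂)) ×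
      Config E₂ (Fin 2 ⊕ I₂) M => glue z.1.1 z.1.2 z.2 := by
  rintro ⟨⟨x₁, s⟩, x₂⟩ ⟨⟨x₁', s'⟩, x₂'⟩ h
  have h1 := fun e => congrFun h (Sum.inl e)
  have h2 := fun e => congrFun h (Sum.inr e)
  simp only [glue, Sum.elim_inl, Sum.elim_inr, Prod.mk.injEq, upper_injective.eq_iff,
    lower_injective.eq_iff] at h1 h2
  have hx : x₁ = x₁' := funext fun e => by
    refine Prod.ext (Prod.ext (h1 e).1.1 (h1 e).1.2) (Prod.ext ?_ (h1 e).2.2)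
    rw [← toUpper_glueHead x₁ s, (h1 e).2.1, toUpper_glueHead]
  subst hx
  have hs : s = s' := funext fun p => lower_injective (I₁ := I₁) <| by
    rw [← glueHead_of_eq, ← glueHead_of_eq, (h1 p).2.1]
  subst hs
  have hx' : x₂ = x₂' := funext fun e =>
    Prod.ext (Prod.ext (h2 e).1.1 (h2 e).1.2) (Prod.ext (h2 e).2.1 (h2 e).2.2)
  rw [hx']

/-- The lower part of a glued graph. -/
abbrev Config.IsGlued (x : Config (E₁ ⊕ E₂) (Fin 3 ⊕ (I₁ ⊕ I₂)) M) : Prop :=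
  x.IsSplit (fun i => i.isRight) (fun e => e.isRight)

/-- The collapse maps lose nothing here: upper edges start at upper vertices, both ends of a lower
edge are lower vertices, and `s` remembers where the edges between the two parts end. -/
theorem Config.IsSplit.exists_glue {x : Config (E₁ ⊕ E₂) (Fin 3 ⊕ (I₁ ⊕ I₂)) M}
    (h : x.IsGlued) : ∃ (x₁ : Config E₁ (Fin 2 ⊕ I₁) M)
      (s : {e // (x₁ e).2.1 = Sum.inl 1} → Fin 2 ⊕ I₂) (x₂ : Config E₂ (Fin 2 ⊕ I₂) M),
      glue x₁ s x₂ = x := by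
  refine ⟨fun e => ((toUpper (x (Sum.inl e)).1.1, (x (Sum.inl e)).1.2),
      (toUpper (x (Sum.inl e)).2.1, (x (Sum.inl e)).2.2)),
    fun p => toLower (x (Sum.inl p)).2.1,
    fun e => ((toLower (x (Sum.inr e)).1.1, (x (Sum.inr e)).1.2),
      (toLower (x (Sum.inr e)).2.1, (x (Sum.inr e)).2.2)), ?_⟩
  funext e
  rcases e with e | e
  · refine Prod.ext (Prod.ext ?_ rfl) (Prod.ext ?_ rfl)
    · refine upper_toUpper ?_
      rcases h.tail_of_not_mem (Sum.inl e) (by simp) with h1 | ⟨i | i, hi, h1⟩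
      · rw [h1]
        simp [toUpper]
      · rw [h1]
        simp [toUpper]
      · simp at hi
    · by_cases h1 : toUpper (x (Sum.inl e)).2.1 = Sum.inl 1
      · simp only [glue, Sum.elim_inl, glueHead]
        rw [dif_pos h1, lower_toLower h1]
      · simp only [glue, Sum.elim_inl, glueHead]
        rw [dif_neg h1, upper_toUpper h1]
  · refine Prod.ext (Prod.ext ?_ rfl) (Prod.ext ?_ rfl)
    · refine lower_toLower ?_
      rcases h.tail_mem (Sum.inr e) rfl with h1 | ⟨i | i, hi, h1⟩
      · rw [h1]
        rfl
      · simp at hi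
      · rw [h1]
        rfl
    · refine lower_toLower ?_
      rcases h.head_mem (Sum.inr e) rfl with h1 | ⟨i | i, hi, h1⟩
      · rw [h1]
        rfl
      · simp at hi
      · rw [h1]
        rfl

section

variable {x₁ : Config E₁ (Fin 2 ⊕ I₁) M} {s : {e // (x₁ e).2.1 = Sum.inl 1} → Fin 2 ⊕ I₂}
  {x₂ : Config E₂ (Fin 2 ⊕ I₂) M}

theorem lower_eq_two {v : Fin 2 ⊕ I₂} : lower I₁ I₂ v = Sum.inl 2 ↔ v = Sum.inl 1 :=
  lower_injective.eq_iff (b := Sum.inl 1)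

theorem lower_ne_zero (v : Fin 2 ⊕ I₂) : lower I₁ I₂ v ≠ Sum.inl 0 :=
  (upper_ne_lower (I₁ := I₁) (v := Sum.inl 0) (by simp) v).symm

theorem glueHead_ne_zero (h₁ : x₁.Valid (graphKind 2 I₁)) (e : E₁) :
    glueHead x₁ s e ≠ Sum.inl 0 := fun h =>
  h₁.source (Sum.inl 0) rfl e
    ((glueHead_eq_upper_iff x₁ s e (v := Sum.inl 0) (by simp)).1 h)

theorem glue_valid [Fintype I₁] (h₁ : x₁.Valid (graphKind 2 I₁)) (h₂ : x₂.Valid (graphKind 2 I₂)) :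
    (glue x₁ s x₂).Valid (graphKind 3 (I₁ ⊕ I₂)) where
  acyclic := by
    classical
    obtain ⟨r₁, hr₁⟩ := h₁.acyclic
    obtain ⟨r₂, hr₂⟩ := h₂.acyclic
    -- The shift gives every lower vertex a greater height than every upper one.
    refine ⟨fun v => if toUpper v = Sum.inl 1 then (∑ u, r₁ u) + 1 + r₂ (toLower v) else
      r₁ (toUpper v), ?_⟩
    have hle : ∀ u, r₁ u ≤ ∑ u, r₁ u := fun u =>
      Finset.single_le_sum (f := r₁) (fun _ _ => Nat.zero_le _) (Finset.mem_univ u)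
    rintro (e | e)
    · have ht := h₁.sink (Sum.inl 1) rfl e
      simp only [glue, Sum.elim_inl, toUpper_upper, toUpper_glueHead, if_neg ht]
      split_ifs
      · have := hle (x₁ e).1.1
        omega
      · exact hr₁ e
    · simp only [glue, Sum.elim_inr, toUpper_lower, toLower_lower, if_true]
      have := hr₂ e
      omega
  exists_in v hv := by
    rcases v with k | i | i
    · exact hv.elim
    · obtain ⟨e, he⟩ := h₁.exists_in (Sum.inr i) trivial
      exact ⟨Sum.inl e, (glueHead_eq_upper_iff x₁ s e (v := Sum.inr i) (by simp)).2 he⟩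
    · obtain ⟨e, he⟩ := h₂.exists_in (Sum.inr i) trivial
      exact ⟨Sum.inr e, congrArg (lower I₁ I₂) he⟩
  exists_out v hv := by
    rcases v with k | i | i
    · exact hv.elim
    · obtain ⟨e, he⟩ := h₁.exists_out (Sum.inr i) trivial
      exact ⟨Sum.inl e, congrArg (upper I₁ I₂) he⟩
    · obtain ⟨e, he⟩ := h₂.exists_out (Sum.inr i) trivial
      exact ⟨Sum.inr e, congrArg (lower I₁ I₂) he⟩
  source v hv e := by
    rcases v with k | i | i
    · obtain rfl : k = 0 := Fin.ext hv
      rcases e with e | e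
      · exact glueHead_ne_zero h₁ e
      · exact lower_ne_zero _
    · exact hv.elim
    · exact hv.elim
  sink v hv e := by
    rcases v with k | i | i
    · obtain rfl : k = 2 := Fin.ext (Nat.succ_injective hv)
      rcases e with e | e
      · exact fun h => h₁.sink (Sum.inl 1) rfl e (upper_injective (a₂ := Sum.inl 1) h)
      · exact fun h => h₂.sink (Sum.inl 1) rfl e (lower_eq_two.1 h)
    · exact hv.elim
    · exact hv.elim

theorem glue_isGlued (h₁ : x₁.Valid (graphKind 2 I₁)) (h₂ : x₂.Valid (graphKind 2 I₂)) :
    (glue x₁ s x₂).IsGlued where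
  tail_mem e he := by
    rcases e with e | e
    · simp at he
    match h : (x₂ e).1.1 with
    | Sum.inl 0 => exact Or.inl (congrArg (lower I₁ I₂) h)
    | Sum.inl 1 => exact absurd h (h₂.sink (Sum.inl 1) rfl e)
    | Sum.inr i => exact Or.inr ⟨Sum.inr i, rfl, congrArg (lower I₁ I₂) h⟩
  head_mem e he := by
    rcases e with e | e
    · simp at he
    match h : (x₂ e).2.1 with
    | Sum.inl 0 => exact absurd h (h₂.source (Sum.inl 0) rfl e)
    | Sum.inl 1 => exact Or.inl (congrArg (lower I₁ I₂) h)
    | Sum.inr i => exact Or.inr ⟨Sum.inr i, rfl, congrArg (lower I₁ I₂) h⟩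
  tail_of_not_mem e he := by
    rcases e with e | e
    · match h : (x₁ e).1.1 with
      | Sum.inl 0 => exact Or.inl (congrArg (upper I₁ I₂) h)
      | Sum.inl 1 => exact absurd h (h₁.sink (Sum.inl 1) rfl e)
      | Sum.inr i => exact Or.inr ⟨Sum.inl i, by simp, congrArg (upper I₁ I₂) h⟩
    · simp at he
  exists_in i hi := by
    rcases i with i | i
    · simp at hi
    · obtain ⟨e, he⟩ := h₂.exists_in (Sum.inr i) trivial
      exact ⟨Sum.inr e, rfl, congrArg (lower I₁ I₂) he⟩

/-- The contraction of the lower part creates no cycle because no edge leaves the contracted vertex,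
which can thus be given a height beyond all others. -/
theorem upper_valid_of_glue [Fintype I₁] [Fintype I₂]
    (h : (glue x₁ s x₂).Valid (graphKind 3 (I₁ ⊕ I₂))) : x₁.Valid (graphKind 2 I₁) := by
  have htail : ∀ e, (x₁ e).1.1 ≠ Sum.inl 1 := fun e he => by
    have hu : (glue x₁ s x₂ (Sum.inl e)).1.1 = Sum.inl 2 := congrArg (upper I₁ I₂) he
    exact h.sink (Sum.inl 2) rfl _ hu
  refine ⟨?_, fun v hv => ?_, fun v hv => ?_, fun v hv e => ?_, fun v hv e => ?_⟩
  · classical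
    obtain ⟨r, hr⟩ := h.acyclic
    refine ⟨fun v => if v = Sum.inl 1 then (∑ u, r u) + 1 else r (upper I₁ I₂ v), fun e => ?_⟩
    have h1 := hr (Sum.inl e)
    have hle := Finset.single_le_sum (f := r) (fun _ _ => Nat.zero_le _)
      (Finset.mem_univ (upper I₁ I₂ (x₁ e).1.1))
    simp only [if_neg (htail e)]
    split_ifs with h2
    · omega
    · simpa only [glue, Sum.elim_inl, glueHead_of_ne s h2] using h1
  · rcases v with k | i
    · exact hv.elim
    · obtain ⟨e | e, he⟩ := h.exists_in (Sum.inr (Sum.inl i)) trivial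
      · exact ⟨e, (glueHead_eq_upper_iff x₁ s e (v := Sum.inr i) (by simp)).1 he⟩
      · exact absurd he.symm (upper_ne_lower (v := Sum.inr i) (by simp) _)
  · rcases v with k | i
    · exact hv.elim
    · obtain ⟨e | e, he⟩ := h.exists_out (Sum.inr (Sum.inl i)) trivial
      · exact ⟨e, upper_injective (a₂ := Sum.inr i) he⟩
      · exact absurd he.symm (upper_ne_lower (v := Sum.inr i) (by simp) _)
  · rcases v with k | i
    · obtain rfl : k = 0 := Fin.ext hv
      intro he
      exact h.source (Sum.inl 0) rfl (Sum.inl e)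
        ((glueHead_eq_upper_iff x₁ s e (v := Sum.inl 0) (by simp)).2 he)
    · exact hv.elim
  · rcases v with k | i
    · obtain rfl : k = 1 := Fin.ext (Nat.succ_injective hv)
      exact htail e
    · exact hv.elim

/-- The cut conditions are indispensable: a lower internal vertex might receive edges from the upper
part only. That its outgoing edge is a lower one follows from the position of the tails of the upper
edges. -/
theorem lower_valid_of_glue (h : (glue x₁ s x₂).Valid (graphKind 3 (I₁ ⊕ I₂)))
    (hs : (glue x₁ s x₂).IsGlued) : x₂.Valid (graphKind 2 I₂) := by
  refine ⟨?_, fun v hv => ?_, fun v hv => ?_, fun v hv e => ?_, fun v hv e => ?_⟩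
  · obtain ⟨r, hr⟩ := h.acyclic
    exact ⟨fun v => r (lower I₁ I₂ v), fun e => hr (Sum.inr e)⟩
  · rcases v with k | i
    · exact hv.elim
    · obtain ⟨e | e, he, he'⟩ := hs.exists_in (Sum.inr i) rfl
      · simp at he
      · exact ⟨e, lower_injective (a₂ := Sum.inr i) he'⟩
  · rcases v with k | i
    · exact hv.elim
    · obtain ⟨e | e, he⟩ := h.exists_out (Sum.inr (Sum.inr i)) trivial
      · rcases hs.tail_of_not_mem (Sum.inl e) (by simp) with h1 | ⟨j | j, hj, h1⟩
        · rw [h1] at he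
          simp at he
        · rw [h1] at he
          simp at he
        · simp at hj
      · exact ⟨e, lower_injective (a₂ := Sum.inr i) he⟩
  · rcases v with k | i
    · obtain rfl : k = 0 := Fin.ext hv
      intro he
      have hl : (glue x₁ s x₂ (Sum.inr e)).2.1 = Sum.inl 1 := congrArg (lower I₁ I₂) he
      rcases hs.head_mem (Sum.inr e) rfl with h1 | ⟨j, -, h1⟩ <;> rw [h1] at hl <;> simp at hl
    · exact hv.elim
  · rcases v with k | i
    · obtain rfl : k = 1 := Fin.ext (Nat.succ_injective hv)
      intro he
      have hl : (glue x₁ s x₂ (Sum.inr e)).1.1 = Sum.inl 2 := congrArg (lower I₁ I₂) he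
      exact h.sink (Sum.inl 2) rfl _ hl
    · exact hv.elim

theorem glue_valid_iff [Fintype I₁] [Fintype I₂] :
    (glue x₁ s x₂).Valid (graphKind 3 (I₁ ⊕ I₂)) ∧ (glue x₁ s x₂).IsGlued ↔
      x₁.Valid (graphKind 2 I₁) ∧ x₂.Valid (graphKind 2 I₂) :=
  ⟨fun h => ⟨upper_valid_of_glue h.1, lower_valid_of_glue h.1 h.2⟩,
    fun h => ⟨glue_valid h.1 h.2, glue_isGlued h.1 h.2⟩⟩

end

end Glue

/-! ### Multi-indices and weights of glued graphs. -/

section Glue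

variable {V M L : Type*} [DecidableEq M]

theorem multiIndex_of_isEmpty {H : Type*} [Fintype H] [IsEmpty H] (y : H → V × M) (v : V) :
    multiIndex y v = 0 := by
  simp [multiIndex]

theorem multiIndex_sum {H H' : Type*} [Fintype H] [Fintype H'] (y : H ⊕ H' → V × M) (v : V) :
    multiIndex y v = multiIndex (fun a => y (Sum.inl a)) v + multiIndex (fun a => y (Sum.inr a)) v :=
  Fintype.sum_sum_type _

theorem multiIndex_eq_zero {H : Type*} [Fintype H] {y : H → V × M} {v : V}
    (h : ∀ a, (y a).1 ≠ v) : multiIndex y v = 0 :=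
  Finset.sum_eq_zero fun a _ => if_neg (h a)

theorem multiIndex_congr {V' H : Type*} [Fintype H] {y : H → V × M} {y' : H → V' × M} {v : V}
    {v' : V'} (h : ∀ a, (y a).1 = v ↔ (y' a).1 = v') (h' : ∀ a, (y a).2 = (y' a).2) :
    multiIndex y v = multiIndex y' v' := by
  refine Finset.sum_congr rfl fun a _ => ?_
  by_cases hv : (y a).1 = v
  · rw [if_pos hv, if_pos ((h a).1 hv), h']
  · rw [if_neg hv, if_neg (mt (h a).2 hv)]

variable {E₁ E₂ I₁ I₂ : Type*} [Fintype E₁] [Fintype E₂]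
  {x₁ : Config E₁ (Fin 2 ⊕ I₁) M} {s : {e // (x₁ e).2.1 = Sum.inl 1} → Fin 2 ⊕ I₂}
  {x₂ : Config E₂ (Fin 2 ⊕ I₂) M}

theorem multiIndex_glue_head_upper {u : Fin 2 ⊕ I₁} (hu : u ≠ Sum.inl 1) :
    multiIndex (fun e => (glue x₁ s x₂ e).2) (upper I₁ I₂ u) =
      multiIndex (fun e => (x₁ e).2) u := by
  rw [multiIndex_sum, multiIndex_eq_zero (y := fun e => (glue x₁ s x₂ (Sum.inr e)).2)
    (fun e => (upper_ne_lower hu _).symm), add_zero]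
  exact multiIndex_congr (fun e => glueHead_eq_upper_iff x₁ s e hu) fun e => rfl

theorem multiIndex_glue_tail_upper {u : Fin 2 ⊕ I₁} (hu : u ≠ Sum.inl 1) :
    multiIndex (fun e => (glue x₁ s x₂ e).1) (upper I₁ I₂ u) =
      multiIndex (fun e => (x₁ e).1) u := by
  rw [multiIndex_sum, multiIndex_eq_zero (y := fun e => (glue x₁ s x₂ (Sum.inr e)).1)
    (fun e => (upper_ne_lower hu _).symm), add_zero]
  exact multiIndex_congr (fun e => upper_injective.eq_iff) fun e => rfl

theorem multiIndex_glue_tail_lower (h : ∀ e, (x₁ e).1.1 ≠ Sum.inl 1) (w : Fin 2 ⊕ I₂) :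
    multiIndex (fun e => (glue x₁ s x₂ e).1) (lower I₁ I₂ w) =
      multiIndex (fun e => (x₂ e).1) w := by
  rw [multiIndex_sum, multiIndex_eq_zero (y := fun e => (glue x₁ s x₂ (Sum.inl e)).1)
    (fun e => upper_ne_lower (h e) _), zero_add]
  exact multiIndex_congr (fun e => lower_injective.eq_iff) fun e => rfl

variable [DecidableEq I₁]

/-- The upper edges that `s` sends to a lower vertex act there as legs. -/
theorem multiIndex_glue_head_lower (w : Fin 2 ⊕ I₂) :
    multiIndex (fun e => (glue x₁ s x₂ e).2) (lower I₁ I₂ w) =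
      multiIndex (fun e => (x₂ e).2) w +
        multiIndex (fun p : {e // (x₁ e).2.1 = Sum.inl 1} => (s p, (x₁ p).2.2)) w := by
  rw [multiIndex_sum, add_comm]
  congr 1
  · exact multiIndex_congr (fun e => lower_injective.eq_iff) fun e => rfl
  · rw [multiIndex, ← Fintype.sum_subtype_add_sum_subtype fun e => (x₁ e).2.1 = Sum.inl 1]
    have h0 : ∀ p : {e // ¬ (x₁ e).2.1 = Sum.inl 1},
        (glue x₁ s x₂ (Sum.inl p)).2.1 ≠ lower I₁ I₂ w := fun p => by
      simp only [glue, Sum.elim_inl]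
      rw [glueHead_of_ne s p.2]
      exact upper_ne_lower p.2 w
    rw [Finset.sum_eq_zero fun (p : {e // ¬ (x₁ e).2.1 = Sum.inl 1}) _ => if_neg (h0 p), add_zero]
    refine multiIndex_congr (y := fun p : {e // (x₁ e).2.1 = Sum.inl 1} =>
      (glue x₁ s x₂ (Sum.inl p)).2) (fun p => ?_) fun p => rfl
    simp only [glue, Sum.elim_inl]
    rw [glueHead_of_eq]
    exact lower_injective.eq_iff

variable [Fintype I₁] [Fintype I₂] [CommRing L]

/-- The constant tensor `1` is a placeholder at the contracted vertex, whose contribution is the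
second factor. The families `y` and `y'` are empty and therefore arbitrary. -/
theorem graphWeight_glue {P : Type*} [Fintype P] [IsEmpty P] (h : ∀ e, (x₁ e).1.1 ≠ Sum.inl 1)
    (X₁ X₂ X₃ V : Tensor M L) (γ : M → M → L) (y : P → (Fin 3 ⊕ (I₁ ⊕ I₂)) × M)
    (y' : P → (Fin 2 ⊕ I₁) × M) :
    graphWeight (graphTensor (I₁ ⊕ I₂) ![X₁, X₂, X₃] V) γ (glue x₁ s x₂) y =
      graphWeight (graphTensor I₁ ![X₁, fun _ _ => 1] V) γ x₁ y' *
        graphWeight (graphTensor I₂ ![X₂, X₃] V) γ x₂ fun p => (s p, (x₁ p).2.2) := by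
  have hu0 := multiIndex_glue_head_upper (s := s) (x₂ := x₂) (u := (Sum.inl 0 : Fin 2 ⊕ I₁))
    (by simp)
  have hu1 := fun i => multiIndex_glue_head_upper (s := s) (x₂ := x₂)
    (u := (Sum.inr i : Fin 2 ⊕ I₁)) (by simp)
  have ht0 := multiIndex_glue_tail_upper (s := s) (x₂ := x₂) (u := (Sum.inl 0 : Fin 2 ⊕ I₁))
    (by simp)
  have ht1 := fun i => multiIndex_glue_tail_upper (s := s) (x₂ := x₂)
    (u := (Sum.inr i : Fin 2 ⊕ I₁)) (by simp)
  have hl := fun w => multiIndex_glue_head_lower (s := s) (x₂ := x₂) w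
  have hl' := fun w => multiIndex_glue_tail_lower (s := s) (x₂ := x₂) h w
  have hl0 := hl (Sum.inl 0)
  have hl1 := hl (Sum.inl 1)
  have hl2 := fun i => hl (Sum.inr i)
  have hl0' := hl' (Sum.inl 0)
  have hl1' := hl' (Sum.inl 1)
  have hl2' := fun i => hl' (Sum.inr i)
  simp only [upper, lower, Sum.map_inl, Sum.map_inr, Matrix.cons_val_zero, Matrix.cons_val_one]
    at hu0 hu1 ht0 ht1 hl0 hl1 hl2 hl0' hl1' hl2'
  simp only [graphWeight, multiIndex_of_isEmpty, add_zero, Fintype.prod_sum_type,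
    Fin.prod_univ_three, Fin.prod_univ_two, graphTensor, Sum.elim_inl, Sum.elim_inr,
    Matrix.cons_val_zero, Matrix.cons_val_one, Matrix.cons_val, hu0, hu1, ht0, ht1, hl0, hl1, hl2,
    hl0', hl1', hl2']
  simp only [glue, Sum.elim_inl, Sum.elim_inr]
  ring

variable [DecidableEq E₁] [DecidableEq E₂] [Fintype M]

-- For fixed `x₁`, the sum over the attachments `s` is the sum over the positions of the legs of the
-- lower graph. Configurations that are not of glued form contribute zero.
open Classical in
theorem graphSum_isGlued (X₁ X₂ X₃ V : Tensor M L) (γ : M → M → L) (l : Empty → M) :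
    graphSum (E := E₁ ⊕ E₂) (graphKind 3 (I₁ ⊕ I₂)) (graphTensor (I₁ ⊕ I₂) ![X₁, X₂, X₃] V) γ
      (fun x => x.IsGlued) l =
    ∑ x₁ : Config E₁ (Fin 2 ⊕ I₁) M, if x₁.Valid (graphKind 2 I₁) then
      graphWeight (graphTensor I₁ ![X₁, fun _ _ => 1] V) γ x₁ (Empty.elim) *
        graphSum (E := E₂) (graphKind 2 I₂) (graphTensor I₂ ![X₂, X₃] V) γ (fun _ => True)
          (fun p : {e // (x₁ e).2.1 = Sum.inl 1} => (x₁ p).2.2) else 0 := by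
  have hR : (∑ x₁ : Config E₁ (Fin 2 ⊕ I₁) M, if x₁.Valid (graphKind 2 I₁) then
      graphWeight (graphTensor I₁ ![X₁, fun _ _ => 1] V) γ x₁ (Empty.elim) *
        graphSum (E := E₂) (graphKind 2 I₂) (graphTensor I₂ ![X₂, X₃] V) γ (fun _ => True)
          (fun p : {e // (x₁ e).2.1 = Sum.inl 1} => (x₁ p).2.2) else 0) =
      ∑ z : (Σ x₁ : Config E₁ (Fin 2 ⊕ I₁) M, ({e // (x₁ e).2.1 = Sum.inl 1} → Fin 2 ⊕ I₂)) ×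
        Config E₂ (Fin 2 ⊕ I₂) M,
        if z.1.1.Valid (graphKind 2 I₁) ∧ z.2.Valid (graphKind 2 I₂) then
          graphWeight (graphTensor I₁ ![X₁, fun _ _ => 1] V) γ z.1.1 (Empty.elim) *
            graphWeight (graphTensor I₂ ![X₂, X₃] V) γ z.2 (fun p => (z.1.2 p, (z.1.1 p).2.2))
        else 0 := by
    rw [Fintype.sum_prod_type, Fintype.sum_sigma]
    refine Finset.sum_congr rfl fun x₁ _ => ?_
    by_cases h : x₁.Valid (graphKind 2 I₁)
    · simp only [h, true_and, if_true, graphSum, and_true]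
      rw [Finset.sum_comm, Finset.mul_sum]
      refine Finset.sum_congr rfl fun s _ => ?_
      rw [Finset.mul_sum]
      refine Finset.sum_congr rfl fun x₂ _ => ?_
      rw [mul_ite, mul_zero]
    · simp [h]
  rw [hR, graphSum]
  simp only [Fintype.sum_unique]
  refine (Fintype.sum_of_injective _ glue_injective _ _ ?_ ?_).symm
  · intro x hx
    refine if_neg fun h => hx ?_
    obtain ⟨x₁, s, x₂, h'⟩ := h.2.exists_glue
    exact ⟨⟨⟨x₁, s⟩, x₂⟩, h'⟩
  · rintro ⟨⟨x₁, s⟩, x₂⟩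
    by_cases h : x₁.Valid (graphKind 2 I₁) ∧ x₂.Valid (graphKind 2 I₂)
    · rw [if_pos h, if_pos (glue_valid_iff.2 h)]
      exact (graphWeight_glue (h.1.sink (Sum.inl 1) rfl) _ _ _ _ _ _ _).symm
    · rw [if_neg h, if_neg (mt glue_valid_iff.1 h)]

end Glue

/-! ### The partition sum with three external vertices -/

section Associativity

variable {M L : Type*} [Fintype M] [DecidableEq M] [CommRing L]

/-- It decouples the sizes of the two parts of a cut, which are a priori constrained by their total.
-/
theorem sum_range_flip {N : ℕ} (f : ℕ → ℕ → L) (h : ∀ a b, N ≤ a + b → f a b = 0) :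
    ∑ a ∈ Finset.range N, ∑ b ∈ Finset.range (a + 1), f (a - b) b =
      ∑ a ∈ Finset.range N, ∑ b ∈ Finset.range N, f a b := by
  rw [Finset.sum_range_diag_flip N fun b a => f a b, Finset.sum_comm]
  rw [Finset.sum_comm]
  conv_rhs => rw [Finset.sum_comm]
  refine Finset.sum_congr rfl fun b hb => ?_
  refine Finset.sum_subset (Finset.range_mono (Nat.sub_le _ _)) fun a _ ha => h _ _ ?_
  rw [Finset.mem_range] at ha hb
  omega

variable [Algebra ℂ L]

/-- The binomial coefficient that counts the subsets of size `j` turns `1 / a!` into the product of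
the factors of the two parts. -/
theorem sum_finset_smul (a : ℕ) (f : ℕ → L) :
    ((a.factorial : ℂ)⁻¹) • ∑ S : Finset (Fin a), f S.card =
      ∑ j ∈ Finset.range (a + 1), (((a - j).factorial * j.factorial : ℂ)⁻¹) • f j := by
  have := Finset.sum_powerset_apply_card f (x := (Finset.univ : Finset (Fin a)))
  rw [Finset.powerset_univ, Finset.card_univ, Fintype.card_fin] at this
  rw [this, Finset.smul_sum]
  refine Finset.sum_congr rfl fun j hj => ?_
  have hj' : j ≤ a := Nat.lt_succ_iff.1 (Finset.mem_range.1 hj)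
  rw [← Nat.cast_smul_eq_nsmul ℂ, smul_smul]
  congr 1
  have h1 := Nat.choose_mul_factorial_mul_factorial hj'
  have h2 : (a.factorial : ℂ) ≠ 0 := Nat.cast_ne_zero.2 (Nat.factorial_ne_zero _)
  have h3 : (j.factorial : ℂ) ≠ 0 := Nat.cast_ne_zero.2 (Nat.factorial_ne_zero _)
  have h4 : ((a - j).factorial : ℂ) ≠ 0 := Nat.cast_ne_zero.2 (Nat.factorial_ne_zero _)
  have h5 : (a.choose j : ℂ) ≠ 0 := Nat.cast_ne_zero.2 (Nat.choose_pos hj').ne'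
  rw [← h1] at h2 ⊢
  push_cast at h2 ⊢
  field_simp

-- Every graph is cut and the lower parts are summed first: for a fixed upper graph they form a full
-- partition sum whose legs are the edges into the contracted vertex.
open Classical in
theorem partitionSum_three {τ : L} {N : ℕ} (hτ : τ ^ N = 0) (X₁ X₂ X₃ V : Tensor M L)
    {γ : M → M → L} (hγ : ∀ s r, τ ∣ γ s r) (l : Empty → M) :
    partitionSum N ![X₁, X₂, X₃] V γ l =
      ∑ a ∈ Finset.range N, ∑ b ∈ Finset.range N, ((a.factorial * b.factorial : ℂ)⁻¹) •
        ∑ x₁ : Config (Fin b) (Fin 2 ⊕ Fin a) M, if x₁.Valid (graphKind 2 (Fin a)) then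
          graphWeight (graphTensor (Fin a) ![X₁, fun _ _ => 1] V) γ x₁ (Empty.elim) *
            partitionSum N ![X₂, X₃] V γ
              (fun p : {e // (x₁ e).2.1 = Sum.inl 1} => (x₁ p).2.2) else 0 := by
  -- The arguments are the numbers of upper vertices, lower vertices, upper edges and lower edges.
  set G : ℕ → ℕ → ℕ → ℕ → L := fun a b c d =>
    graphSum (E := Fin c ⊕ Fin d) (graphKind 3 (Fin a ⊕ Fin b))
      (graphTensor (Fin a ⊕ Fin b) ![X₁, X₂, X₃] V) γ (fun x => x.IsGlued) l with hG
  have hG0 : ∀ a b c d, N ≤ c + d → G a b c d = 0 := fun a b c d h =>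
    graphSum_eq_zero_of_card hτ (by simpa using h) _ _ hγ _ l
  have hG1 : ∀ a b c d, c + d < a + b → G a b c d = 0 := fun a b c d h =>
    graphSum_eq_zero_of_lt (by simpa using h) _ _ _ l
  have h1 : ∀ a b : ℕ, ((a.factorial * b.factorial : ℂ)⁻¹) •
      graphSum (E := Fin b) (graphKind 3 (Fin a)) (graphTensor (Fin a) ![X₁, X₂, X₃] V) γ
        (fun _ => True) l =
      ∑ i ∈ Finset.range (a + 1), ∑ j ∈ Finset.range (b + 1),
        (((a - i).factorial * i.factorial : ℂ)⁻¹) • (((b - j).factorial * j.factorial : ℂ)⁻¹) •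
          G (a - i) i (b - j) j := by
    intro a b
    rw [graphSum_eq_sum_isSplit, mul_inv, mul_smul]
    have h2 : ∀ (S : Finset (Fin a)) (T : Finset (Fin b)),
        graphSum (E := Fin b) (graphKind 3 (Fin a)) (graphTensor (Fin a) ![X₁, X₂, X₃] V) γ
          (fun x => x.IsSplit (· ∈ S) (· ∈ T)) l = G (a - S.card) S.card (b - T.card) T.card := by
      intro S T
      have hS := Finset.card_le_univ S
      have hT := Finset.card_le_univ T
      rw [Fintype.card_fin] at hS hT
      exact graphSum_isSplit_eq _ _ _ _ S T rfl (by rw [Fintype.card_fin]; omega) rfl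
        (by rw [Fintype.card_fin]; omega)
    simp only [h2]
    rw [Finset.smul_sum]
    rw [Finset.sum_congr rfl fun (S : Finset (Fin a)) _ =>
      sum_finset_smul b fun j => G (a - S.card) S.card (b - j) j]
    rw [sum_finset_smul a fun i => ∑ j ∈ Finset.range (b + 1),
      (((b - j).factorial * j.factorial : ℂ)⁻¹) • G (a - i) i (b - j) j]
    simp only [Finset.smul_sum]
  unfold partitionSum
  simp only [h1]
  have h3 : ∀ a, ∑ b ∈ Finset.range N, ∑ i ∈ Finset.range (a + 1), ∑ j ∈ Finset.range (b + 1),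
        (((a - i).factorial * i.factorial : ℂ)⁻¹) • (((b - j).factorial * j.factorial : ℂ)⁻¹) •
          G (a - i) i (b - j) j =
      ∑ i ∈ Finset.range (a + 1), (((a - i).factorial * i.factorial : ℂ)⁻¹) •
        ∑ c ∈ Finset.range N, ∑ d ∈ Finset.range N, ((c.factorial * d.factorial : ℂ)⁻¹) •
          G (a - i) i c d := by
    intro a
    rw [Finset.sum_comm]
    refine Finset.sum_congr rfl fun i _ => ?_
    simp only [Finset.smul_sum]
    exact sum_range_flip (fun c d => (((a - i).factorial * i.factorial : ℂ)⁻¹) •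
      ((c.factorial * d.factorial : ℂ)⁻¹) • G (a - i) i c d)
      fun c d h => by rw [hG0 _ _ _ _ h, smul_zero, smul_zero]
  simp only [h3]
  rw [sum_range_flip fun a i => ((a.factorial * i.factorial : ℂ)⁻¹) •
        ∑ c ∈ Finset.range N, ∑ d ∈ Finset.range N, ((c.factorial * d.factorial : ℂ)⁻¹) •
          G a i c d]
  · refine Finset.sum_congr rfl fun a _ => ?_
    simp only [Finset.smul_sum]
    rw [Finset.sum_comm]
    refine Finset.sum_congr rfl fun c _ => ?_
    simp only [hG, Config.IsGlued]
    simp only [graphSum_isGlued, Finset.smul_sum]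
    have h4 : ∀ (p : Prop) [Decidable p] (w : L) (S : ℕ → ℕ → L),
        (if p then w * ∑ i ∈ Finset.range N, ∑ d ∈ Finset.range N,
          ((i.factorial * d.factorial : ℂ)⁻¹) • S i d else 0) =
        ∑ i ∈ Finset.range N, ∑ d ∈ Finset.range N,
          ((i.factorial * d.factorial : ℂ)⁻¹) • if p then w * S i d else 0 := by
      intro p _ w S
      split_ifs
      · simp only [Finset.mul_sum, mul_smul_comm]
      · simp
    simp only [h4, Finset.smul_sum]
    rw [Finset.sum_comm (s := Finset.univ)]
    refine Finset.sum_congr rfl fun i _ => ?_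
    rw [Finset.sum_comm (s := Finset.univ)]
    refine Finset.sum_congr rfl fun d _ => Finset.sum_congr rfl fun x₁ _ => ?_
    rw [smul_smul, smul_smul]
    congr 1
    rw [mul_inv, mul_inv, mul_inv, mul_inv]
    ring
  -- With `N` or more internal vertices there are either at least `N` edges, and `τ ^ N = 0`
  -- applies, or fewer edges than internal vertices.
  · intro a i h
    rw [Finset.sum_eq_zero, smul_zero]
    refine fun c _ => Finset.sum_eq_zero fun d _ => ?_
    by_cases h' : N ≤ c + d
    · rw [hG0 _ _ _ _ h', smul_zero]
    · rw [hG1 _ _ _ _ (by omega), smul_zero]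

end Associativity

/-! ### Derivation rules and one half of the associativity. -/

section Associativity

variable {M L : Type*} [Fintype M] [DecidableEq M] [CommRing L] [Algebra ℂ L]

/-- The rules for the differentiation of the tensor `V` at the internal vertices and of the propagator
`γ`: a derivative adds an index to `V`, except that `V` has no component `K` of bidegree `(1, 1)`; this
component is produced by the derivatives of the propagator, which is divisible by the nilpotent
element `τ`. -/
structure IsPropagator (d : M → Derivation ℂ L L) (V : Tensor M L) (γ : M → M → L)
    (K : M → Tensor M L) (τ : L) (N : ℕ) : Prop where
  pow_eq_zero : τ ^ N = 0
  dvd : ∀ s r, τ ∣ γ s r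
  bidegree : ∀ i α β, K i α β ≠ 0 → ∑ j, α j = 1 ∧ ∑ j, β j = 1
  derivation_propagator : ∀ i s r,
    d i (γ s r) = ∑ p, ∑ q, γ s p * K i (Pi.single p 1) (Pi.single q 1) * γ q r
  derivation_vertex : ∀ i α β, α ≠ 0 → β ≠ 0 → d i (V α β) = V (α + Pi.single i 1) β - K i α β

/-- A derivative adds a holomorphic index to the tensor `X`. -/
def Tensor.IsDifferential (d : M → Derivation ℂ L L) (X : Tensor M L) : Prop :=
  ∀ i α β, d i (X α β) = X (α + Pi.single i 1) β

variable {d : M → Derivation ℂ L L} {V : Tensor M L} {γ : M → M → L} {K : M → Tensor M L} {τ : L}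
  {N : ℕ}

/-- Induction on the number of legs: a derivation adds a leg on the left and an index to `B` on the
right. -/
theorem IsPropagator.partitionSum_eq {n : ℕ} (h : IsPropagator d V γ K τ N)
    {X : Fin n → Tensor M L} (hX : ∀ k, (X k).IsDifferential d) {B : Tensor M L}
    (hB : B.IsDifferential d) (l₀ : Empty → M) (hB₀ : B 0 0 = partitionSum N X V γ l₀)
    {P : Type*} [Fintype P] [DecidableEq P] (l : P → M) :
    partitionSum N X V γ l = B (∑ p, Pi.single (l p) 1) 0 := by
  have key : ∀ (k : ℕ) (l : Fin k → M),
      partitionSum N X V γ l = B (∑ p, Pi.single (l p) 1) 0 := by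
    intro k
    induction k with
    | zero =>
      intro l
      rw [Finset.univ_eq_empty, Finset.sum_empty, hB₀,
        partitionSum_equiv (Equiv.equivOfIsEmpty (Fin 0) Empty) N X V γ l₀]
      congr
      funext i
      exact i.elim0
    | succ k ih =>
      intro l
      rw [Fin.sum_univ_succ, add_comm (Pi.single _ _), ← hB, ← ih fun p => l p.succ,
        derivation_partitionSum (d (l 0)) (l 0) h.pow_eq_zero (h.bidegree _) h.dvd
          (h.derivation_propagator _) (h.derivation_vertex _) (fun k => hX k _),
        partitionSum_equiv (finSuccEquiv k) N X V γ]
      congr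
      funext p
      refine Fin.cases ?_ (fun p => ?_) p <;> simp
  rw [partitionSum_equiv (Fintype.equivFin P).symm, key]
  congr 1
  exact Equiv.sum_comp (Fintype.equivFin P).symm fun p => (Pi.single (l p) 1 : M → ℕ)

/-- One half of the associativity. -/
theorem IsPropagator.partitionSum_three (h : IsPropagator d V γ K τ N) (X₁ : Tensor M L)
    {X₂ X₃ B : Tensor M L} (hX₂ : X₂.IsDifferential d) (hX₃ : X₃.IsDifferential d)
    (hB : B.IsDifferential d) (l : Empty → M) (hB₀ : B 0 0 = partitionSum N ![X₂, X₃] V γ l) :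
    partitionSum N ![X₁, X₂, X₃] V γ l = partitionSum N ![X₁, B] V γ l := by
  classical
  rw [KahlerStar.partitionSum_three h.pow_eq_zero X₁ X₂ X₃ V h.dvd l]
  refine Finset.sum_congr rfl fun a _ => Finset.sum_congr rfl fun b _ => ?_
  congr 1
  unfold graphSum
  refine Finset.sum_congr rfl fun x₁ _ => ?_
  simp only [Fintype.sum_unique, and_true]
  by_cases hx : x₁.Valid (graphKind 2 (Fin a))
  swap
  · rw [if_neg hx, if_neg hx]
  rw [if_pos hx, if_pos hx]
  have hX : ∀ k, (![X₂, X₃] k).IsDifferential d := fun k => by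
    fin_cases k
    · exact hX₂
    · exact hX₃
  -- The contracted vertex is a sink, so `B` enters with holomorphic indices only, and these are
  -- what the legs produce.
  have h1 : multiIndex (fun e => (x₁ e).1) (Sum.inl 1) = 0 :=
    multiIndex_eq_zero (hx.sink (Sum.inl 1) rfl)
  have h2 : multiIndex (fun e => (x₁ e).2) (Sum.inl 1) =
      ∑ p : {e // (x₁ e).2.1 = Sum.inl 1}, Pi.single (x₁ p).2.2 1 := by
    rw [multiIndex_eq, ← Finset.sum_filter]
    exact Finset.sum_subtype _ (by simp) _
  rw [h.partitionSum_eq hX hB l hB₀, ← h2]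
  simp only [graphWeight, multiIndex_of_isEmpty, add_zero, Fintype.prod_sum_type,
    Fin.prod_univ_two, graphTensor, Sum.elim_inl, Sum.elim_inr,
    Matrix.cons_val_zero, Matrix.cons_val_one, h1]
  ring

end Associativity

/-! ## Sums over isomorphism classes as sums over numbered graphs -/

namespace Graph

variable {n : ℕ} {I E I' E' : Type}

@[ext]
theorem ext {G G' : Graph n I E} (ht : G.tail = G'.tail) (hh : G.head = G'.head)
    (hw : G.weight = G'.weight) : G = G' := by
  cases G
  cases G'
  simp only at ht hh hw
  subst ht hh hw
  rfl

/-- Transport of a graph along bijections of the internal vertices and of the edges. -/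
def transport (G : Graph n I E) (σ : I ≃ I') (ε : E ≃ E') : Graph n I' E' where
  tail e := Sum.map id σ (G.tail (ε.symm e))
  head e := Sum.map id σ (G.head (ε.symm e))
  weight i := G.weight (σ.symm i)
  neg_one_le_weight i := G.neg_one_le_weight _
  acyclic v h := by
    refine G.acyclic (Sum.map id σ.symm v) (h.lift (Sum.map id σ.symm) ?_)
    rintro _ _ ⟨e, rfl, rfl⟩
    exact ⟨ε.symm e, by simp [Sum.map_map], by simp [Sum.map_map]⟩
  exists_incoming i := by
    obtain ⟨e, he⟩ := G.exists_incoming (σ.symm i)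
    exact ⟨ε e, by simp [he]⟩
  exists_outgoing i := by
    obtain ⟨e, he⟩ := G.exists_outgoing (σ.symm i)
    exact ⟨ε e, by simp [he]⟩
  first_source k hk e h := G.first_source k hk (ε.symm e) (by
    have := congrArg (Sum.map id σ.symm) h
    simpa [Sum.map_map] using this)
  last_sink k hk e h := G.last_sink k hk (ε.symm e) (by
    have := congrArg (Sum.map id σ.symm) h
    simpa [Sum.map_map] using this)
  three_le_degree i hi := by
    have key : ∀ f : E → Fin n ⊕ I,
        Nat.card {e // Sum.map id σ (f (ε.symm e)) = Sum.inr i} =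
          Nat.card {e // f e = Sum.inr (σ.symm i)} := fun f => by
      refine Nat.card_congr (ε.symm.subtypeEquiv fun e => ?_)
      rcases f (ε.symm e) with k | j
      · simp
      · simp [Equiv.eq_symm_apply]
    rw [key, key]
    exact G.three_le_degree _ hi

/-- The isomorphism onto the transported graph. -/
def transportIso (G : Graph n I E) (σ : I ≃ I') (ε : E ≃ E') : Iso G (G.transport σ ε) where
  vert := σ
  edge := ε
  map_tail e := by simp [transport]
  map_head e := by simp [transport]
  map_weight i := by simp [transport]

theorem eq_transport {G : Graph n I E} {G' : Graph n I' E'} (φ : Iso G G') :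
    G' = G.transport φ.vert φ.edge := by
  ext1
  · funext e
    have := φ.map_tail (φ.edge.symm e)
    rwa [Equiv.apply_symm_apply] at this
  · funext e
    have := φ.map_head (φ.edge.symm e)
    rwa [Equiv.apply_symm_apply] at this
  · funext i
    have := φ.map_weight (φ.vert.symm i)
    rwa [Equiv.apply_symm_apply] at this

/-- All isomorphisms with source `G` correspond to the pairs of bijections. -/
noncomputable def sigmaIsoEquiv (G : Graph n I E) :
    (Σ G' : Graph n I' E', Iso G G') ≃ (I ≃ I') × (E ≃ E') :=
  Equiv.ofBijective (fun z => (z.2.vert, z.2.edge)) ⟨by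
    rintro ⟨G', φ⟩ ⟨G'', ψ⟩ h
    simp only [Prod.mk.injEq] at h
    obtain rfl : G' = G'' := by rw [eq_transport φ, eq_transport ψ, h.1, h.2]
    rw [Iso.ext h.1 h.2], fun p => ⟨⟨G.transport p.1 p.2, G.transportIso p.1 p.2⟩, rfl⟩⟩

end Graph

/-- The composition of isomorphisms. -/
def Iso.trans {n : ℕ} {I E I' E' I'' E'' : Type} {G : Graph n I E} {G' : Graph n I' E'}
    {G'' : Graph n I'' E''} (φ : Iso G G') (ψ : Iso G' G'') : Iso G G'' where
  vert := φ.vert.trans ψ.vert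
  edge := φ.edge.trans ψ.edge
  map_tail e := by simp [ψ.map_tail, φ.map_tail, Sum.map_map]
  map_head e := by simp [ψ.map_head, φ.map_head, Sum.map_map]
  map_weight i := by simp [ψ.map_weight, φ.map_weight]

/-- The inverse of an isomorphism. -/
def Iso.symm {n : ℕ} {I E I' E' : Type} {G : Graph n I E} {G' : Graph n I' E'}
    (φ : Iso G G') : Iso G' G where
  vert := φ.vert.symm
  edge := φ.edge.symm
  map_tail e := by
    have h := φ.map_tail (φ.edge.symm e)
    rw [Equiv.apply_symm_apply] at h
    rw [h, Sum.map_map]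
    simp
  map_head e := by
    have h := φ.map_head (φ.edge.symm e)
    rw [Equiv.apply_symm_apply] at h
    rw [h, Sum.map_map]
    simp
  map_weight i := by
    have h := φ.map_weight (φ.vert.symm i)
    rw [Equiv.apply_symm_apply] at h
    exact h.symm

/-- Composition with a fixed isomorphism. -/
def Iso.transEquiv {n : ℕ} {I E I' E' : Type} {G : Graph n I E} {G' : Graph n I' E'}
    (φ : Iso G G') : Iso G G ≃ Iso G G' where
  toFun ψ := ψ.trans φ
  invFun ψ := ψ.trans φ.symm
  left_inv ψ := by
    ext <;> simp [Iso.trans, Iso.symm]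
  right_inv ψ := by
    ext <;> simp [Iso.trans, Iso.symm]

theorem Iso.totalWeight_eq {n : ℕ} {I E I' E' : Type} [Fintype I] [Fintype E] [Fintype I']
    [Fintype E'] {G : Graph n I E} {G' : Graph n I' E'} (φ : Iso G G') :
    G.totalWeight = G'.totalWeight := by
  unfold Graph.totalWeight
  rw [Fintype.card_congr φ.edge, ← Equiv.sum_comp φ.vert]
  simp only [φ.map_weight]

/-- The number of numberings of an unnumbered graph. -/
theorem card_iso_mul_card_aut {n a b : ℕ} (G : Graph n (Fin a) (Fin b)) :
    Nat.card {G' : Graph n (Fin a) (Fin b) // Nonempty (Iso G G')} * Nat.card (Iso G G) =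
      a.factorial * b.factorial := by
  have h1 : Nat.card (Σ G' : Graph n (Fin a) (Fin b), Iso G G') = a.factorial * b.factorial := by
    rw [Nat.card_congr (Graph.sigmaIsoEquiv G), Nat.card_prod]
    simp [Nat.card_eq_fintype_card, Fintype.card_perm]
  -- A fixed isomorphism `G → G'` identifies all isomorphisms `G → G'` with the automorphisms of
  -- `G`.
  rw [← h1, ← Nat.card_prod]
  refine Nat.card_congr ?_
  refine (Equiv.sigmaEquivProd _ _).symm.trans ?_
  refine (Equiv.sigmaCongrRight fun G' : {G' : Graph n (Fin a) (Fin b) // Nonempty (Iso G G')} =>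
    Iso.transEquiv G'.2.some).trans ?_
  exact Equiv.sigmaSubtypeEquivOfSubset (fun G' => Iso G G') (fun G' => Nonempty (Iso G G'))
    fun G' φ => ⟨φ⟩

noncomputable instance fintypeFinGraph (n k : ℕ) :
    Fintype {G : FinGraph n // G.graph.totalWeight = (k : ℤ)} :=
  Fintype.ofFinite _

/-- The isomorphism class of a graph of total weight `k`. -/
def toIsoClass {n k : ℕ} (G : {G : FinGraph n // G.graph.totalWeight = (k : ℤ)}) :
    IsoClassOfWeight n k :=
  ⟨Quotient.mk _ G.1, by
    obtain ⟨φ⟩ := Quotient.exact (Quotient.out_eq (Quotient.mk (isoSetoid n) G.1))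
    exact φ.totalWeight_eq.trans G.2⟩

theorem toIsoClass_eq_iff {n k : ℕ} (G : {G : FinGraph n // G.graph.totalWeight = (k : ℤ)})
    (c : IsoClassOfWeight n k) :
    toIsoClass G = c ↔ Nonempty (Iso c.1.rep.graph G.1.graph) := by
  constructor
  · intro h
    have : Quotient.mk (isoSetoid n) G.1 = Quotient.mk (isoSetoid n) c.1.rep :=
      (congrArg Subtype.val h).trans (Quotient.out_eq c.1).symm
    exact Quotient.exact this.symm
  · intro h
    exact Subtype.ext ((Quotient.sound (s := isoSetoid n) h).symm.trans (Quotient.out_eq c.1))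

/-- Isomorphic graphs have equally many vertices and edges, so the fibre stays within the graphs on
the index sets of the representative. -/
theorem card_fiber_toIsoClass {n k : ℕ} (c : IsoClassOfWeight n k) :
    Nat.card {G // toIsoClass G = c} =
      Nat.card {G' : Graph n (Fin c.1.rep.1) (Fin c.1.rep.2.1) //
        Nonempty (Iso c.1.rep.graph G')} := by
  refine (Nat.card_congr (Equiv.ofBijective (fun G' : {G' : Graph n (Fin c.1.rep.1)
    (Fin c.1.rep.2.1) // Nonempty (Iso c.1.rep.graph G')} =>
    (⟨⟨⟨c.1.rep.1, c.1.rep.2.1, G'.1⟩, G'.2.some.totalWeight_eq.symm.trans c.2⟩,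
      (toIsoClass_eq_iff _ c).2 G'.2⟩ : {G // toIsoClass G = c})) ⟨?_, ?_⟩)).symm
  · rintro ⟨G, hG⟩ ⟨G', hG'⟩ h
    have h1 := congrArg (fun z => z.1.1) h
    exact Subtype.ext (eq_of_heq (Sigma.mk.inj (eq_of_heq (Sigma.mk.inj h1).2)).2)
  · rintro ⟨⟨⟨a, b, G⟩, hG⟩, h⟩
    obtain ⟨φ⟩ := (toIsoClass_eq_iff _ c).1 h
    obtain rfl : c.1.rep.1 = a := by simpa using Fintype.card_congr φ.vert
    obtain rfl : c.1.rep.2.1 = b := by simpa using Fintype.card_congr φ.edge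
    exact ⟨⟨G, ⟨φ⟩⟩, rfl⟩

/-- The sum over isomorphism classes, divided by the orders of the automorphism groups, is the sum over
numbered graphs, divided by the numbers of numberings. -/
theorem sum_isoClass {n k : ℕ} (ψ : FinGraph n → ℂ)
    (hψ : ∀ G G' : FinGraph n, Nonempty (Iso G.graph G'.graph) → ψ G = ψ G') :
    ∑ c : IsoClassOfWeight n k,
        (1 / (Nat.card (Iso c.1.rep.graph c.1.rep.graph) : ℂ)) * ψ c.1.rep =
      ∑ G : {G : FinGraph n // G.graph.totalWeight = (k : ℤ)},
        ((G.1.1.factorial * G.1.2.1.factorial : ℂ)⁻¹) * ψ G.1 := by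
  classical
  rw [← Finset.sum_fiberwise (s := Finset.univ) (g := toIsoClass)]
  refine Finset.sum_congr rfl fun c _ => ?_
  have h1 : ∀ G ∈ Finset.univ.filter (fun G => toIsoClass G = c),
      ((G.1.1.factorial * G.1.2.1.factorial : ℂ)⁻¹) * ψ G.1 =
        ((c.1.rep.1.factorial * c.1.rep.2.1.factorial : ℂ)⁻¹) * ψ c.1.rep := by
    intro G hG
    have hG' := (toIsoClass_eq_iff G c).1 (Finset.mem_filter.1 hG).2
    obtain ⟨φ⟩ := hG'
    have h1 : c.1.rep.1 = G.1.1 := by simpa using Fintype.card_congr φ.vert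
    have h2 : c.1.rep.2.1 = G.1.2.1 := by simpa using Fintype.card_congr φ.edge
    simp only [h1, h2, hψ _ _ ⟨φ⟩]
  rw [Finset.sum_congr rfl h1, Finset.sum_const, nsmul_eq_mul, ← mul_assoc]
  congr 1
  -- Orbit and stabilizer: the fibre is the orbit of the representative under renumbering.
  have h2 := card_iso_mul_card_aut c.1.rep.graph
  rw [← card_fiber_toIsoClass, Nat.card_eq_fintype_card (α := {G // toIsoClass G = c}),
    Fintype.card_subtype] at h2
  have h3 : (Nat.card (Iso c.1.rep.graph c.1.rep.graph) : ℂ) ≠ 0 := by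
    rw [Nat.cast_ne_zero]
    intro h
    rw [h, mul_zero] at h2
    exact (Nat.mul_pos (Nat.factorial_pos _) (Nat.factorial_pos _)).ne h2
  rw [← Nat.cast_mul, ← h2]
  have h4 : ((Finset.univ.filter fun G => toIsoClass G = c).card : ℂ) ≠ 0 := by
    rw [Nat.cast_ne_zero]
    intro h
    rw [h, zero_mul] at h2
    exact (Nat.mul_pos (Nat.factorial_pos _) (Nat.factorial_pos _)).ne h2
  push_cast
  field_simp

/-! ### Numbered graphs of a given total weight as configurations. -/

section

variable {n : ℕ} {M A : Type*}

theorem multiIndex_apply [DecidableEq M] {H V : Type*} [Fintype H] (y : H → V × M) (v : V) (j : M) :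
    multiIndex y v j = Nat.card {a // (y a).1 = v ∧ (y a).2 = j} := by
  classical
  rw [multiIndex, Finset.sum_apply, Nat.card_eq_fintype_card, Fintype.card_subtype,
    Finset.card_filter]
  refine Finset.sum_congr rfl fun a _ => ?_
  by_cases h : (y a).1 = v
  · simp [h, Pi.single_apply, eq_comm]
  · simp [h]

/-- The configuration given by a graph and a labelling. -/
def Graph.config {I E : Type} (G : Graph n I E) (l : E → M × M) : Config E (Fin n ⊕ I) M :=
  fun e => ((G.tail e, (l e).1), (G.head e, (l e).2))

theorem Graph.valid_config {I E : Type} [Fintype I] (G : Graph n I E) (l : E → M × M) :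
    (G.config l).Valid (graphKind n I) where
  acyclic := by
    classical
    let R : Fin n ⊕ I → Fin n ⊕ I → Prop := fun u w => ∃ e, G.tail e = u ∧ G.head e = w
    -- The height of a vertex is the number of its ancestors. It grows strictly along an edge, since
    -- the tail is an ancestor of the head but not of itself.
    refine ⟨fun v => (Finset.univ.filter fun u => Relation.TransGen R u v).card, fun e => ?_⟩
    refine Finset.card_lt_card ((Finset.ssubset_iff_of_subset fun u hu => ?_).2
      ⟨G.tail e, ?_, ?_⟩)
    · rw [Finset.mem_filter] at hu ⊢
      exact ⟨hu.1, hu.2.tail ⟨e, rfl, rfl⟩⟩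
    · rw [Finset.mem_filter]
      exact ⟨Finset.mem_univ _, .single ⟨e, rfl, rfl⟩⟩
    · rw [Finset.mem_filter]
      exact fun h => G.acyclic _ h.2
  exists_in v hv := by
    rcases v with k | i
    · exact hv.elim
    · exact G.exists_incoming i
  exists_out v hv := by
    rcases v with k | i
    · exact hv.elim
    · exact G.exists_outgoing i
  source v hv e := by
    rcases v with k | i
    · exact G.first_source k hv e
    · exact hv.elim
  sink v hv e := by
    rcases v with k | i
    · exact G.last_sink k hv e
    · exact hv.elim

variable [DecidableEq M] [Fintype M]

/-- The number of edges at the vertex `v`. -/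
noncomputable def Config.degree {E V : Type*} [Fintype E] (x : Config E V M) (v : V) : ℕ :=
  ∑ j, multiIndex (fun e => (x e).2) v j + ∑ j, multiIndex (fun e => (x e).1) v j

/-- The constraints on the weights: `u i - 1` is the weight of the internal vertex `i`, and `k` is the
total weight. -/
def Config.HasWeight {E I : Type*} [Fintype E] [Fintype I] (x : Config E (Fin n ⊕ I) M)
    (u : I → ℕ) (k : ℕ) : Prop :=
  x.Valid (graphKind n I) ∧ (∀ i, u i = 0 → 3 ≤ x.degree (Sum.inr i)) ∧
    (Fintype.card E : ℤ) + ∑ i, ((u i : ℤ) - 1) = k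

/-- The tensors `X` at the external vertices, and `ψ w` at an internal vertex of weight `w`. -/
def weightTensor {I : Type*} (X : Fin n → Tensor M A) (ψ : ℤ → Tensor M A) (u : I → ℕ) :
    Fin n ⊕ I → Tensor M A :=
  Sum.elim X fun i => ψ ((u i : ℤ) - 1)

open Classical in
/-- The sum over all numbered graphs of total weight `k` with less than `N` vertices and edges and with
weights less than `N - 1`. -/
noncomputable def weightedSum [CommRing A] [Algebra ℂ A] (N k : ℕ) (X : Fin n → Tensor M A)
    (ψ : ℤ → Tensor M A) (γ : M → M → A) : A :=
  ∑ a ∈ Finset.range N, ∑ b ∈ Finset.range N, ((a.factorial * b.factorial : ℂ)⁻¹) •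
    ∑ x : Config (Fin b) (Fin n ⊕ Fin a) M, ∑ u : Fin a → Fin N,
      if x.HasWeight (fun i => (u i : ℕ)) k then
        graphWeight (weightTensor X ψ fun i => (u i : ℕ)) γ x Empty.elim else 0

theorem map_weightedSum {B : Type*} [CommRing A] [Algebra ℂ A] [CommRing B] [Algebra ℂ B]
    (π : A →ₐ[ℂ] B) (N k : ℕ) (X : Fin n → Tensor M A) (ψ : ℤ → Tensor M A) (γ : M → M → A) :
    π (weightedSum N k X ψ γ) = weightedSum N k (fun j α β => π (X j α β))
      (fun w α β => π (ψ w α β)) (fun s r => π (γ s r)) := by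
  classical
  simp only [weightedSum, map_sum, map_smul, apply_ite π, map_zero, graphWeight, map_mul, map_prod]
  refine Finset.sum_congr rfl fun a _ => Finset.sum_congr rfl fun b _ => ?_
  congr 1
  refine Finset.sum_congr rfl fun x _ => Finset.sum_congr rfl fun u _ => ?_
  congr 2
  refine Finset.prod_congr rfl fun v _ => ?_
  rcases v with k | i <;> rfl

theorem Config.degree_eq {E V : Type*} [Fintype E] (x : Config E V M) (v : V) :
    x.degree v = Nat.card {e // (x e).2.1 = v} + Nat.card {e // (x e).1.1 = v} := by
  classical
  rw [degree, sum_multiIndex, sum_multiIndex, Nat.card_eq_fintype_card, Nat.card_eq_fintype_card,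
    Fintype.card_subtype, Fintype.card_subtype]

theorem Graph.hasWeight_config {I E : Type} [Fintype I] [Fintype E] (G : Graph n I E)
    (l : E → M × M) {k : ℕ} (h : G.totalWeight = k) :
    (G.config l).HasWeight (fun i => (G.weight i + 1).toNat) k := by
  refine ⟨G.valid_config l, fun i hi => ?_, ?_⟩
  · rw [Config.degree_eq]
    refine G.three_le_degree i ?_
    have := G.neg_one_le_weight i
    have hi' : (G.weight i + 1).toNat = 0 := hi
    omega
  · rw [← h, Graph.totalWeight]
    congr 1
    refine Finset.sum_congr rfl fun i _ => ?_
    have := G.neg_one_le_weight i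
    rw [Int.toNat_of_nonneg (by omega)]
    ring

/-- The graph underlying a configuration with given weights. -/
def Config.HasWeight.toGraph {I E : Type} [Fintype I] [Fintype E] {x : Config E (Fin n ⊕ I) M}
    {u : I → ℕ} {k : ℕ} (h : x.HasWeight u k) : Graph n I E where
  tail e := (x e).1.1
  head e := (x e).2.1
  weight i := (u i : ℤ) - 1
  neg_one_le_weight i := by omega
  acyclic v hv := by
    obtain ⟨r, hr⟩ := h.1.acyclic
    exact lt_irrefl _ (Config.Valid.lt_of_transGen hr hv)
  exists_incoming i := h.1.exists_in (Sum.inr i) trivial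
  exists_outgoing i := h.1.exists_out (Sum.inr i) trivial
  first_source k hk := h.1.source (Sum.inl k) hk
  last_sink k hk := h.1.sink (Sum.inl k) hk
  three_le_degree i hi := by
    have := h.2.1 i (by omega)
    rwa [Config.degree_eq] at this

variable [CommRing A] [Algebra ℂ A]

/-- The sum over numbered graphs of a given total weight as a sum over configurations. -/
theorem sum_finGraph_eq_weightedSum {N k : ℕ} (hN : 3 * k < N) (X : Fin n → Tensor M A)
    (ψ : ℤ → Tensor M A) (γ : M → M → A) :
    ∑ G : {G : FinGraph n // G.graph.totalWeight = (k : ℤ)},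
      ((G.1.1.factorial * G.1.2.1.factorial : ℂ)⁻¹) • ∑ l : Fin G.1.2.1 → M × M,
        graphWeight (Sum.elim X fun i => ψ (G.1.graph.weight i)) γ (G.1.graph.config l)
          Empty.elim = weightedSum N k X ψ γ := by
  classical
  have hR : weightedSum N k X ψ γ = ∑ z : Σ a : Fin N, Σ b : Fin N,
      Config (Fin b) (Fin n ⊕ Fin a) M × (Fin a → Fin N),
      (((z.1 : ℕ).factorial * (z.2.1 : ℕ).factorial : ℂ)⁻¹) •
      if z.2.2.1.HasWeight (fun i => (z.2.2.2 i : ℕ)) k then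
        graphWeight (weightTensor X ψ fun i => (z.2.2.2 i : ℕ)) γ z.2.2.1 Empty.elim else 0 := by
    rw [Fintype.sum_sigma, weightedSum, Finset.sum_range]
    refine Finset.sum_congr rfl fun a _ => ?_
    rw [Fintype.sum_sigma, Finset.sum_range]
    refine Finset.sum_congr rfl fun b _ => ?_
    rw [Fintype.sum_prod_type]
    simp only [Finset.smul_sum]
  -- Total weight `k` allows at most `3k` edges, no more internal vertices than edges, and weights
  -- below `k`; hence `3k < N` loses no graph.
  have hb : ∀ G : {G : FinGraph n // G.graph.totalWeight = (k : ℤ)}, G.1.2.1 < N := by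
    rintro ⟨G, hG⟩
    have h := G.graph.card_edge_le
    rw [hG, Fintype.card_fin] at h
    show G.2.1 < _
    omega
  have ha : ∀ G : {G : FinGraph n // G.graph.totalWeight = (k : ℤ)}, G.1.1 < N := by
    rintro ⟨G, hG⟩
    have h := G.graph.card_vert_le
    have h' := hb ⟨G, hG⟩
    rw [Fintype.card_fin, Fintype.card_fin] at h
    exact lt_of_le_of_lt h h'
  have hw : ∀ (G : {G : FinGraph n // G.graph.totalWeight = (k : ℤ)}) i,
      (G.1.graph.weight i + 1).toNat < N := by
    rintro ⟨G, hG⟩ i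
    have h := G.graph.weight_lt i
    have h' := G.graph.neg_one_le_weight i
    rw [hG] at h
    show (G.graph.weight i + 1).toNat < N
    omega
  have hL : ∑ G : {G : FinGraph n // G.graph.totalWeight = (k : ℤ)},
      ((G.1.1.factorial * G.1.2.1.factorial : ℂ)⁻¹) • ∑ l : Fin G.1.2.1 → M × M,
        graphWeight (Sum.elim X fun i => ψ (G.1.graph.weight i)) γ (G.1.graph.config l)
          Empty.elim = ∑ y : Σ G : {G : FinGraph n // G.graph.totalWeight = (k : ℤ)},
            (Fin G.1.2.1 → M × M),
      ((y.1.1.1.factorial * y.1.1.2.1.factorial : ℂ)⁻¹) •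
        graphWeight (Sum.elim X fun i => ψ (y.1.1.graph.weight i)) γ (y.1.1.graph.config y.2)
          Empty.elim := by
    rw [Fintype.sum_sigma]
    simp only [Finset.smul_sum]
  rw [hL, hR]
  refine Fintype.sum_of_injective
    (fun y : Σ G : {G : FinGraph n // G.graph.totalWeight = (k : ℤ)}, (Fin G.1.2.1 → M × M) =>
      (⟨⟨y.1.1.1, ha y.1⟩, ⟨y.1.1.2.1, hb y.1⟩, y.1.1.graph.config y.2,
        fun i => ⟨(y.1.1.graph.weight i + 1).toNat, hw y.1 i⟩⟩ :
        Σ a : Fin N, Σ b : Fin N, Config (Fin b) (Fin n ⊕ Fin a) M × (Fin a → Fin N))) ?_ _ _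
    ?_ ?_
  · rintro ⟨⟨⟨a, b, G⟩, hG⟩, l⟩ ⟨⟨⟨a', b', G'⟩, hG'⟩, l'⟩ h
    rw [Sigma.mk.injEq] at h
    obtain ⟨h1, h2⟩ := h
    obtain rfl : a = a' := congrArg Fin.val h1
    rw [heq_eq_eq, Sigma.mk.injEq] at h2
    obtain ⟨h3, h4⟩ := h2
    obtain rfl : b = b' := congrArg Fin.val h3
    rw [heq_eq_eq, Prod.mk.injEq] at h4
    obtain ⟨h5, h6⟩ := h4
    have h5' : ∀ e, G.config l e = G'.config l' e := congrFun h5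
    have h6' : ∀ i, (G.weight i + 1).toNat = (G'.weight i + 1).toNat := fun i =>
      congrArg Fin.val (congrFun h6 i)
    simp only [Graph.config, Prod.mk.injEq] at h5'
    obtain rfl : G = G' := Graph.ext (funext fun e => (h5' e).1.1) (funext fun e => (h5' e).2.1)
      (funext fun i => by
        have := h6' i
        have := G.neg_one_le_weight i
        have := G'.neg_one_le_weight i
        omega)
    obtain rfl : l = l' := funext fun e => Prod.ext (h5' e).1.2 (h5' e).2.2
    rfl
  -- A configuration that satisfies the weight conditions is a labelled graph, so all terms outside
  -- the image vanish.
  · rintro ⟨a, b, x, u⟩ hz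
    rw [if_neg, smul_zero]
    intro h
    apply hz
    refine ⟨⟨⟨⟨a, b, h.toGraph⟩, h.2.2⟩, fun e => ((x e).1.2, (x e).2.2)⟩, ?_⟩
    have hu : ∀ i, ((h.toGraph.weight i + 1).toNat) = (u i : ℕ) := fun i => by
      change (((u i : ℕ) : ℤ) - 1 + 1).toNat = _
      simp
    have hu' : (fun i => (⟨(h.toGraph.weight i + 1).toNat, hw ⟨⟨a, b, h.toGraph⟩, h.2.2⟩ i⟩ :
        Fin N)) = u := funext fun i => Fin.ext (hu i)
    exact congrArg (fun u' => (⟨a, b, x, u'⟩ :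
      Σ a : Fin N, Σ b : Fin N, Config (Fin b) (Fin n ⊕ Fin a) M × (Fin a → Fin N))) hu'
  · rintro ⟨⟨⟨a, b, G⟩, hG⟩, l⟩
    have h := G.hasWeight_config l hG
    refine congrArg _ ?_
    refine Eq.trans ?_ (if_pos h).symm
    have hT : (Sum.elim X fun i => ψ (G.weight i)) =
        weightTensor X ψ fun i => (G.weight i + 1).toNat := by
      funext v
      rcases v with j | i
      · rfl
      · have := G.neg_one_le_weight i
        simp only [weightTensor, Sum.elim_inr]
        congr 1
        omega
    exact congrArg (fun T => graphWeight T γ (G.config l) Empty.elim) hT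

end

/-! ### Partition functions and the operators `Dk` at a point. -/

section

variable {m n : ℕ}

/-- The partition function at a point as a sum over configurations. -/
theorem Graph.partitionFun_eq {I E : Type} [Fintype I] [Fintype E] [DecidableEq E]
    (G : Graph n I E)
    (Φ : ℤ → (Fin m → ℂ) → ℂ) (f : Fin n → (Fin m → ℂ) → ℂ) (x : Fin m → ℂ) :
    G.partitionFun Φ f x = ∑ l : E → Fin m × Fin m,
      graphWeight (Sum.elim (fun j α β => mixedDeriv α β (f j) x)
        fun i α β => mixedDeriv α β (-Φ (G.weight i)) x) (fun s r => (metric Φ x)⁻¹ s r) (G.config l)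
        Empty.elim := by
  unfold partitionFun
  refine Finset.sum_congr (by congr!) fun l _ => ?_
  rw [graphWeight]
  refine congrArg₂ _ (Finset.prod_congr rfl fun v _ => ?_) rfl
  have h1 : G.inIndex l v = multiIndex (fun e => (G.config l e).2) v := by
    funext j
    rw [multiIndex_apply]
    rfl
  have h2 : G.outIndex l v = multiIndex (fun e => (G.config l e).1) v := by
    funext j
    rw [multiIndex_apply]
    rfl
  rw [h1, h2, multiIndex_of_isEmpty (H := Empty), add_zero]
  rcases v with j | i <;> rfl

theorem Iso.partitionFun_eq {I E I' E' : Type} [Fintype I] [Fintype E] [DecidableEq E] [Fintype I']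
    [Fintype E'] [DecidableEq E'] {G : Graph n I E} {G' : Graph n I' E'} (φ : Iso G G')
    (Φ : ℤ → (Fin m → ℂ) → ℂ) (f : Fin n → (Fin m → ℂ) → ℂ) (x : Fin m → ℂ) :
    G.partitionFun Φ f x = G'.partitionFun Φ f x := by
  rw [G.partitionFun_eq, G'.partitionFun_eq]
  refine Fintype.sum_equiv (Equiv.arrowCongr φ.edge (Equiv.refl _)) _ _ fun l => ?_
  refine (graphWeight_relabel ((Equiv.refl (Fin n)).sumCongr φ.vert) φ.edge (Equiv.refl Empty)
    (fun v => ?_) _ (fun e => ?_) fun p => p.elim).symm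
  · rcases v with j | i
    · rfl
    · simp [φ.map_weight]
  · simp only [Graph.config, φ.map_tail, φ.map_head, Equiv.arrowCongr_apply, Function.comp_apply,
      Equiv.symm_apply_apply]
    rfl

/-- The coefficients of the operator `D` as sums over configurations. -/
theorem Dk_eq_weightedSum {N k : ℕ} (hN : 3 * k < N) (Φ : ℤ → (Fin m → ℂ) → ℂ)
    (f : Fin n → (Fin m → ℂ) → ℂ) (x : Fin m → ℂ) :
    Dk Φ k f x = weightedSum N k (fun j α β => mixedDeriv α β (f j) x)
      (fun w α β => mixedDeriv α β (-Φ w) x) (fun s r => (metric Φ x)⁻¹ s r) := by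
  rw [← sum_finGraph_eq_weightedSum hN]
  refine (sum_isoClass (fun G => G.graph.partitionFun Φ f x)
    fun G G' ⟨φ⟩ => φ.partitionFun_eq Φ f x).trans ?_
  refine Finset.sum_congr rfl fun G _ => ?_
  rw [Graph.partitionFun_eq, smul_eq_mul]

end

/-! ## Generating polynomials -/

section

open Polynomial

variable {n : ℕ} {M A : Type*} [Fintype M] [DecidableEq M] [CommRing A]

/-- The generating polynomial of the tensors `X j`; an index has degree one, the formal parameter has
degree three. -/
noncomputable def extTensor (N : ℕ) (X : ℕ → Tensor M A) : Tensor M A[X] := fun α β =>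
  ∑ j : Fin N, C (X j α β) * Polynomial.X ^ (3 * (j : ℕ) + (∑ i, α i + ∑ i, β i))

/-- The generating polynomial of the tensors `ψ w` at the internal vertices. -/
noncomputable def intTensor (N : ℕ) (ψ : ℤ → Tensor M A) : Tensor M A[X] := fun α β =>
  ∑ u : Fin N, if (u : ℕ) = 0 → 3 ≤ ∑ i, α i + ∑ i, β i then
    C (ψ ((u : ℤ) - 1) α β) * Polynomial.X ^ (3 * (u : ℕ) + (∑ i, α i + ∑ i, β i) - 3) else 0

theorem sum_degree {E V : Type*} [Fintype E] [Fintype V] (x : Config E V M) :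
    ∑ v, x.degree v = 2 * Fintype.card E := by
  classical
  simp only [Config.degree, sum_multiIndex, Finset.sum_add_distrib]
  rw [← Finset.card_eq_sum_card_fiberwise (f := fun e => (x e).2.1) (fun _ _ => Finset.mem_univ _),
    ← Finset.card_eq_sum_card_fiberwise (f := fun e => (x e).1.1) (fun _ _ => Finset.mem_univ _),
    Finset.card_univ, two_mul]

/-- The exponent of the contribution of a configuration with weights `u` and orders `j`. -/
noncomputable def Config.exponent {E I : Type*} [Fintype E] [Fintype I]
    (x : Config E (Fin n ⊕ I) M) (j : Fin n → ℕ) (u : I → ℕ) : ℕ :=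
  ∑ k, (3 * j k + x.degree (Sum.inl k)) + ∑ i, (3 * u i + x.degree (Sum.inr i) - 3) +
    Fintype.card E

/-- The degrees contribute `2|E|` and the propagators `|E|`, which makes the exponent three times
the order in `h`. The hypothesis on `u` ensures that the subtraction of `3` is not truncated. -/
theorem Config.exponent_eq {E I : Type*} [Fintype E] [Fintype I]
    (x : Config E (Fin n ⊕ I) M) (j : Fin n → ℕ) (u : I → ℕ)
    (hu : ∀ i, u i = 0 → 3 ≤ x.degree (Sum.inr i)) :
    (x.exponent j u : ℤ) =
      3 * (∑ k, (j k : ℤ) + ((Fintype.card E : ℤ) + ∑ i, ((u i : ℤ) - 1))) := by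
  have h1 := sum_degree x
  rw [Fintype.sum_sum_type] at h1
  zify at h1
  have h2 : ∀ i, ((3 * u i + x.degree (Sum.inr i) - 3 : ℕ) : ℤ) =
      3 * ((u i : ℤ) - 1) + x.degree (Sum.inr i) := fun i => by
    have := hu i
    omega
  unfold exponent
  push_cast [h2]
  rw [Finset.sum_add_distrib, Finset.sum_add_distrib, ← Finset.mul_sum, ← Finset.mul_sum]
  linarith

-- Expanding the product over the vertices amounts to the choice of an order `j` at each external
-- vertex and of a weight `u - 1` at each internal one.
open Classical in
theorem graphWeight_polynomial {E I : Type*} [Fintype E] [Fintype I] [DecidableEq I] (N : ℕ)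
    (X : Fin n → ℕ → Tensor M A) (ψ : ℤ → Tensor M A) (γ : M → M → A)
    (x : Config E (Fin n ⊕ I) M) :
    graphWeight (graphTensor I (fun k => extTensor N (X k)) (intTensor N ψ))
      (fun s r => Polynomial.X * C (γ s r)) x (Empty.elim : Empty → _) =
    ∑ u : I → Fin N, ∑ j : Fin n → Fin N,
      if ∀ i, (u i : ℕ) = 0 → 3 ≤ x.degree (Sum.inr i) then
        C (graphWeight (weightTensor (fun k => X k (j k)) ψ fun i => (u i : ℕ)) γ x Empty.elim) *
          Polynomial.X ^ x.exponent (fun k => (j k : ℕ)) (fun i => (u i : ℕ)) else 0 := by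
  rw [graphWeight, Fintype.prod_sum_type]
  simp only [graphTensor, Sum.elim_inl, Sum.elim_inr, extTensor, intTensor]
  rw [Finset.prod_univ_sum, Finset.prod_univ_sum, Fintype.piFinset_univ, Fintype.piFinset_univ,
    mul_comm (∑ p : Fin n → Fin N, _), Finset.sum_mul_sum, Finset.sum_mul]
  refine Finset.sum_congr rfl fun u _ => ?_
  rw [Finset.sum_mul]
  refine Finset.sum_congr rfl fun j _ => ?_
  simp only [multiIndex_of_isEmpty (H := Empty), add_zero]
  split_ifs with hu
  · simp only [Config.degree] at hu
    simp only [if_pos (hu _)]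
    rw [graphWeight, Fintype.prod_sum_type]
    simp only [Finset.prod_mul_distrib, Finset.prod_pow_eq_pow_sum, Finset.prod_const, map_mul,
      map_prod, weightTensor, Sum.elim_inl, Sum.elim_inr, multiIndex_of_isEmpty (H := Empty),
      add_zero, Config.exponent, pow_add, Config.degree, Finset.card_univ]
    simp only [Finset.sum_add_distrib, pow_add]
    ring
  · push Not at hu
    obtain ⟨i, hi, hi'⟩ := hu
    rw [Finset.prod_eq_zero (Finset.mem_univ i), zero_mul, zero_mul]
    refine if_neg fun h => ?_
    exact absurd (h hi) (not_le.2 hi')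

variable [Algebra ℂ A]

open Classical in
/-- The coefficients of the partition sum of the generating polynomials. -/
theorem coeff_partitionSum {N c : ℕ} (hc : c < N) (X : Fin n → ℕ → Tensor M A)
    (ψ : ℤ → Tensor M A) (γ : M → M → A) (l : Empty → M) :
    (partitionSum N (fun k => extTensor N (X k)) (intTensor N ψ)
      (fun s r => Polynomial.X * C (γ s r)) l).coeff c =
    if 3 ∣ c then ∑ p ∈ Finset.Nat.antidiagonalTuple (n + 1) (c / 3),
      weightedSum N (p 0) (fun k => X k (p k.succ)) ψ γ else 0 := by
  have hR : (if 3 ∣ c then ∑ p ∈ Finset.Nat.antidiagonalTuple (n + 1) (c / 3),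
      weightedSum N (p 0) (fun k => X k (p k.succ)) ψ γ else 0) =
      ∑ a ∈ Finset.range N, ∑ b ∈ Finset.range N, ((a.factorial * b.factorial : ℂ)⁻¹) •
        ∑ x : Config (Fin b) (Fin n ⊕ Fin a) M, ∑ u : Fin a → Fin N,
          if 3 ∣ c then ∑ p ∈ Finset.Nat.antidiagonalTuple (n + 1) (c / 3),
          if x.HasWeight (fun i => (u i : ℕ)) (p 0) then
            graphWeight (weightTensor (fun k => X k (p k.succ)) ψ fun i => (u i : ℕ)) γ x
              Empty.elim else 0 else 0 := by
    split_ifs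
    · unfold weightedSum
      rw [Finset.sum_comm]
      refine Finset.sum_congr rfl fun a _ => ?_
      rw [Finset.sum_comm]
      refine Finset.sum_congr rfl fun b _ => ?_
      rw [← Finset.smul_sum, Finset.sum_comm]
      congr 1
      refine Finset.sum_congr rfl fun x _ => ?_
      rw [Finset.sum_comm]
    · simp
  rw [hR, partitionSum, finsetSum_coeff]
  refine Finset.sum_congr rfl fun a _ => ?_
  rw [finsetSum_coeff]
  refine Finset.sum_congr rfl fun b _ => ?_
  rw [coeff_smul, graphSum, finsetSum_coeff]
  congr 1
  refine Finset.sum_congr rfl fun x _ => ?_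
  rw [Fintype.sum_unique]
  by_cases hx : x.Valid (graphKind n (Fin a))
  swap
  · simp [hx, Config.HasWeight]
  rw [if_pos ⟨hx, trivial⟩]
  have hl : (fun p : Empty => ((default : Empty → Fin n ⊕ Fin a) p, l p)) = Empty.elim :=
    funext fun p => p.elim
  rw [hl, graphWeight_polynomial, finsetSum_coeff]
  refine Finset.sum_congr rfl fun u _ => ?_
  rw [finsetSum_coeff]
  by_cases hu : ∀ i, (u i : ℕ) = 0 → 3 ≤ x.degree (Sum.inr i)
  swap
  · simp only [coeff_zero, Finset.sum_const_zero, Config.HasWeight, hu, false_and,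
      and_false, if_false, ite_self]
  simp only [if_pos hu, coeff_C_mul, coeff_X_pow, mul_ite, mul_one, mul_zero]
  have hexp := fun j : Fin n → Fin N => x.exponent_eq (fun k => (j k : ℕ)) (fun i => (u i : ℕ)) hu
  -- This bounds the sum of the orders, so that the subtraction in the bijection below is not
  -- truncated.
  have hge : ∀ j : Fin n → Fin N, 3 * ∑ k, (j k : ℕ) ≤
      x.exponent (fun k => (j k : ℕ)) (fun i => (u i : ℕ)) := fun j => by
    unfold Config.exponent
    rw [Finset.sum_add_distrib, ← Finset.mul_sum]
    omega
  split_ifs with h3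
  swap
  · refine Finset.sum_eq_zero fun j _ => if_neg fun h => h3 ?_
    have := hexp j
    rw [← h] at this
    omega
  obtain ⟨K, rfl⟩ := h3
  rw [Nat.mul_div_cancel_left K (by norm_num)]
  rw [← Finset.sum_filter, ← Finset.sum_filter]
  -- The total weight of the graph is what the orders `j` leave of `K`; it becomes the entry `p 0`.
  refine Finset.sum_bij (fun j _ => Fin.cons (K - ∑ k, (j k : ℕ)) fun k => (j k : ℕ)) ?_ ?_ ?_ ?_
  · intro j hj
    have h0 := (Finset.mem_filter.1 hj).2
    have h1 := hexp j
    have h2 := hge j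
    rw [← h0] at h1 h2
    rw [Finset.mem_filter, Finset.Nat.mem_antidiagonalTuple, Fin.sum_univ_succ]
    simp only [Fin.cons_zero, Fin.cons_succ]
    refine ⟨by omega, hx, hu, ?_⟩
    push_cast [show ∑ k, (j k : ℕ) ≤ K by omega]
    push_cast at h1
    linarith
  · intro j _ j' _ h
    funext k
    have := congrFun h k.succ
    simp only [Fin.cons_succ] at this
    exact Fin.ext this
  · intro p hp
    obtain ⟨hp1, hp2⟩ := Finset.mem_filter.1 hp
    rw [Finset.Nat.mem_antidiagonalTuple, Fin.sum_univ_succ] at hp1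
    have hlt : ∀ k : Fin n, p k.succ < N := fun k => by
      have := Finset.single_le_sum (f := fun k : Fin n => p k.succ) (fun _ _ => Nat.zero_le _)
        (Finset.mem_univ k)
      omega
    refine ⟨fun k => ⟨p k.succ, hlt k⟩, ?_, ?_⟩
    · rw [Finset.mem_filter]
      refine ⟨Finset.mem_univ _, ?_⟩
      have h1 := hexp fun k => ⟨p k.succ, hlt k⟩
      rw [hp2.2.2] at h1
      zify at hp1 ⊢
      rw [h1]
      linarith
    · funext k
      refine Fin.cases ?_ (fun k => ?_) k
      · change K - ∑ k : Fin n, p (Fin.succ k) = p 0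
        omega
      · simp
  · intro j _
    simp
end

/-! ## Associativity over a differential algebra -/

section

open Polynomial

variable {n : ℕ} {M A : Type*} [Fintype M] [DecidableEq M] [CommRing A] [Algebra ℂ A]

theorem map_partitionSum {B : Type*} [CommRing B] [Algebra ℂ B] (π : A →ₐ[ℂ] B) (N : ℕ)
    (X : Fin n → Tensor M A) (V : Tensor M A) (γ : M → M → A) {P : Type*} [Fintype P]
    [DecidableEq P] (l : P → M) :
    π (partitionSum N X V γ l) = partitionSum N (fun k α β => π (X k α β))
      (fun α β => π (V α β)) (fun s r => π (γ s r)) l := by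
  classical
  simp only [partitionSum, graphSum, map_sum, map_smul, apply_ite π, map_zero, graphWeight, map_mul,
    map_prod]
  refine Finset.sum_congr rfl fun a _ => Finset.sum_congr rfl fun b _ => ?_
  congr 1
  refine Finset.sum_congr rfl fun x _ => Finset.sum_congr rfl fun u _ => ?_
  congr 2
  refine Finset.prod_congr rfl fun v _ => ?_
  rcases v with k | i <;> rfl

/-- The derivation of polynomials that applies `d` to the coefficients and multiplies by the
variable. -/
noncomputable def scaledDerivation (d : Derivation ℂ A A) : Derivation ℂ A[X] A[X] :=
  (Polynomial.X : A[X]) • PolynomialModule.equivPolynomialSelf.toLinearMap.compDer d.mapCoeffs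

theorem scaledDerivation_C_mul_X_pow (d : Derivation ℂ A A) (a : A) (k : ℕ) :
    scaledDerivation d (C a * Polynomial.X ^ k) = C (d a) * Polynomial.X ^ (k + 1) := by
  have h : PolynomialModule.equivPolynomialSelf (d.mapCoeffs (monomial k a)) =
      monomial k (d a) := by
    rw [Derivation.mapCoeffs_monomial]
    simp [PolynomialModule.equivPolynomialSelf_apply_eq]
  rw [C_mul_X_pow_eq_monomial]
  change (Polynomial.X : A[X]) • PolynomialModule.equivPolynomialSelf (d.mapCoeffs (monomial k a)) = _
  rw [h, ← C_mul_X_pow_eq_monomial, smul_eq_mul, pow_succ]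
  ring

/-- Polynomials truncated in degree `N`. -/
abbrev Truncation (A : Type*) [CommRing A] (N : ℕ) : Type _ :=
  A[X] ⧸ Ideal.span {(Polynomial.X : A[X]) ^ N}

/-- The projection to the truncated polynomials. -/
noncomputable def truncate (A : Type*) [CommRing A] [Algebra ℂ A] (N : ℕ) :
    A[X] →ₐ[ℂ] Truncation A N :=
  Ideal.Quotient.mkₐ ℂ _

theorem truncate_surjective (N : ℕ) : Function.Surjective (truncate A N) :=
  Ideal.Quotient.mkₐ_surjective ℂ _

theorem truncate_eq_zero {N : ℕ} {p : A[X]} : truncate A N p = 0 ↔ Polynomial.X ^ N ∣ p := by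
  rw [truncate, Ideal.Quotient.mkₐ_eq_mk, Ideal.Quotient.eq_zero_iff_mem,
    Ideal.mem_span_singleton]

theorem truncate_eq_iff {N : ℕ} {p q : A[X]} :
    truncate A N p = truncate A N q ↔ ∀ c < N, p.coeff c = q.coeff c := by
  rw [← sub_eq_zero, ← map_sub, truncate_eq_zero, X_pow_dvd_iff]
  simp only [coeff_sub, sub_eq_zero]

/-- The derivation acts on coefficients and kills `X ^ N`, so it preserves the ideal. -/
theorem truncate_scaledDerivation (N : ℕ) (d : Derivation ℂ A A) (p : A[X])
    (hp : truncate A N p = 0) : truncate A N (scaledDerivation d p) = 0 := by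
  rw [truncate_eq_zero] at hp ⊢
  obtain ⟨q, rfl⟩ := hp
  have h := scaledDerivation_C_mul_X_pow d 1 N
  rw [map_one, one_mul, Derivation.map_one_eq_zero, map_zero, zero_mul] at h
  rw [Derivation.leibniz, h, smul_zero, add_zero, smul_eq_mul]
  exact dvd_mul_right _ _

/-- The derivation of the truncated polynomials induced by `d`. -/
noncomputable def truncatedDerivation (N : ℕ) (d : Derivation ℂ A A) :
    Derivation ℂ (Truncation A N) (Truncation A N) :=
  Derivation.liftOfSurjective (truncate_surjective N) (truncate_scaledDerivation N d)

theorem truncatedDerivation_truncate (N : ℕ) (d : Derivation ℂ A A) (p : A[X]) :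
    truncatedDerivation N d (truncate A N p) = truncate A N (scaledDerivation d p) :=
  Derivation.liftOfSurjective_apply _ (truncate_scaledDerivation N d) _

theorem sum_add_single (α : M → ℕ) (i : M) :
    ∑ j, (α + Pi.single i 1 : M → ℕ) j = ∑ j, α j + 1 := by
  simp [Finset.sum_add_distrib]

/-- The factor `X` in `scaledDerivation` accounts for the degree of the additional index. -/
theorem isDifferential_extTensor (N N' : ℕ) {d : M → Derivation ℂ A A} {X : ℕ → Tensor M A}
    (hX : ∀ j, (X j).IsDifferential d) :
    Tensor.IsDifferential (fun i => truncatedDerivation N (d i))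
      fun α β => truncate A N (extTensor N' X α β) := by
  intro i α β
  simp only [truncatedDerivation_truncate, extTensor, map_sum, scaledDerivation_C_mul_X_pow]
  refine Finset.sum_congr rfl fun j _ => ?_
  rw [hX, sum_add_single]
  congr 3
  ring

variable {d : M → Derivation ℂ A A} {ψ : ℤ → Tensor M A} {γ : M → M → A} {N : ℕ}

-- The derivative of `intTensor` misses the trivalent vertices of weight `-1` that come from the
-- forbidden bivalent ones; these are `K`, and their power of `X` is `3 * 0 + 3 - 3 = 0`. On the
-- propagator, the factor `X` of the derivation supplies the second of the two edges of the
-- subdivision.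
open Classical in
theorem isPropagator_truncate (hN : 0 < N) (hψ : ∀ w, (ψ w).IsDifferential d)
    (hγ : ∀ i s r, d i (γ s r) = ∑ p, ∑ q,
      γ s p * ψ (-1) (Pi.single p 1 + Pi.single i 1) (Pi.single q 1) * γ q r) :
    IsPropagator (fun i => truncatedDerivation N (d i))
      (fun α β => truncate A N (intTensor N ψ α β))
      (fun s r => truncate A N (Polynomial.X * C (γ s r)))
      (fun i α β => if ∑ j, α j = 1 ∧ ∑ j, β j = 1 then
        truncate A N (C (ψ (-1) (α + Pi.single i 1) β)) else 0)
      (truncate A N Polynomial.X) N where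
  pow_eq_zero := by
    rw [← map_pow, truncate_eq_zero]
  dvd s r := by
    rw [map_mul]
    exact dvd_mul_right _ _
  bidegree i α β h := by
    by_contra h'
    exact h (if_neg h')
  derivation_propagator i s r := by
    have h := scaledDerivation_C_mul_X_pow (d i) (γ s r) 1
    rw [pow_one, mul_comm] at h
    rw [truncatedDerivation_truncate, h, hγ]
    have hs : ∀ p : M, ∑ j, (Pi.single p 1 : M → ℕ) j = 1 := fun p => by simp
    simp only [hs, and_self, if_true, ← map_mul, ← map_sum]
    congr 1
    rw [map_sum, Finset.sum_mul]
    refine Finset.sum_congr rfl fun p _ => ?_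
    rw [map_sum, Finset.sum_mul]
    refine Finset.sum_congr rfl fun q _ => ?_
    rw [map_mul, map_mul]
    ring
  derivation_vertex i α β hα hβ := by
    have hpos : ∀ δ : M → ℕ, δ ≠ 0 → 0 < ∑ j, δ j := fun δ hδ => by
      refine Nat.pos_of_ne_zero fun h => hδ (funext fun j => ?_)
      exact Finset.sum_eq_zero_iff.1 h j (Finset.mem_univ j)
    have hα' := hpos α hα
    have hβ' := hpos β hβ
    obtain ⟨N, rfl⟩ : ∃ N', N = N' + 1 := ⟨N - 1, by omega⟩
    have hK : (if ∑ j, α j = 1 ∧ ∑ j, β j = 1 then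
        truncate A (N + 1) (C (ψ (-1) (α + Pi.single i 1) β)) else 0) =
        truncate A (N + 1) (if ∑ j, α j = 1 ∧ ∑ j, β j = 1 then
          C (ψ (-1) (α + Pi.single i 1) β) else 0) := by
      rw [apply_ite (truncate A (N + 1)), map_zero]
    rw [truncatedDerivation_truncate, hK, ← map_sub]
    congr 1
    simp only [intTensor, Fin.sum_univ_succ, Fin.val_zero, Fin.val_succ, Nat.add_eq_zero_iff,
      one_ne_zero, and_false, IsEmpty.forall_iff, if_true, forall_const]
    rw [map_add, map_sum, add_sub_right_comm]
    congr 1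
    -- Only the weight `-1`, the term `u = 0`, is exceptional. As both multi-indices are nonzero, a
    -- degree below three means bidegree `(1, 1)`.
    · by_cases h3 : 3 ≤ ∑ j, α j + ∑ j, β j
      · rw [if_pos h3, if_pos (by rw [sum_add_single]; omega), if_neg (by omega), sub_zero,
          scaledDerivation_C_mul_X_pow, hψ, sum_add_single]
        congr 2
        omega
      · rw [if_neg h3, if_pos (by rw [sum_add_single]; omega), if_pos (by omega), map_zero,
          sum_add_single, show 3 * 0 + (∑ j, α j + 1 + ∑ j, β j) - 3 = 0 by omega, pow_zero, mul_one]
        simp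
    · refine Finset.sum_congr rfl fun u _ => ?_
      rw [scaledDerivation_C_mul_X_pow, hψ, sum_add_single]
      congr 2
      omega

/-- One half of the associativity over a differential algebra. -/
theorem sum_weightedSum_assoc (hψ : ∀ w, (ψ w).IsDifferential d)
    (hγ : ∀ i s r, d i (γ s r) = ∑ p, ∑ q,
      γ s p * ψ (-1) (Pi.single p 1 + Pi.single i 1) (Pi.single q 1) * γ q r)
    (X₁ : ℕ → Tensor M A) {X₂ X₃ B : ℕ → Tensor M A} (hX₂ : ∀ j, (X₂ j).IsDifferential d)
    (hX₃ : ∀ j, (X₃ j).IsDifferential d) (hB : ∀ j, (B j).IsDifferential d)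
    (hB₀ : ∀ j, 3 * j < N → B j 0 0 = ∑ p ∈ Finset.Nat.antidiagonalTuple 3 j,
      weightedSum N (p 0) (fun k => (![X₂, X₃] : Fin 2 → _) k (p k.succ)) ψ γ) {j : ℕ}
    (hj : 3 * j < N) :
    ∑ p ∈ Finset.Nat.antidiagonalTuple 4 j,
      weightedSum N (p 0) (fun k => (![X₁, X₂, X₃] : Fin 3 → _) k (p k.succ)) ψ γ =
    ∑ p ∈ Finset.Nat.antidiagonalTuple 3 j,
      weightedSum N (p 0) (fun k => (![X₁, B] : Fin 2 → _) k (p k.succ)) ψ γ := by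
  have hN : 0 < N := by omega
  have hB₀' : truncate A N (extTensor N B 0 0) = partitionSum N
      ![fun α β => truncate A N (extTensor N X₂ α β), fun α β => truncate A N (extTensor N X₃ α β)]
      (fun α β => truncate A N (intTensor N ψ α β))
      (fun s r => truncate A N (Polynomial.X * C (γ s r))) (Empty.elim : Empty → M) := by
    have h := map_partitionSum (truncate A N) N (fun k => extTensor N ((![X₂, X₃] : Fin 2 → _) k))
      (intTensor N ψ) (fun s r => Polynomial.X * C (γ s r)) (Empty.elim : Empty → M)
    refine Eq.trans ?_ (h.trans ?_)
    · rw [truncate_eq_iff]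
      intro c hc
      rw [coeff_partitionSum hc]
      simp only [extTensor, finsetSum_coeff, Pi.zero_apply, Finset.sum_const_zero, add_zero,
        coeff_C_mul, coeff_X_pow, mul_ite, mul_one, mul_zero]
      split_ifs with h3
      · obtain ⟨j, rfl⟩ := h3
        rw [Nat.mul_div_cancel_left j (by norm_num), ← hB₀ j hc,
          Finset.sum_eq_single (⟨j, by omega⟩ : Fin N)]
        · simp
        · intro b _ hb
          refine if_neg fun h => hb (Fin.ext ?_)
          simp only
          omega
        · simp
      · refine Finset.sum_eq_zero fun b _ => if_neg fun h => h3 ⟨_, h⟩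
    · congr 1
      funext k
      fin_cases k <;> rfl
  have key := (isPropagator_truncate hN hψ hγ).partitionSum_three
    (fun α β => truncate A N (extTensor N X₁ α β)) (isDifferential_extTensor N N hX₂)
    (isDifferential_extTensor N N hX₃) (isDifferential_extTensor N N hB) Empty.elim hB₀'
  have h3 := map_partitionSum (truncate A N) N
    (fun k => extTensor N ((![X₁, X₂, X₃] : Fin 3 → _) k))
    (intTensor N ψ) (fun s r => Polynomial.X * C (γ s r)) (Empty.elim : Empty → M)
  have h2 := map_partitionSum (truncate A N) N
    (fun k => extTensor N ((![X₁, B] : Fin 2 → _) k))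
    (intTensor N ψ) (fun s r => Polynomial.X * C (γ s r)) (Empty.elim : Empty → M)
  have h := h3.trans (Eq.trans ?_ (key.trans (Eq.trans ?_ h2.symm)))
  · rw [truncate_eq_iff] at h
    have := h _ hj
    rw [coeff_partitionSum hj, coeff_partitionSum hj, if_pos (dvd_mul_right _ _),
      if_pos (dvd_mul_right _ _), Nat.mul_div_cancel_left j (by norm_num)] at this
    exact this
  · congr 1
    funext k
    fin_cases k <;> rfl
  · congr 1
    funext k
    fin_cases k <;> rfl

end

/-! ### Reversal of the edges and the other half of the associativity. -/

section

open Polynomial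

variable {n : ℕ} {M A : Type*} [Fintype M] [DecidableEq M] [CommRing A] [Algebra ℂ A]

/-- The tensor with the holomorphic and the anti-holomorphic indices exchanged. -/
def Tensor.swap {M L : Type*} (X : Tensor M L) : Tensor M L := fun α β => X β α

theorem extTensor_swap {M A : Type*} [Fintype M] [CommRing A] (N : ℕ) (X : ℕ → Tensor M A) :
    extTensor N (fun j => (X j).swap) = fun α β => extTensor N X β α := by
  funext α β
  simp only [extTensor, Tensor.swap, add_comm (∑ i, α i)]

theorem intTensor_swap {M A : Type*} [Fintype M] [CommRing A] (N : ℕ) (ψ : ℤ → Tensor M A) :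
    intTensor N (fun w => (ψ w).swap) = fun α β => intTensor N ψ β α := by
  funext α β
  simp only [intTensor, Tensor.swap, add_comm (∑ i, α i)]

/-- The sum over graphs is invariant under the reversal of all edges. -/
theorem sum_weightedSum_reverse {N j : ℕ} (hj : 3 * j < N) (X : Fin n → ℕ → Tensor M A)
    (ψ : ℤ → Tensor M A) (γ : M → M → A) :
    ∑ p ∈ Finset.Nat.antidiagonalTuple (n + 1) j, weightedSum N (p 0)
      (fun k => (X k.rev (p k.succ)).swap) (fun w => (ψ w).swap) (fun s r => γ r s) =
    ∑ p ∈ Finset.Nat.antidiagonalTuple (n + 1) j,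
      weightedSum N (p 0) (fun k => X k (p k.succ)) ψ γ := by
  have h := partitionSum_reverse N (fun k => extTensor N (X k)) (intTensor N ψ)
    (fun s r => Polynomial.X * C (γ s r)) (Empty.elim : Empty → M)
  have h' := coeff_partitionSum hj (fun k i => (X k.rev i).swap) (fun w => (ψ w).swap)
    (fun s r => γ r s) (Empty.elim : Empty → M)
  simp only [extTensor_swap, intTensor_swap] at h'
  rw [h, coeff_partitionSum hj, if_pos (dvd_mul_right _ _), if_pos (dvd_mul_right _ _),
    Nat.mul_div_cancel_left j (by norm_num)] at h'
  exact h'.symm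

variable {d : M → Derivation ℂ A A} {ψ : ℤ → Tensor M A} {γ : M → M → A} {N : ℕ}

/-- The other half of the associativity over a differential algebra. -/
theorem sum_weightedSum_assoc_swap (hψ : ∀ w, (ψ w).swap.IsDifferential d)
    (hγ : ∀ i s r, d i (γ s r) = ∑ p, ∑ q,
      γ s p * ψ (-1) (Pi.single p 1) (Pi.single q 1 + Pi.single i 1) * γ q r)
    {X₁ X₂ B : ℕ → Tensor M A} (X₃ : ℕ → Tensor M A) (hX₁ : ∀ j, (X₁ j).swap.IsDifferential d)
    (hX₂ : ∀ j, (X₂ j).swap.IsDifferential d) (hB : ∀ j, (B j).swap.IsDifferential d)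
    (hB₀ : ∀ j, 3 * j < N → B j 0 0 = ∑ p ∈ Finset.Nat.antidiagonalTuple 3 j,
      weightedSum N (p 0) (fun k => (![X₁, X₂] : Fin 2 → _) k (p k.succ)) ψ γ) {j : ℕ}
    (hj : 3 * j < N) :
    ∑ p ∈ Finset.Nat.antidiagonalTuple 4 j,
      weightedSum N (p 0) (fun k => (![X₁, X₂, X₃] : Fin 3 → _) k (p k.succ)) ψ γ =
    ∑ p ∈ Finset.Nat.antidiagonalTuple 3 j,
      weightedSum N (p 0) (fun k => (![B, X₃] : Fin 2 → _) k (p k.succ)) ψ γ := by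
  have h2 : ∀ (Y Y' : ℕ → Tensor M A) (p : Fin 3 → ℕ),
      (fun k : Fin 2 => ((![Y, Y'] : Fin 2 → _) k.rev (p k.succ)).swap) =
        fun k => (![fun j => (Y' j).swap, fun j => (Y j).swap] : Fin 2 → _) k (p k.succ) := by
    intro Y Y' p
    funext k
    fin_cases k <;> rfl
  have h3 : ∀ p : Fin 4 → ℕ,
      (fun k : Fin 3 => ((![X₁, X₂, X₃] : Fin 3 → _) k.rev (p k.succ)).swap) =
        fun k => (![fun j => (X₃ j).swap, fun j => (X₂ j).swap, fun j => (X₁ j).swap] :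
          Fin 3 → _) k (p k.succ) := by
    intro p
    funext k
    fin_cases k <;> rfl
  -- After the reversal `X₃` is the first vertex and the inner pair is `(X₂, X₁)`, so the first half
  -- applies with the swapped tensors.
  rw [← sum_weightedSum_reverse hj, ← sum_weightedSum_reverse hj]
  simp only [h2, h3]
  refine sum_weightedSum_assoc hψ (fun i s r => ?_) _ hX₂ hX₁ hB (fun j hj => ?_) hj
  · rw [hγ, Finset.sum_comm]
    refine Finset.sum_congr rfl fun p _ => Finset.sum_congr rfl fun q _ => ?_
    simp only [Tensor.swap]
    ring
  · simp only [← h2]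
    rw [sum_weightedSum_reverse hj, ← hB₀ j hj]
    rfl

end

/-! ## The algebra of smooth functions -/

section

variable {m : ℕ} {U : Set (Fin m → ℂ)}

/-- The algebra of smooth complex functions on `U`. -/
def SmoothFun (U : Set (Fin m → ℂ)) : Subalgebra ℂ (U → ℂ) where
  carrier := {f | ∃ F : (Fin m → ℂ) → ℂ, ContDiffOn ℝ ∞ F U ∧ ∀ x : U, F x = f x}
  mul_mem' := by
    rintro f g ⟨F, hF, hf⟩ ⟨G, hG, hg⟩
    exact ⟨F * G, hF.mul hG, fun x => by simp [hf, hg]⟩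
  add_mem' := by
    rintro f g ⟨F, hF, hf⟩ ⟨G, hG, hg⟩
    exact ⟨F + G, hF.add hG, fun x => by simp [hf, hg]⟩
  algebraMap_mem' c := ⟨fun _ => c, contDiffOn_const, fun x => rfl⟩

/-- The function `F` is smooth on `U`, with restriction `f`. -/
def Represents (F : (Fin m → ℂ) → ℂ) (f : SmoothFun U) : Prop :=
  ContDiffOn ℝ ∞ F U ∧ ∀ x : U, F x = f.1 x

theorem exists_represents {F : (Fin m → ℂ) → ℂ} (hF : ContDiffOn ℝ ∞ F U) :
    ∃ f : SmoothFun U, Represents F f :=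
  ⟨⟨fun x => F x, F, hF, fun _ => rfl⟩, hF, fun _ => rfl⟩

/-- An extension of a smooth function to the whole space. -/
noncomputable def smoothLift (f : SmoothFun U) : (Fin m → ℂ) → ℂ := f.2.choose

theorem represents_smoothLift (f : SmoothFun U) : Represents (smoothLift f) f := f.2.choose_spec

/-- The evaluation at a point. -/
def SmoothFun.eval (x : U) : SmoothFun U →ₐ[ℂ] ℂ :=
  (Pi.evalAlgHom ℂ (fun _ : U => ℂ) x).comp (SmoothFun U).val

theorem Represents.eval_eq {F : (Fin m → ℂ) → ℂ} {f : SmoothFun U} (h : Represents F f) (x : U) :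
    SmoothFun.eval x f = F x := (h.2 x).symm

theorem SmoothFun.ext_eval {f g : SmoothFun U} (h : ∀ x, eval x f = eval x g) : f = g :=
  Subtype.ext (funext h)

theorem SmoothFun.isUnit {f : SmoothFun U} (h : ∀ x, eval x f ≠ 0) : IsUnit f := by
  obtain ⟨F, hF, hf⟩ := f.2
  refine IsUnit.of_mul_eq_one ⟨fun x => (f.1 x)⁻¹, F⁻¹, hF.inv fun x hx => ?_, fun x => ?_⟩ ?_
  · rw [hf ⟨x, hx⟩]
    exact h ⟨x, hx⟩
  · simp [hf]
  · exact ext_eval fun x => mul_inv_cancel₀ (h x)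

theorem Represents.contDiffAt (hU : IsOpen U) {F : (Fin m → ℂ) → ℂ} {f : SmoothFun U} (h : Represents F f) (x : U) :
    ContDiffAt ℝ ∞ F x := h.1.contDiffAt (hU.mem_nhds x.2)

theorem Represents.differentiableAt (hU : IsOpen U) {F : (Fin m → ℂ) → ℂ} {f : SmoothFun U} (h : Represents F f)
    (x : U) : DifferentiableAt ℝ F x :=
  (h.contDiffAt hU x).differentiableAt (by simp)

/-- On an open set the derivative depends on the germ only; this makes derivations independent of
the chosen extensions. -/
theorem Represents.fderiv_eq (hU : IsOpen U) {F G : (Fin m → ℂ) → ℂ} {f : SmoothFun U} (hF : Represents F f)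
    (hG : Represents G f) (x : U) : fderiv ℝ F x = fderiv ℝ G x := by
  refine Filter.EventuallyEq.fderiv_eq ?_
  filter_upwards [hU.mem_nhds x.2] with y hy
  exact (hF.2 ⟨y, hy⟩).trans (hG.2 ⟨y, hy⟩).symm

theorem contDiffOn_fderiv_apply (hU : IsOpen U) {F : (Fin m → ℂ) → ℂ} (hF : ContDiffOn ℝ ∞ F U) (v : Fin m → ℂ) :
    ContDiffOn ℝ ∞ (fun x => fderiv ℝ F x v) U :=
  (hF.fderiv_of_isOpen hU (by simp)).clm_apply contDiffOn_const

/-- The derivative in the direction `v`. -/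
noncomputable def dirDeriv (hU : IsOpen U) (v : Fin m → ℂ) : Derivation ℂ (SmoothFun U) (SmoothFun U) :=
  Derivation.mk'
    { toFun := fun f => ⟨fun x => fderiv ℝ (smoothLift f) x v, fun x => fderiv ℝ (smoothLift f) x v,
        contDiffOn_fderiv_apply hU (represents_smoothLift f).1 v, fun _ => rfl⟩
      map_add' := fun f g => Subtype.ext (funext fun x => by
        have h : Represents ((smoothLift f) + (smoothLift g)) (f + g) :=
          ⟨(represents_smoothLift f).1.add (represents_smoothLift g).1, fun x => by
            simp [(represents_smoothLift f).2 x, (represents_smoothLift g).2 x]⟩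
        change fderiv ℝ (smoothLift (f + g)) x v = fderiv ℝ (smoothLift f) x v + fderiv ℝ (smoothLift g) x v
        rw [(represents_smoothLift (f + g)).fderiv_eq hU h x,
          fderiv_add ((represents_smoothLift f).differentiableAt hU x)
            ((represents_smoothLift g).differentiableAt hU x)]
        rfl)
      map_smul' := fun c f => Subtype.ext (funext fun x => by
        have h : Represents (c • (smoothLift f)) (c • f) :=
          ⟨(represents_smoothLift f).1.const_smul c, fun x => by simp [(represents_smoothLift f).2 x]⟩
        change fderiv ℝ (smoothLift (c • f)) x v = c • fderiv ℝ (smoothLift f) x v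
        rw [(represents_smoothLift (c • f)).fderiv_eq hU h x,
          fderiv_const_smul ((represents_smoothLift f).differentiableAt hU x)]
        rfl) }
    fun f g => Subtype.ext (funext fun x => by
      have h : Represents ((smoothLift f) * (smoothLift g)) (f * g) :=
        ⟨(represents_smoothLift f).1.mul (represents_smoothLift g).1, fun x => by
          simp [(represents_smoothLift f).2 x, (represents_smoothLift g).2 x]⟩
      change fderiv ℝ (smoothLift (f * g)) x v =
        f.1 x * fderiv ℝ (smoothLift g) x v + g.1 x * fderiv ℝ (smoothLift f) x v
      rw [(represents_smoothLift (f * g)).fderiv_eq hU h x,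
        fderiv_mul ((represents_smoothLift f).differentiableAt hU x)
          ((represents_smoothLift g).differentiableAt hU x), ← (represents_smoothLift f).2, ← (represents_smoothLift g).2]
      rfl)

theorem Represents.fderiv_apply (hU : IsOpen U) {F : (Fin m → ℂ) → ℂ} {f : SmoothFun U} (h : Represents F f)
    (v : Fin m → ℂ) : Represents (fun x => fderiv ℝ F x v) (dirDeriv hU v f) := by
  refine ⟨contDiffOn_fderiv_apply hU h.1 v, fun x => ?_⟩
  change fderiv ℝ F x v = _
  rw [h.fderiv_eq hU (represents_smoothLift f)]
  rfl

theorem dirDeriv_comm (hU : IsOpen U) (v w : Fin m → ℂ) (f : SmoothFun U) :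
    dirDeriv hU v (dirDeriv hU w f) = dirDeriv hU w (dirDeriv hU v f) := by
  refine SmoothFun.ext_eval fun x => ?_
  have h := (represents_smoothLift f)
  rw [((h.fderiv_apply hU w).fderiv_apply hU v).eval_eq, ((h.fderiv_apply hU v).fderiv_apply hU w).eval_eq]
  have h2 : DifferentiableAt ℝ (fderiv ℝ (smoothLift f)) x :=
    ((h.contDiffAt hU x).fderiv_right (m := 1) (by norm_cast)).differentiableAt one_ne_zero
  rw [fderiv_clm_apply h2 (differentiableAt_const _), fderiv_clm_apply h2 (differentiableAt_const _)]
  have := (h.contDiffAt hU x).isSymmSndFDerivAt (by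
    rw [minSmoothness_of_isRCLikeNormedField]
    norm_cast) v w
  simpa using this

/-- The Wirtinger derivative `∂/∂zⁱ` on smooth functions. -/
noncomputable def dzDerivation (hU : IsOpen U) (i : Fin m) :
    Derivation ℂ (SmoothFun U) (SmoothFun U) :=
  (2⁻¹ : ℂ) • (dirDeriv hU (Pi.single i 1) - Complex.I • dirDeriv hU (Pi.single i Complex.I))

/-- The Wirtinger derivative `∂/∂z̄ⁱ` on smooth functions. -/
noncomputable def dzbarDerivation (hU : IsOpen U) (i : Fin m) :
    Derivation ℂ (SmoothFun U) (SmoothFun U) :=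
  (2⁻¹ : ℂ) • (dirDeriv hU (Pi.single i 1) + Complex.I • dirDeriv hU (Pi.single i Complex.I))

theorem Represents.dz (hU : IsOpen U) {F : (Fin m → ℂ) → ℂ} {f : SmoothFun U}
    (h : Represents F f) (i : Fin m) : Represents (KahlerStar.dz i F) (dzDerivation hU i f) := by
  have h1 := h.fderiv_apply hU (Pi.single i 1)
  have h2 := h.fderiv_apply hU (Pi.single i Complex.I)
  refine ⟨(h1.1.sub (contDiffOn_const.mul h2.1)).div_const 2, fun x => ?_⟩
  change _ = 2⁻¹ * ((dirDeriv hU (Pi.single i 1) f).1 x -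
    Complex.I * (dirDeriv hU (Pi.single i Complex.I) f).1 x)
  rw [← h1.2, ← h2.2, KahlerStar.dz]
  ring

theorem Represents.dzbar (hU : IsOpen U) {F : (Fin m → ℂ) → ℂ} {f : SmoothFun U}
    (h : Represents F f) (i : Fin m) :
    Represents (KahlerStar.dzbar i F) (dzbarDerivation hU i f) := by
  have h1 := h.fderiv_apply hU (Pi.single i 1)
  have h2 := h.fderiv_apply hU (Pi.single i Complex.I)
  refine ⟨(h1.1.add (contDiffOn_const.mul h2.1)).div_const 2, fun x => ?_⟩
  change _ = 2⁻¹ * ((dirDeriv hU (Pi.single i 1) f).1 x +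
    Complex.I * (dirDeriv hU (Pi.single i Complex.I) f).1 x)
  rw [← h1.2, ← h2.2, KahlerStar.dzbar]
  ring

theorem dzDerivation_comm (hU : IsOpen U) (i j : Fin m) :
    Function.Commute (dzDerivation hU i) (dzDerivation hU j) := fun f => by
  simp only [dzDerivation, Derivation.smul_apply, Derivation.sub_apply, Derivation.map_smul, Derivation.map_sub,
    dirDeriv_comm hU (Pi.single i _)]
  module

theorem dzbarDerivation_comm (hU : IsOpen U) (i j : Fin m) :
    Function.Commute (dzbarDerivation hU i) (dzbarDerivation hU j) := fun f => by
  simp only [dzbarDerivation, Derivation.smul_apply, Derivation.add_apply, Derivation.map_smul, Derivation.map_add,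
    dirDeriv_comm hU (Pi.single i _)]
  module

theorem dzbarDerivation_comm_dzDerivation (hU : IsOpen U) (i j : Fin m) :
    Function.Commute (dzbarDerivation hU i) (dzDerivation hU j) := fun f => by
  simp only [dzbarDerivation, dzDerivation, Derivation.smul_apply, Derivation.add_apply,
    Derivation.sub_apply, Derivation.map_smul, Derivation.map_add, Derivation.map_sub, dirDeriv_comm hU (Pi.single i _)]
  module

/-! ### Mixed derivatives as tensors. -/

theorem foldr_iterate_comm {ι A : Type*} {e : A → A} {d : ι → A → A}
    (h : ∀ i, Function.Commute e (d i)) (α : ι → ℕ) (l : List ι) (a : A) :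
    l.foldr (fun i u => (d i)^[α i] u) (e a) = e (l.foldr (fun i u => (d i)^[α i] u) a) := by
  induction l with
  | nil => rfl
  | cons i l ih => rw [List.foldr_cons, List.foldr_cons, ih, ((h i).iterate_right (α i)).eq]

theorem foldr_iterate_congr {ι A : Type*} {d : ι → A → A} {α β : ι → ℕ} {l : List ι}
    (h : ∀ i ∈ l, α i = β i) (a : A) :
    l.foldr (fun i u => (d i)^[α i] u) a = l.foldr (fun i u => (d i)^[β i] u) a := by
  induction l with
  | nil => rfl
  | cons i l ih =>
    rw [List.foldr_cons, List.foldr_cons, ih fun j hj => h j (List.mem_cons_of_mem _ hj),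
      h i List.mem_cons_self]

theorem foldr_iterate_add_single {ι A : Type*} [DecidableEq ι] {d : ι → A → A}
    (h : ∀ i j, Function.Commute (d i) (d j)) (α : ι → ℕ) {l : List ι} (hl : l.Nodup) {j : ι}
    (hj : j ∈ l) (a : A) :
    l.foldr (fun i u => (d i)^[(α + Pi.single j 1 : ι → ℕ) i] u) a =
      d j (l.foldr (fun i u => (d i)^[α i] u) a) := by
  induction l with
  | nil => exact absurd hj List.not_mem_nil
  | cons i l ih =>
    rw [List.foldr_cons, List.foldr_cons]
    obtain ⟨hi, hl'⟩ := List.nodup_cons.1 hl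
    by_cases hij : j = i
    · subst hij
      rw [foldr_iterate_congr (β := α) fun i hi' => ?_]
      · rw [Pi.add_apply, Pi.single_eq_same, Function.iterate_succ_apply']
      · have : i ≠ j := fun h => hi (h ▸ hi')
        simp [this]
    · rw [ih hl' ((List.mem_cons.1 hj).resolve_left hij), ((h j i).iterate_right (α i)).eq]
      simp [Ne.symm hij]

/-- The mixed derivatives of a smooth function on `U`. -/
noncomputable def mixedDerivation (hU : IsOpen U) (f : SmoothFun U) :
    Tensor (Fin m) (SmoothFun U) := fun α β =>
  (List.finRange m).foldr (fun i u => (dzDerivation hU i)^[α i] u)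
    ((List.finRange m).foldr (fun i u => (dzbarDerivation hU i)^[β i] u) f)

theorem mixedDerivation_zero_zero (hU : IsOpen U) (f : SmoothFun U) :
    mixedDerivation hU f 0 0 = f := by
  have h : ∀ (d : Fin m → SmoothFun U → SmoothFun U) (l : List (Fin m)) (f : SmoothFun U),
      l.foldr (fun i u => (d i)^[(0 : Fin m → ℕ) i] u) f = f := fun d l f => by
    induction l with
    | nil => rfl
    | cons i l ih => simp
  rw [mixedDerivation, h, h]

theorem isDifferential_mixedDerivation (hU : IsOpen U) (f : SmoothFun U) :
    (mixedDerivation hU f).IsDifferential (dzDerivation hU) := fun i α _ =>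
  (foldr_iterate_add_single (dzDerivation_comm hU) α (List.nodup_finRange m)
    (List.mem_finRange i) _).symm

/-- The anti-holomorphic derivatives are applied first, so an additional one has to be moved past
the holomorphic ones. -/
theorem isDifferential_swap_mixedDerivation (hU : IsOpen U) (f : SmoothFun U) :
    (mixedDerivation hU f).swap.IsDifferential (dzbarDerivation hU) := fun i α _ => by
  rw [Tensor.swap, Tensor.swap, mixedDerivation, mixedDerivation,
    foldr_iterate_add_single (dzbarDerivation_comm hU) α (List.nodup_finRange m)
    (List.mem_finRange i), foldr_iterate_comm (dzbarDerivation_comm_dzDerivation hU i)]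

theorem Represents.foldr {F : (Fin m → ℂ) → ℂ} {f : SmoothFun U} (h : Represents F f)
    {e : Fin m → ((Fin m → ℂ) → ℂ) → (Fin m → ℂ) → ℂ} {d : Fin m → SmoothFun U → SmoothFun U}
    (hd : ∀ {F f} i, Represents F f → Represents (e i F) (d i f)) (α : Fin m → ℕ)
    (l : List (Fin m)) : Represents (l.foldr (fun i u => (e i)^[α i] u) F)
      (l.foldr (fun i u => (d i)^[α i] u) f) := by
  induction l with
  | nil => exact h
  | cons i l ih =>
    rw [List.foldr_cons, List.foldr_cons]
    induction α i with
    | zero => exact ih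
    | succ k ihk =>
      rw [Function.iterate_succ_apply', Function.iterate_succ_apply']
      exact hd i ihk

theorem Represents.mixedDeriv (hU : IsOpen U) {F : (Fin m → ℂ) → ℂ} {f : SmoothFun U}
    (h : Represents F f) (α β : Fin m → ℕ) :
    Represents (KahlerStar.mixedDeriv α β F) (mixedDerivation hU f α β) :=
  (h.foldr (fun i h => h.dzbar hU i) β _).foldr (fun i h => h.dz hU i) α _

end

/-! ## The operator `D` on smooth functions -/

/-- The weights have the form `u - 1` with `u` natural, so potentials of weight below `-1` never
enter. -/
theorem weightedSum_congr {n : ℕ} {M A : Type*} [Fintype M] [DecidableEq M] [CommRing A]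
    [Algebra ℂ A] (N k : ℕ) {X Y : Fin n → Tensor M A} {ψ φ : ℤ → Tensor M A} {γ δ : M → M → A}
    (hX : X = Y) (hψ : ∀ w, -1 ≤ w → ψ w = φ w) (hγ : γ = δ) :
    weightedSum N k X ψ γ = weightedSum N k Y φ δ := by
  subst hX hγ
  have h : ∀ (a : ℕ) (u : Fin a → ℕ), weightTensor X ψ u = weightTensor X φ u := fun a u => by
    unfold weightTensor
    congr 1
    funext i
    exact hψ _ (by omega)
  simp only [weightedSum, h]

/-- A derivation applied to the entries of the inverse of a matrix. -/
theorem derivation_matrix_inv {M A : Type*} [Fintype M] [DecidableEq M] [CommRing A] [Algebra ℂ A]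
    (d : Derivation ℂ A A) {g γ : Matrix M M A} (h : γ * g = 1) (s r : M) :
    d (γ s r) = ∑ p, ∑ q, γ s p * -d (g p q) * γ q r := by
  have h' : g * γ = 1 := mul_eq_one_comm.1 h
  -- This is the derivative of `γ * g = 1`; multiplication by `γ` from the right then isolates `d
  -- γ`.
  have h1 : ∀ q, ∑ t, d (γ s t) * g t q = ∑ p, γ s p * -d (g p q) := fun q => by
    have := congrArg d (congrFun (congrFun h s) q)
    rw [Matrix.mul_apply, map_sum, Matrix.one_apply] at this
    simp only [Derivation.leibniz, smul_eq_mul] at this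
    rw [Finset.sum_add_distrib, apply_ite d, Derivation.map_one_eq_zero, map_zero, ite_self] at this
    simp only [mul_neg, Finset.sum_neg_distrib]
    rw [eq_neg_iff_add_eq_zero, add_comm, ← this]
    simp only [mul_comm]
  calc d (γ s r) = ∑ t, d (γ s t) * (g * γ) t r := by simp [h', Matrix.one_apply]
    _ = ∑ q, (∑ t, d (γ s t) * g t q) * γ q r := by
      simp only [Matrix.mul_apply, Finset.mul_sum, Finset.sum_mul, mul_assoc]
      exact Finset.sum_comm
    _ = _ := by
      simp only [h1, Finset.sum_mul]
      exact Finset.sum_comm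

section

variable {m : ℕ} {U : Set (Fin m → ℂ)}

/-- The matrix `g_{p q̄}` of smooth functions for the potential `φ`. -/
noncomputable def smoothMetric (hU : IsOpen U) (φ : SmoothFun U) :
    Matrix (Fin m) (Fin m) (SmoothFun U) :=
  Matrix.of fun p q => dzDerivation hU p (dzbarDerivation hU q φ)

/-- The coefficients of the operator `D` on formal smooth functions. -/
noncomputable def coeffD (hU : IsOpen U) (φ : ℤ → SmoothFun U) {n : ℕ} (N : ℕ)
    (a : Fin n → ℕ → SmoothFun U) (j : ℕ) : SmoothFun U :=
  ∑ p ∈ Finset.Nat.antidiagonalTuple (n + 1) j, weightedSum N (p 0)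
    (fun k => mixedDerivation hU (a k (p k.succ))) (fun w => mixedDerivation hU (-φ w))
    fun s r => (smoothMetric hU (φ (-1)))⁻¹ s r

theorem mixedDerivation_single_single (hU : IsOpen U) (f : SmoothFun U) (p q : Fin m) :
    mixedDerivation hU f (Pi.single p 1) (Pi.single q 1) =
      dzDerivation hU p (dzbarDerivation hU q f) := by
  have h1 := isDifferential_mixedDerivation hU f p 0 (Pi.single q 1)
  have h2 := isDifferential_swap_mixedDerivation hU f q 0 0
  rw [zero_add] at h1 h2
  simp only [Tensor.swap, mixedDerivation_zero_zero] at h2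
  rw [← h1, ← h2]

variable {Φ : ℤ → (Fin m → ℂ) → ℂ} {φ : ℤ → SmoothFun U}

theorem map_smoothMetric (hU : IsOpen U) (hφ : ∀ w, -1 ≤ w → Represents (Φ w) (φ w)) (x : U) :
    (smoothMetric hU (φ (-1))).map (SmoothFun.eval x) = metric Φ x := by
  ext p q
  exact ((hφ (-1) le_rfl).dzbar hU q |>.dz hU p).eval_eq x

theorem smoothMetric_inv_mul (hU : IsOpen U) (hφ : ∀ w, -1 ≤ w → Represents (Φ w) (φ w))
    (hpos : ∀ x ∈ U, (metric Φ x).PosDef) :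
    (smoothMetric hU (φ (-1)))⁻¹ * smoothMetric hU (φ (-1)) = 1 := by
  refine Matrix.nonsing_inv_mul _ (SmoothFun.isUnit fun x => ?_)
  have h := AlgHom.map_det (SmoothFun.eval x) (smoothMetric hU (φ (-1)))
  rw [h]
  have h' : (SmoothFun.eval x).mapMatrix (smoothMetric hU (φ (-1))) = metric Φ x :=
    map_smoothMetric hU hφ x
  rw [h']
  exact (hpos x x.2).det_pos.ne'

theorem eval_smoothMetric_inv (hU : IsOpen U) (hφ : ∀ w, -1 ≤ w → Represents (Φ w) (φ w))
    (hpos : ∀ x ∈ U, (metric Φ x).PosDef) (x : U) (s r : Fin m) :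
    SmoothFun.eval x ((smoothMetric hU (φ (-1)))⁻¹ s r) = (metric Φ x)⁻¹ s r := by
  have h := congrArg (SmoothFun.eval x).mapMatrix (smoothMetric_inv_mul hU hφ hpos)
  rw [map_mul, map_one] at h
  have h' : (SmoothFun.eval x).mapMatrix (smoothMetric hU (φ (-1))) = metric Φ x :=
    map_smoothMetric hU hφ x
  rw [h'] at h
  rw [Matrix.inv_eq_left_inv h]
  rfl

theorem Represents.neg {F : (Fin m → ℂ) → ℂ} {f : SmoothFun U} (h : Represents F f) :
    Represents (-F) (-f) :=
  ⟨h.1.neg, fun x => by simp [h.2 x]⟩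

/-- In particular the value does not depend on the truncation `N` once `3 * j < N`. -/
theorem eval_coeffD (hU : IsOpen U) (hφ : ∀ w, -1 ≤ w → Represents (Φ w) (φ w))
    (hpos : ∀ x ∈ U, (metric Φ x).PosDef) {n N j : ℕ} (hj : 3 * j < N) {F : Fin n → FormalFun m}
    {a : Fin n → ℕ → SmoothFun U} (ha : ∀ k i, Represents (PowerSeries.coeff i (F k)) (a k i))
    (x : U) : SmoothFun.eval x (coeffD hU φ N a j) = PowerSeries.coeff j (D Φ F) x := by
  rw [coeffD, map_sum, D, PowerSeries.coeff_mk, Finset.sum_apply]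
  refine Finset.sum_congr rfl fun p hp => ?_
  have hp' : p 0 ≤ j := by
    rw [← Finset.Nat.mem_antidiagonalTuple.1 hp]
    exact Finset.single_le_sum (fun _ _ => Nat.zero_le _) (Finset.mem_univ 0)
  rw [map_weightedSum, Dk_eq_weightedSum (show 3 * p 0 < N by omega)]
  refine weightedSum_congr _ _ ?_ (fun w hw => ?_) ?_
  · funext k α β
    exact ((ha k _).mixedDeriv hU α β).eval_eq x
  · funext α β
    exact ((hφ w hw).neg.mixedDeriv hU α β).eval_eq x
  · funext s r
    exact eval_smoothMetric_inv hU hφ hpos x s r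

theorem represents_coeff_D (hU : IsOpen U) (hφ : ∀ w, -1 ≤ w → Represents (Φ w) (φ w))
    (hpos : ∀ x ∈ U, (metric Φ x).PosDef) {n : ℕ} {F : Fin n → FormalFun m}
    {a : Fin n → ℕ → SmoothFun U} (ha : ∀ k i, Represents (PowerSeries.coeff i (F k)) (a k i))
    (j : ℕ) : Represents (PowerSeries.coeff j (D Φ F)) (coeffD hU φ (3 * j + 1) a j) := by
  have h : ∀ x : U, PowerSeries.coeff j (D Φ F) x = (coeffD hU φ (3 * j + 1) a j).1 x :=
    fun x => (eval_coeffD hU hφ hpos (by omega) ha x).symm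
  refine ⟨?_, h⟩
  have hl := represents_smoothLift (coeffD hU φ (3 * j + 1) a j)
  exact hl.1.congr fun x hx => (h ⟨x, hx⟩).trans (hl.2 ⟨x, hx⟩).symm

/-- The associativity of the operator `D` on formal smooth functions. -/
theorem coeffD_assoc (hU : IsOpen U) (hφ : ∀ w, -1 ≤ w → Represents (Φ w) (φ w))
    (hpos : ∀ x ∈ U, (metric Φ x).PosDef) {N j : ℕ} (hj : 3 * j < N)
    (a₁ a₂ a₃ : ℕ → SmoothFun U) :
    (∀ b : ℕ → SmoothFun U, (∀ i, 3 * i < N → b i = coeffD hU φ N ![a₂, a₃] i) →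
      coeffD hU φ N ![a₁, a₂, a₃] j = coeffD hU φ N ![a₁, b] j) ∧
    (∀ b : ℕ → SmoothFun U, (∀ i, 3 * i < N → b i = coeffD hU φ N ![a₁, a₂] i) →
      coeffD hU φ N ![a₁, a₂, a₃] j = coeffD hU φ N ![b, a₃] j) := by
  have hγ := smoothMetric_inv_mul hU hφ hpos
  let T : (ℕ → SmoothFun U) → ℕ → Tensor (Fin m) (SmoothFun U) := fun a i => mixedDerivation hU (a i)
  have h2 : ∀ (a b : ℕ → SmoothFun U) (p : Fin 3 → ℕ),
      (fun k : Fin 2 => mixedDerivation hU ((![a, b] : Fin 2 → _) k (p k.succ))) =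
        fun k => (![T a, T b] : Fin 2 → _) k (p k.succ) := fun a b p => by
    funext k
    fin_cases k <;> rfl
  have h3 : ∀ (a b c : ℕ → SmoothFun U) (p : Fin 4 → ℕ),
      (fun k : Fin 3 => mixedDerivation hU ((![a, b, c] : Fin 3 → _) k (p k.succ))) =
        fun k => (![T a, T b, T c] : Fin 3 → _) k (p k.succ) := fun a b c p => by
    funext k
    fin_cases k <;> rfl
  -- The sign of `-Φ₋₁` matches the sign in the derivative of an inverse matrix, so a differentiated
  -- propagator yields a trivalent vertex of weight `-1`.
  have hg : ∀ p q, mixedDerivation hU (-φ (-1)) (Pi.single p 1) (Pi.single q 1) =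
      -smoothMetric hU (φ (-1)) p q := fun p q => by
    rw [mixedDerivation_single_single, map_neg, map_neg]
    rfl
  refine ⟨fun b hb => ?_, fun b hb => ?_⟩
  · simp only [coeffD, h2, h3] at hb ⊢
    refine sum_weightedSum_assoc (d := dzDerivation hU)
      (fun w => isDifferential_mixedDerivation hU _) (fun i s r => ?_) (T a₁)
      (fun i => isDifferential_mixedDerivation hU _) (fun i => isDifferential_mixedDerivation hU _)
      (fun i => isDifferential_mixedDerivation hU _) (fun i hi => ?_) hj
    · rw [derivation_matrix_inv _ hγ]
      refine Finset.sum_congr rfl fun p _ => Finset.sum_congr rfl fun q _ => ?_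
      rw [← isDifferential_mixedDerivation hU (-φ (-1)) i, hg, map_neg]
    · exact (mixedDerivation_zero_zero hU _).trans (hb i hi)
  · simp only [coeffD, h2, h3] at hb ⊢
    refine sum_weightedSum_assoc_swap (d := dzbarDerivation hU)
      (fun w => isDifferential_swap_mixedDerivation hU _) (fun i s r => ?_) (T a₃)
      (fun i => isDifferential_swap_mixedDerivation hU _)
      (fun i => isDifferential_swap_mixedDerivation hU _)
      (fun i => isDifferential_swap_mixedDerivation hU _) (fun i hi => ?_) hj
    · rw [derivation_matrix_inv _ hγ]
      refine Finset.sum_congr rfl fun p _ => Finset.sum_congr rfl fun q _ => ?_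
      have h := isDifferential_swap_mixedDerivation hU (-φ (-1)) i (Pi.single q 1) (Pi.single p 1)
      rw [Tensor.swap, Tensor.swap, hg, map_neg] at h
      rw [h]
    · exact (mixedDerivation_zero_zero hU _).trans (hb i hi)

end

end KahlerStar

/-! ### Associativity of the operator `D`. -/

theorem theorem6p1 {m : ℕ} {U : Set (Fin m → ℂ)} (hU : IsOpen U)
    (Φ : ℤ → (Fin m → ℂ) → ℂ)
    (hΦ : ∀ k : ℤ, -1 ≤ k → ContDiffOn ℝ ∞ (Φ k) U)
    (hpos : ∀ x ∈ U, (KahlerStar.metric Φ x).PosDef)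
    (f₁ f₂ f₃ : KahlerStar.FormalFun m)
    (hf₁ : f₁.SmoothOn U) (hf₂ : f₂.SmoothOn U) (hf₃ : f₃.SmoothOn U) :
    (KahlerStar.D Φ ![f₁, KahlerStar.D Φ ![f₂, f₃]]).EqOn (KahlerStar.D Φ ![f₁, f₂, f₃]) U ∧
    (KahlerStar.D Φ ![f₁, f₂, f₃]).EqOn (KahlerStar.D Φ ![KahlerStar.D Φ ![f₁, f₂], f₃]) U := by
  choose a₁ ha₁ using fun i => KahlerStar.exists_represents (hf₁ i)
  choose a₂ ha₂ using fun i => KahlerStar.exists_represents (hf₂ i)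
  choose a₃ ha₃ using fun i => KahlerStar.exists_represents (hf₃ i)
  have hφ' : ∀ w, ∃ φ : KahlerStar.SmoothFun U, -1 ≤ w → KahlerStar.Represents (Φ w) φ := fun w => by
    by_cases hw : -1 ≤ w
    · obtain ⟨φ, hφ⟩ := KahlerStar.exists_represents (hΦ w hw)
      exact ⟨φ, fun _ => hφ⟩
    -- Weights below `-1` do not occur, so any default value will do.
    · exact ⟨0, fun h => absurd h hw⟩
  choose φ hφ using hφ'
  have pair : ∀ {F G : KahlerStar.FormalFun m} {a b : ℕ → KahlerStar.SmoothFun U},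
      (∀ i, KahlerStar.Represents (PowerSeries.coeff i F) (a i)) →
      (∀ i, KahlerStar.Represents (PowerSeries.coeff i G) (b i)) →
      ∀ (k : Fin 2) (i : ℕ), KahlerStar.Represents (PowerSeries.coeff i (![F, G] k))
        ((![a, b] : Fin 2 → _) k i) := by
    intro F G a b ha hb k i
    fin_cases k
    · exact ha i
    · exact hb i
  have triple : ∀ (k : Fin 3) (i : ℕ), KahlerStar.Represents
      (PowerSeries.coeff i (![f₁, f₂, f₃] k)) ((![a₁, a₂, a₃] : Fin 3 → _) k i) := by
    intro k i
    fin_cases k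
    · exact ha₁ i
    · exact ha₂ i
    · exact ha₃ i
  -- The inner operator is represented with the truncation `3 * i + 1` for its `i`-th coefficient,
  -- whereas associativity uses a common `N`; both evaluate to the coefficient of `D`.
  have hN : ∀ {F G : KahlerStar.FormalFun m} {a b : ℕ → KahlerStar.SmoothFun U},
      (∀ i, KahlerStar.Represents (PowerSeries.coeff i F) (a i)) →
      (∀ i, KahlerStar.Represents (PowerSeries.coeff i G) (b i)) → ∀ N i, 3 * i < N →
      KahlerStar.coeffD hU φ (3 * i + 1) ![a, b] i = KahlerStar.coeffD hU φ N ![a, b] i :=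
    fun ha hb N i hi => KahlerStar.SmoothFun.ext_eval fun x => by
      rw [KahlerStar.eval_coeffD hU hφ hpos (by omega) (pair ha hb),
        KahlerStar.eval_coeffD hU hφ hpos hi (pair ha hb)]
  refine ⟨fun j x hx => ?_, fun j x hx => ?_⟩
  · have h := (KahlerStar.coeffD_assoc hU hφ hpos (N := 3 * j + 1) (j := j) (by omega) a₁ a₂ a₃).1
      _ fun i => hN ha₂ ha₃ _ i
    have h' := congrArg (KahlerStar.SmoothFun.eval ⟨x, hx⟩) h
    rw [KahlerStar.eval_coeffD hU hφ hpos (by omega) triple,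
      KahlerStar.eval_coeffD hU hφ hpos (by omega)
        (pair ha₁ (KahlerStar.represents_coeff_D hU hφ hpos (pair ha₂ ha₃)))] at h'
    exact h'.symm
  · have h := (KahlerStar.coeffD_assoc hU hφ hpos (N := 3 * j + 1) (j := j) (by omega) a₁ a₂ a₃).2
      _ fun i => hN ha₁ ha₂ _ i
    have h' := congrArg (KahlerStar.SmoothFun.eval ⟨x, hx⟩) h
    rw [KahlerStar.eval_coeffD hU hφ hpos (by omega) triple,
      KahlerStar.eval_coeffD hU hφ hpos (by omega)
        (pair (KahlerStar.represents_coeff_D hU hφ hpos (pair ha₁ ha₂)) ha₃)] at h'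
    exact h'
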